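/- All graphs are finite and simple; $n$ and $m$ are the numbers of vertices and edges of $G$, and the arboricity $\alpha$ is the least number of edge-disjoint spanning forests into which $G$ decomposes. A vertex $v$ dominates $w$ if $N(w)\subseteq N(v)$. A cycle $v,a,w,b$ of length $4$ is dominated if one of $v,w$ dominates the other or one of $a,b$ dominates the other; $G$ is $C_4$-dominated if all its $4$-cycles are dominated. A degree-ordered graph is a graph with a total order $<$ of its vertices such that $v<w$ implies $d(v)\le d(w)$. For $w<v$ put $L(v,w)=\{a\in N(v)\cap N(w): a<v\}$; if $L(v,w)\ne\emptyset$ then $S=(v,w,L(v,w))$ is called a triple, and it is unsafe if $v$ does not dominate $w$. Write $a\to_S b$ if $b$ is the immediate successor of $a$ in $L(v,w)$ with respect to $<$. The unsafe domination digraph $U(G)$ has the vertices of $G$ and the edges $a\to b$ such that $a\to_S b$ for some unsafe triple $S$. Consider the following algorithm, whose input is a degree-ordered triangle-free graph $G$. Set $\mathit{UNSAFE}:=\emptyset$, let $U$ be the digraph on $V(G)$ without edges, and set $d^<(w):=|N(w)|$ for all $w$. For each vertex $v$, in decreasing order, do the following. 1. Let $\mathit{REACH}$ be the set of all $w$ with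 $d^<(w)>0$ such that there is a path from $w$ to $v$ in $U$. 2. For each triple $S=(v,w,L)$ with $|L|\ne d^<(w)$, or with $w\in\mathit{UNSAFE}$ and $w\notin\mathit{REACH}$: for each pair $a\to_S b$, if $N^+_U(a)\not\subseteq\{b\}$, or if $N^+_U(a)=\emptyset$ and $b$ does not dominate $a$, output $v,a,w,b$ and halt; otherwise add $a\to b$ to $U$. After all pairs of $S$, set $\mathit{UNSAFE}:=\mathit{UNSAFE}\cup L$. 3. Decrease $d^<(w)$ by $1$ for every $w\in N(v)$. At the end, output $U$. The orders in which step 2 examines the triples, and the pairs of each triple, are arbitrary. Theorem. (a) On every degree-ordered triangle-free graph $G$, and whatever those orders, the algorithm either outputs $v,a,w,b$ that form a non-dominated $4$-cycle of $G$ (so $G$ is not $C_4$-dominated), or outputs $U(G)$, and then $G$ is $C_4$-dominated. (b) The algorithm can be implemented on a random access machine (addition, truncated subtraction and array access in unit time) so that, on every such $G$ given by adjacency lists with the vertices numbered along $<$, it takes $O(n+\alpha m)$ time and $O(n+m)$ space, the space being counted in memory words that hold numbers of size $O(n+m)$. More precisely, there are a program and a constant $C$ such that on every such input the program outputs a possible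 output of the algorithm, takes at most $C(n+\alpha m+1)$ steps, and uses a fixed number of arrays of at most $C(n+m+1)$ words. If $n>0$ and $G$ has no isolated vertices, the time is at most $C\alpha m$. (c) There is a program for the same machine that decides, within the same time and space bounds, whether an arbitrary graph, given by adjacency lists, is triangle-free and $C_4$-dominated. -/

import Mathlib

namespace C4Dom

universe u

/-! ### Graphs -/

section Graphs

variable {V : Type u}

/-- `v` dominates `w`: `N(w) ⊆ N(v)`. -/
def Dominates (G : SimpleGraph V) (v w : V) : Prop :=
  G.neighborSet w ⊆ G.neighborSet v

/-- `v, a, w, b` is a cycle of length four of `G` (in this cyclic order). -/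
structure IsC4 (G : SimpleGraph V) (v a w b : V) : Prop where
  adj₁ : G.Adj v a
  adj₂ : G.Adj a w
  adj₃ : G.Adj w b
  adj₄ : G.Adj b v
  ne₁ : v ≠ w
  ne₂ : a ≠ b

/-- `v` and `w` are dom-comparable. -/
def DomComparable (G : SimpleGraph V) (v w : V) : Prop :=
  Dominates G v w ∨ Dominates G w v

/-- `v, a, w, b` is a non-dominated `C₄` of `G`: no two of its vertices are dom-comparable
(adjacent vertices never are, so only the two opposite pairs matter). -/
def NonDominatedC4 (G : SimpleGraph V) (v a w b : V) : Prop :=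
  IsC4 G v a w b ∧ ¬ DomComparable G v w ∧ ¬ DomComparable G a b

/-- `G` is `C₄`-dominated: every `C₄` has two dom-comparable opposite vertices. -/
def C4Dominated (G : SimpleGraph V) : Prop :=
  ∀ v a w b : V, IsC4 G v a w b → DomComparable G v w ∨ DomComparable G a b

/-- The order of `V` is a degree ordering of `G`. -/
def IsDegreeOrdered [LT V] (G : SimpleGraph V) : Prop :=
  ∀ v w : V, v < w → (G.neighborSet v).ncard ≤ (G.neighborSet w).ncard

/-- The arboricity: the least number of edge-disjoint spanning forests that decompose `G`. -/
noncomputable def arboricity (G : SimpleGraph V) : ℕ :=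
  sInf {k : ℕ | ∃ F : Fin k → SimpleGraph V,
    (∀ i, (F i).IsAcyclic) ∧ (∀ i j, i ≠ j → Disjoint (F i) (F j)) ∧ (⨆ i, F i) = G}

/-- The number of edges. -/
noncomputable def numEdges (G : SimpleGraph V) : ℕ :=
  G.edgeSet.ncard

variable [LinearOrder V]

/-- The least common neighborhood `L(v, w)`; it is used for `w < v` only. -/
def leastCommon (G : SimpleGraph V) (v w : V) : Set V :=
  {a | G.Adj v a ∧ G.Adj w a ∧ a < v}

/-- `(v, w, L(v, w))` is a triple of the squares family of `G`. -/
def IsTriple (G : SimpleGraph V) (v w : V) : Prop :=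
  w < v ∧ (leastCommon G v w).Nonempty

/-- `a →_S b` for the triple `S = (v, w, L(v, w))`: `b` is the successor of `a` in `L(v, w)`. -/
def IsNext (G : SimpleGraph V) (v w a b : V) : Prop :=
  a ∈ leastCommon G v w ∧ b ∈ leastCommon G v w ∧ a < b ∧
    ¬ ∃ c ∈ leastCommon G v w, a < c ∧ c < b

/-- The unsafe domination digraph `U(G)`: `a → b` if and only if `a →_S b` for some unsafe
triple `S`, i.e. some triple whose high vertex does not dominate its low vertex. -/
def unsafeDigraph (G : SimpleGraph V) : Digraph V where
  Adj a b := ∃ v w, IsTriple G v w ∧ ¬ Dominates G v w ∧ IsNext G v w a b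

end Graphs

/-! ### The algorithm -/

section Algorithm

variable {V : Type u}

/-- The orders in which the two "for each" loops examine their elements, which the algorithm
leaves unspecified: `lows v` for the low vertices of the triples with high vertex `v`, and
`pairs v w` for the pairs `(a, b)` of the triple `(v, w, L(v, w))`.  The loops go through those
elements of these lists that the algorithm asks for. -/
structure Schedule (V : Type u) where
  lows : V → List V
  lows_nodup : ∀ v, (lows v).Nodup
  mem_lows : ∀ v w, w ∈ lows v
  pairs : V → V → List (V × V)
  pairs_nodup : ∀ v w, (pairs v w).Nodup
  mem_pairs : ∀ v w p, p ∈ pairs v w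

/-- The variables `UNSAFE`, `U` and `d^<` of the algorithm. -/
structure AlgState (V : Type u) where
  marked : Set V
  dig : Digraph V
  dlt : V → ℕ

/-- The algorithm halts with a quadruple `v, a, w, b` (`Except.error`) or goes on. -/
abbrev Outcome (V σ : Type u) := Except (V × V × V × V) σ

/-- The digraph `U` with the edge `a → b` added. -/
def addEdge (U : Digraph V) (a b : V) : Digraph V where
  Adj x y := U.Adj x y ∨ (x = a ∧ y = b)

open Classical in
/-- The innermost loop, for the triple `(v, w, L(v, w))` and a list of pairs `a →_S b`. -/
noncomputable def checkPairs (G : SimpleGraph V) (v w : V) :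
    List (V × V) → Digraph V → Outcome V (Digraph V)
  | [], U => .ok U
  | (a, b) :: l, U =>
    if ¬ {c | U.Adj a c} ⊆ {b} then .error (v, a, w, b)
    else if {c | U.Adj a c} = ∅ ∧ ¬ Dominates G b a then .error (v, a, w, b)
    else checkPairs G v w l (addEdge U a b)

variable [LinearOrder V]

/-- The set `REACH` for the vertex `v`. -/
def reach (st : AlgState V) (v : V) : Set V :=
  {w | 0 < st.dlt w ∧ Relation.ReflTransGen st.dig.Adj w v}

/-- The test that selects the triples with high vertex `v` to be checked. -/
def Selected (G : SimpleGraph V) (st : AlgState V) (v w : V) : Prop :=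
  IsTriple G v w ∧
    ((leastCommon G v w).ncard ≠ st.dlt w ∨ (w ∈ st.marked ∧ w ∉ reach st v))

open Classical in
/-- The loop over the selected triples with high vertex `v`, given by a list of low vertices. -/
noncomputable def checkTriples (G : SimpleGraph V) (sch : Schedule V) (v : V) :
    List V → AlgState V → Outcome V (AlgState V)
  | [], st => .ok st
  | w :: l, st =>
    match checkPairs G v w ((sch.pairs v w).filter fun p => IsNext G v w p.1 p.2) st.dig with
    | .error c => .error c
    | .ok U => checkTriples G sch v l
        { st with dig := U, marked := st.marked ∪ leastCommon G v w }

open Classical in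
/-- The outer loop, over a list of vertices. -/
noncomputable def mainLoop (G : SimpleGraph V) (sch : Schedule V) :
    List V → AlgState V → Outcome V (AlgState V)
  | [], st => .ok st
  | v :: l, st =>
    match checkTriples G sch v ((sch.lows v).filter fun w => Selected G st v w) st with
    | .error c => .error c
    | .ok st' => mainLoop G sch l
        { st' with dlt := fun w => if G.Adj v w then st'.dlt w - 1 else st'.dlt w }

/-- The algorithm: its output is a quadruple `v, a, w, b` of vertices or the digraph `U`. -/
noncomputable def algorithm [Fintype V] (G : SimpleGraph V) (sch : Schedule V) :
    Outcome V (Digraph V) :=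
  match mainLoop G sch ((Finset.univ : Finset V).sort (· ≥ ·))
      { marked := ∅, dig := ⟨fun _ _ => False⟩, dlt := fun v => (G.neighborSet v).ncard } with
  | .error c => .error c
  | .ok st => .ok st.dig

end Algorithm

/-! ### The machine model

A random access machine with registers `0, 1, …` and arrays `0, 1, …` of words, programmed in a
structured language.  A program is a finite text, so that it uses a fixed number of registers and
of arrays.  The machine has a *size* `W`: every array has the `W` cells `0, …, W - 1`, and every
word holds a number less than `W`, that is, `⌈log₂ W⌉` bits.  An execution that leaves these bounds
is stuck.  Hence a program that halts on the machine of size `W` uses `O(W)` words of memory,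
input and output included. -/

section Machine

inductive Exp where
  | lit (c : ℕ)
  | reg (x : ℕ)
  | cell (A : ℕ) (i : Exp)
  | plus (e f : Exp)
  | minus (e f : Exp)

/-- The tests `e ≠ 0` are the only ones; `e < f` is the test `f - e ≠ 0`. -/
inductive Cmd where
  | skip
  | setReg (x : ℕ) (e : Exp)
  | setCell (A : ℕ) (i e : Exp)
  | seq (P Q : Cmd)
  | ifNonzero (e : Exp) (P Q : Cmd)
  | whileNonzero (e : Exp) (P : Cmd)

structure Store where
  reg : ℕ → ℕ
  arr : ℕ → ℕ → ℕ

def Store.setReg (s : Store) (x k : ℕ) : Store :=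
  { s with reg := Function.update s.reg x k }

def Store.setCell (s : Store) (A i k : ℕ) : Store :=
  { s with arr := Function.update s.arr A (Function.update (s.arr A) i k) }

/-- The value of an expression; `minus` is truncated subtraction. -/
def Exp.val (s : Store) : Exp → ℕ
  | lit c => c
  | reg x => s.reg x
  | cell A i => s.arr A (i.val s)
  | plus e f => e.val s + f.val s
  | minus e f => e.val s - f.val s

/-- The time to evaluate an expression: one step for each operation in it. -/
def Exp.cost : Exp → ℕ
  | lit _ => 1
  | reg _ => 1
  | cell _ i => i.cost + 1
  | plus e f => e.cost + f.cost + 1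
  | minus e f => e.cost + f.cost + 1

/-- All values (hence all addresses) in the evaluation of the expression are less than `W`. -/
def Exp.Fits (W : ℕ) (s : Store) : Exp → Prop
  | lit c => c < W
  | reg x => s.reg x < W
  | cell A i => i.Fits W s ∧ s.arr A (i.val s) < W
  | plus e f => e.Fits W s ∧ f.Fits W s ∧ e.val s + f.val s < W
  | minus e f => e.Fits W s ∧ f.Fits W s

/-- `Exec W P s t s'`: on the machine of size `W`, the program `P` started in the store `s`
halts after `t` steps in the store `s'`. -/
inductive Exec (W : ℕ) : Cmd → Store → ℕ → Store → Prop
  | skip (s : Store) : Exec W .skip s 1 s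
  | setReg (s : Store) (x : ℕ) (e : Exp) (he : e.Fits W s) :
      Exec W (.setReg x e) s (e.cost + 1) (s.setReg x (e.val s))
  | setCell (s : Store) (A : ℕ) (i e : Exp) (hi : i.Fits W s) (he : e.Fits W s) :
      Exec W (.setCell A i e) s (i.cost + e.cost + 1) (s.setCell A (i.val s) (e.val s))
  | seq {P Q : Cmd} {s s₁ s₂ : Store} {t₁ t₂ : ℕ} (hP : Exec W P s t₁ s₁)
      (hQ : Exec W Q s₁ t₂ s₂) : Exec W (.seq P Q) s (t₁ + t₂) s₂
  | ifTrue {e : Exp} {P Q : Cmd} {s s' : Store} {t : ℕ} (he : e.Fits W s) (h : e.val s ≠ 0)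
      (hP : Exec W P s t s') : Exec W (.ifNonzero e P Q) s (e.cost + 1 + t) s'
  | ifFalse {e : Exp} {P Q : Cmd} {s s' : Store} {t : ℕ} (he : e.Fits W s) (h : e.val s = 0)
      (hQ : Exec W Q s t s') : Exec W (.ifNonzero e P Q) s (e.cost + 1 + t) s'
  | whileFalse {e : Exp} {P : Cmd} {s : Store} (he : e.Fits W s) (h : e.val s = 0) :
      Exec W (.whileNonzero e P) s (e.cost + 1) s
  | whileTrue {e : Exp} {P : Cmd} {s s₁ s₂ : Store} {t₁ t₂ : ℕ} (he : e.Fits W s)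
      (h : e.val s ≠ 0) (hP : Exec W P s t₁ s₁) (hw : Exec W (.whileNonzero e P) s₁ t₂ s₂) :
      Exec W (.whileNonzero e P) s (e.cost + 1 + t₁ + t₂) s₂

/-- The store `s` is an input that represents the graph `G` with vertices `0, …, n - 1` by
adjacency lists: register `0` holds `n`, and the neighbors of `v` are listed in array `1`, once
each and in any order, from cell `s.arr 0 v` up to, but not including, cell `s.arr 0 (v + 1)`.
Everything else is zero. -/
structure Encodes {n : ℕ} (G : SimpleGraph (Fin n)) (s : Store) : Prop where
  size : s.reg 0 = n
  reg_eq_zero : ∀ x, x ≠ 0 → s.reg x = 0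
  offset_zero : s.arr 0 0 = 0
  offset_le : ∀ v : Fin n, s.arr 0 v ≤ s.arr 0 (v + 1)
  offset_eq_zero : ∀ i, n < i → s.arr 0 i = 0
  list_lt : ∀ k, k < s.arr 0 n → s.arr 1 k < n
  list_injOn : ∀ v : Fin n, Set.InjOn (s.arr 1) (Set.Ico (s.arr 0 v) (s.arr 0 (v + 1)))
  mem_list : ∀ v w : Fin n,
    G.Adj v w ↔ ∃ k ∈ Set.Ico (s.arr 0 v) (s.arr 0 (v + 1)), s.arr 1 k = w
  list_eq_zero : ∀ k, s.arr 0 n ≤ k → s.arr 1 k = 0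
  arr_eq_zero : ∀ A, 2 ≤ A → ∀ i, s.arr A i = 0

/-- How an output of the algorithm is represented in a final store: either register `0` holds `1`
and registers `1, …, 4` hold the quadruple, or register `0` holds `0` and cell `a` of array `2`
holds `b + 1` if `b` is the (only) out-neighbor of `a`, and `0` if `a` has no out-neighbor. -/
def Represents {n : ℕ} (s : Store) : Outcome (Fin n) (Digraph (Fin n)) → Prop
  | .error (v, a, w, b) =>
      s.reg 0 = 1 ∧ s.reg 1 = v ∧ s.reg 2 = a ∧ s.reg 3 = w ∧ s.reg 4 = b
  | .ok U => s.reg 0 = 0 ∧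
      ∀ a : Fin n, s.arr 2 a ≤ n ∧ ∀ b : Fin n, U.Adj a b ↔ s.arr 2 a = b + 1

/-- On the adjacency lists of `G`, `P` halts with a store satisfying `post`, using at most
`C (n + m + 1)` words per array, each less than `C (n + m + 1)`, and at most `C (n + αm + 1)`
steps, and also at most `C α m` steps if there are vertices and none of them is isolated. -/
def RunsWithin (P : Cmd) (C : ℕ) {n : ℕ} (G : SimpleGraph (Fin n)) (post : Store → Prop) : Prop :=
  ∀ s : Store, Encodes G s → ∃ (t : ℕ) (s' : Store),
    Exec (C * (n + numEdges G + 1)) P s t s' ∧ post s' ∧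
    t ≤ C * (n + arboricity G * numEdges G + 1) ∧
    (0 < n → (∀ v, ∃ w, G.Adj v w) → t ≤ C * (arboricity G * numEdges G))

end Machine

end C4Dom

namespace C4Dom

universe u

/-! ### Domination, successors in least common neighborhoods, and non-dominated cycles -/

section Structure

variable {V : Type u} {G : SimpleGraph V}

/-! Domination is transitive, so consecutive pairs suffice. If `v` is the highest vertex of a
four-cycle and `w` is opposite to it, the other two vertices lie in `L(v, w)`. When `v` does not
dominate `w` but every successor in `L(v, w)` dominates its predecessor, the larger of the two
dominates the smaller (`c4Dominated_of_goodOn`). Conversely, an undominated pair of an unsafe triple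
spans a non-dominated cycle, because in a degree ordering a lower vertex dominates a higher one only
if their neighborhoods are equal (`Bad.nonDominatedC4`). So `G` is `C₄`-dominated exactly when no
pair is `Bad`.

As long as no bad pair has occurred, `U` has out-degree at most one: a vertex that dominates `a` is
adjacent to both ends of every triple containing `a`, so two dominating successors of `a` coincide
(`IsNext.unique`). A pair that agrees with `U` is therefore good, one that contradicts it is bad,
and only the first out-edge of a vertex needs a test of dominance (`checkPairs_spec`).

The selection finds exactly the unsafe triples (`selected_iff_unsafe`). If `v` dominates `w`, then
`L(v, w)` consists of all neighbors of `w` not above `v`, and if an unsafe `(v', w')` has marked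
`w`, then `v` lies above `w` in `L(v', w')`, which gives a path of `U`. If `(v, w)` is unsafe and
the count does not show it, some neighbor of `w` above `v` misses `N(v)`, and together with a common
neighbor of `v` and `w` it forms an unsafe triple that has marked `w`; a path from `w` to `v` would
make `v` dominate `w`.

The program never computes `REACH`. It inspects only the out-neighbor `p` of `w` (`Checked`) and so
may skip an unsafe triple `(v, w)`. But then `p` dominates `w` and `L(v, w) ⊆ L(v, p)`; climbing
along out-edges ends at a checked triple (`Unsafe.exists_checked`) with the same successors
(`IsNext.of_subset`). Hence each round that ends without failure leaves the same edges and marks. A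
recorded failure is a bad quadruple with highest possible `v`, and each of these is the output under
a suitable schedule (`algorithm_headed`).

A round for `v` visits the pairs `a ∈ N(v)`, `a < v`, and `w ∈ N(a)`. In a degree ordering the total
is bounded by the sum of `min (d v) (d a)` over the edges, which is `O(αm)`: in each forest, charge
an edge to its child (`sum_min_le`). The tests of dominance cost `d(a)` once for each `a`, accounted
for by `potential`. Counting sort by degree and transposition of the lists supply sorted adjacency
in linear time. For recognition an arbitrary graph is relabeled by degree and searched for triangles
first. -/

theorem Dominates.trans {u v w : V} (h : Dominates G u v) (h' : Dominates G v w) :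
    Dominates G u w := fun _ hx => h (h' hx)

theorem Dominates.adj {v w a : V} (h : Dominates G v w) (ha : G.Adj w a) : G.Adj v a := h ha

theorem not_dominates_iff {v w : V} : ¬ Dominates G v w ↔ ∃ a, G.Adj w a ∧ ¬ G.Adj v a := by
  simp [Dominates, Set.subset_def]

theorem CliqueFree.not_adj (hG : G.CliqueFree 3) {a b c : V} (hab : G.Adj a b) (hbc : G.Adj b c) :
    ¬ G.Adj a c := by
  classical
  intro hac
  exact hG {a, b, c} (SimpleGraph.is3Clique_triple_iff.2 ⟨hab, hac, hbc⟩)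

theorem dominates_of_reflTransGen {R : V → V → Prop} (hR : ∀ a b, R a b → Dominates G b a)
    {a b : V} (h : Relation.ReflTransGen R a b) : Dominates G b a := by
  induction h with
  | refl => exact fun _ h => h
  | tail _ hbc ih => exact (hR _ _ hbc).trans ih

variable [LinearOrder V]

/-- The triple `(v, w, L(v, w))` exists and is unsafe. -/
def Unsafe (G : SimpleGraph V) (v w : V) : Prop := IsTriple G v w ∧ ¬ Dominates G v w

/-- The pair `a →_S b` of the unsafe triple `S = (v, w, L(v, w))` is not dominated. -/
def Bad (G : SimpleGraph V) (v w a b : V) : Prop :=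
  Unsafe G v w ∧ IsNext G v w a b ∧ ¬ Dominates G b a

/-- The edges that come from unsafe triples with high vertex in `T`. -/
def EdgeIn (G : SimpleGraph V) (T : Set V) (a b : V) : Prop :=
  ∃ v ∈ T, ∃ w, Unsafe G v w ∧ IsNext G v w a b

/-- The vertices that lie in unsafe triples with high vertex in `T`. -/
def MarkIn (G : SimpleGraph V) (T : Set V) (a : V) : Prop :=
  ∃ v ∈ T, ∃ w, Unsafe G v w ∧ a ∈ leastCommon G v w

/-- No pair of an unsafe triple with high vertex in `T` is bad. -/
def GoodOn (G : SimpleGraph V) (T : Set V) : Prop :=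
  ∀ v ∈ T, ∀ w a b, ¬ Bad G v w a b

theorem EdgeIn.dominates {T : Set V} (hT : GoodOn G T) {a b : V} (h : EdgeIn G T a b) :
    Dominates G b a := by
  obtain ⟨v, hv, w, hu, hn⟩ := h
  by_contra hd
  exact hT v hv w a b ⟨hu, hn, hd⟩

/-- Whatever dominates `a` is adjacent to both ends of every triple containing `a`. So the smaller
of `b` and `c` also lies in the other least common neighborhood, strictly between `a` and its
successor there. For `b < c` the required `b < v'` comes from `v ≤ v'`. -/
theorem IsNext.unique_of_le {v w v' w' a b c : V} (hvv : v ≤ v') (h : IsNext G v w a b)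
    (h' : IsNext G v' w' a c) (hb : Dominates G b a) (hc : Dominates G c a) : b = c := by
  obtain ⟨ha, hbL, hab, hno⟩ := h
  obtain ⟨ha', hcL, hac, hno'⟩ := h'
  rcases lt_trichotomy b c with hlt | heq | hgt
  · exact absurd ⟨b, ⟨(hb.adj ha'.1.symm).symm, (hb.adj ha'.2.1.symm).symm,
      lt_of_lt_of_le hbL.2.2 hvv⟩, hab, hlt⟩ hno'
  · exact heq
  · exact absurd ⟨c, ⟨(hc.adj ha.1.symm).symm, (hc.adj ha.2.1.symm).symm,
      hgt.trans hbL.2.2⟩, hac, hgt⟩ hno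

theorem IsNext.unique {v w v' w' a b c : V} (h : IsNext G v w a b)
    (h' : IsNext G v' w' a c) (hb : Dominates G b a) (hc : Dominates G c a) : b = c := by
  rcases le_total v v' with hvv | hvv
  · exact h.unique_of_le hvv h' hb hc
  · exact (h'.unique_of_le hvv h hc hb).symm

/-- Below the highest neighbor of `w` that is not adjacent to `v`, an unsafe triple marks `w`. -/
theorem Unsafe.markIn (hG : G.CliqueFree 3) {v w : V} (h : Unsafe G v w)
    (hall : ∀ a, G.Adj w a → a < v → G.Adj v a) : MarkIn G (Set.Ioi v) w := by
  obtain ⟨⟨hwv, c, hvc, hwc, hcv⟩, hd⟩ := h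
  obtain ⟨v', hwv', hvv'⟩ := not_dominates_iff.1 hd
  have hlt : v < v' := by
    refine lt_of_not_ge fun hle => ?_
    rcases hle.lt_or_eq with hlt | rfl
    · exact hvv' (hall _ hwv' hlt)
    · exact CliqueFree.not_adj hG hvc hwc.symm hwv'.symm
  -- The marking triple is `(v', c)`, where `v'` is a neighbor of `w` outside `N(v)` and `c` is
  -- common to `v` and `w`. It is unsafe because `v` lies in `N(c)` but not in `N(v')`.
  have hmem : w ∈ leastCommon G v' c := ⟨hwv'.symm, hwc.symm, hwv.trans hlt⟩
  refine ⟨v', hlt, c, ⟨⟨hcv.trans hlt, w, hmem⟩, fun hdom => ?_⟩, hmem⟩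
  exact hvv' (hdom.adj hvc.symm).symm

/-- The immediate successor of `a` in `L(v, w)`. -/
theorem exists_isNext (hfin : ∀ v : V, (Set.Iio v).Finite) {v w a b : V}
    (ha : a ∈ leastCommon G v w) (hb : b ∈ leastCommon G v w) (hab : a < b) :
    ∃ c, c ≤ b ∧ IsNext G v w a c := by
  have hS : ({c | c ∈ leastCommon G v w ∧ a < c} : Set V).Finite :=
    (hfin v).subset fun c hc => hc.1.2.2
  obtain ⟨c, hc⟩ := hS.exists_minimal ⟨b, hb, hab⟩
  have hmin : ∀ d ∈ leastCommon G v w, a < d → c ≤ d := fun d hd had =>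
    le_of_not_gt fun hlt => absurd (hc.2 ⟨hd, had⟩ hlt.le) (not_le_of_gt hlt)
  exact ⟨c, hmin b hb hab, ha, hc.1.1, hc.1.2, fun ⟨d, hd, had, hdc⟩ =>
    absurd (hmin d hd had) (not_le_of_gt hdc)⟩

/-- Induction on the number of elements of `L(v, w)` above `a`. These chains both carry domination
along `L(v, w)` and supply the paths of `U` that put a vertex into `REACH`. -/
theorem reflTransGen_isNext (hfin : ∀ v : V, (Set.Iio v).Finite) {v w b : V}
    (hb : b ∈ leastCommon G v w) : ∀ a ∈ leastCommon G v w, a ≤ b →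
      Relation.ReflTransGen (IsNext G v w) a b := by
  have hS : (leastCommon G v w).Finite := (hfin v).subset fun c hc => hc.2.2
  have key : ∀ k : ℕ, ∀ a ∈ leastCommon G v w, a ≤ b →
      (leastCommon G v w ∩ Set.Ioi a).ncard = k → Relation.ReflTransGen (IsNext G v w) a b := by
    intro k
    induction k using Nat.strong_induction_on with
    | _ k ih =>
      intro a ha hab hk
      rcases hab.lt_or_eq with hlt | rfl
      · obtain ⟨c, hcb, hn⟩ := exists_isNext hfin ha hb hlt
        refine .head hn (ih _ ?_ c hn.2.1 hcb rfl)
        rw [← hk]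
        refine Set.ncard_lt_ncard ⟨fun x hx => ⟨hx.1, hn.2.2.1.trans hx.2⟩, fun hsub => ?_⟩
          (hS.subset Set.inter_subset_left)
        exact lt_irrefl _ (hsub ⟨hn.2.1, hn.2.2.1⟩).2
      · exact .refl
  intro a ha hab
  exact key _ a ha hab rfl

/-- Rotations and reflections of the cycle reduce to the case where `v` is the highest vertex and `a
< b`. If `v` does not dominate `w`, the triple is unsafe, and the chain of successors from `a` to
`b` composes to a domination of `a` by `b`. -/
theorem c4Dominated_of_goodOn (hfin : ∀ v : V, (Set.Iio v).Finite)
    (h : GoodOn G Set.univ) : C4Dominated G := by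
  have key : ∀ v w a b : V, w < v → a < b → b < v → IsC4 G v a w b →
      DomComparable G v w ∨ DomComparable G a b := by
    intro v w a b hwv hab hbv hC
    have ha : a ∈ leastCommon G v w := ⟨hC.adj₁, hC.adj₂.symm, hab.trans hbv⟩
    have hb : b ∈ leastCommon G v w := ⟨hC.adj₄.symm, hC.adj₃, hbv⟩
    by_cases hd : Dominates G v w
    · exact .inl (.inl hd)
    · refine .inr (.inr (dominates_of_reflTransGen (fun x y hxy => ?_)
        (reflTransGen_isNext hfin hb a ha hab.le)))
      by_contra hn
      exact h v trivial w x y ⟨⟨⟨hwv, a, ha⟩, hd⟩, hxy, hn⟩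
  have swap : ∀ {v a w b : V}, IsC4 G v a w b → IsC4 G v b w a := fun h =>
    ⟨h.adj₄.symm, h.adj₃.symm, h.adj₂.symm, h.adj₁.symm, h.ne₁, h.ne₂.symm⟩
  have rot : ∀ {v a w b : V}, IsC4 G v a w b → IsC4 G a w b v := fun h =>
    ⟨h.adj₂, h.adj₃, h.adj₄, h.adj₁, h.ne₂, h.ne₁.symm⟩
  have key₂ : ∀ v w a b : V, w < v → a < v → b < v → IsC4 G v a w b →
      DomComparable G v w ∨ DomComparable G a b := by
    intro v w a b hwv hav hbv hC
    rcases lt_or_gt_of_ne hC.ne₂ with hab | hab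
    · exact key v w a b hwv hab hbv hC
    · exact (key v w b a hwv hab hav (swap hC)).imp_right Or.symm
  have key₃ : ∀ v w a b : V, w < v → b < a → IsC4 G v a w b →
      DomComparable G v w ∨ DomComparable G a b := by
    intro v w a b hwv hba hC
    rcases lt_trichotomy a v with hlt | heq | hgt
    · exact key₂ v w a b hwv hlt (hba.trans hlt) hC
    · exact absurd heq hC.adj₁.ne'
    · exact (key₂ a b w v hba (hwv.trans hgt) hgt (rot hC)).symm.imp_left Or.symm
  have key₄ : ∀ v w a b : V, w < v → IsC4 G v a w b →
      DomComparable G v w ∨ DomComparable G a b := by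
    intro v w a b hwv hC
    rcases lt_or_gt_of_ne hC.ne₂ with hab | hab
    · exact (key₃ v w b a hwv hab (swap hC)).imp_right Or.symm
    · exact key₃ v w a b hwv hab hC
  intro v a w b hC
  rcases lt_or_gt_of_ne hC.ne₁ with hwv | hwv
  · refine (key₄ w v b a hwv (rot (rot hC))).imp Or.symm Or.symm
  · exact key₄ v w a b hwv hC

/-- The inclusion goes against the degrees, so the two neighborhoods are equal. Hence failure of the
downward domination already means incomparability, and one direction is enough to test. -/
theorem dominates_of_le [Finite V] (hG : IsDegreeOrdered G) {v w : V} (hwv : w < v)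
    (h : Dominates G w v) : Dominates G v w :=
  (Set.eq_of_subset_of_ncard_le h (hG w v hwv) (Set.toFinite _)).ge

theorem Bad.nonDominatedC4 [Finite V] (hG : IsDegreeOrdered G) {v w a b : V}
    (h : Bad G v w a b) : NonDominatedC4 G v a w b := by
  obtain ⟨⟨⟨hwv, -⟩, hd⟩, ⟨ha, hb, hab, -⟩, hd'⟩ := h
  refine ⟨⟨ha.1, ha.2.1.symm, hb.2.1, hb.1.symm, hwv.ne', hab.ne⟩, ?_, ?_⟩
  · exact fun h => h.elim hd fun h => hd (dominates_of_le hG hwv h)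
  · exact fun h => h.elim (fun h => hd' (dominates_of_le hG hab h)) hd'

theorem Bad.not_c4Dominated [Finite V] (hG : IsDegreeOrdered G) {v w a b : V}
    (h : Bad G v w a b) : ¬ C4Dominated G := fun hC => by
  obtain ⟨h4, h1, h2⟩ := h.nonDominatedC4 hG
  exact (hC _ _ _ _ h4).elim h1 h2

end Structure

/-! ### Correctness of the abstract algorithm for every schedule -/

section Correctness

variable {V : Type u} {G : SimpleGraph V} [LinearOrder V]

/-- For an unsafe triple the two tests together amount to dominance of the pair. If `b` dominates
`a`, uniqueness of dominating successors makes every old out-edge of `a` end in `b`. If it does not,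
`b` cannot be an old out-neighbor, so either another out-neighbor exists and the first test fires,
or there is none and the second fires. -/
theorem checkPairs_spec {v w : V} (hu : Unsafe G v w) (l : List (V × V)) (U : Digraph V)
    (hl : ∀ p ∈ l, IsNext G v w p.1 p.2)
    (hU : ∀ a b, U.Adj a b → Dominates G b a ∧ ∃ v' w', IsNext G v' w' a b) :
    (∃ a b, checkPairs G v w l U = .error (v, a, w, b) ∧ Bad G v w a b) ∨
    ∃ U', checkPairs G v w l U = .ok U' ∧ (∀ p ∈ l, Dominates G p.2 p.1) ∧
      ∀ a b, U'.Adj a b ↔ U.Adj a b ∨ (a, b) ∈ l := by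
  induction l generalizing U with
  | nil => exact .inr ⟨U, rfl, by simp, by simp⟩
  | cons p l ih =>
    obtain ⟨a, b⟩ := p
    have hn : IsNext G v w a b := hl (a, b) (by simp)
    by_cases hd : Dominates G b a
    · have h1 : {c | U.Adj a c} ⊆ {b} := fun c hc => by
        obtain ⟨hdc, v', w', hn'⟩ := hU a c hc
        exact hn'.unique hn hdc hd
      have hU' : ∀ x y, (addEdge U a b).Adj x y →
          Dominates G y x ∧ ∃ v' w', IsNext G v' w' x y := by
        rintro x y (h | ⟨rfl, rfl⟩)
        · exact hU x y h
        · exact ⟨hd, v, w, hn⟩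
      have heq : checkPairs G v w ((a, b) :: l) U = checkPairs G v w l (addEdge U a b) := by
        simp only [checkPairs]
        rw [if_neg (not_not.2 h1), if_neg (fun h => h.2 hd)]
      rcases ih _ (fun p hp => hl p (List.mem_cons_of_mem _ hp)) hU' with ⟨x, y, he, hb⟩ | ⟨U', he, hD, hA⟩
      · exact .inl ⟨x, y, heq.trans he, hb⟩
      · refine .inr ⟨U', heq.trans he, ?_, fun x y => ?_⟩
        · rintro p (_ | ⟨_, hp⟩)
          · exact hd
          · exact hD p hp
        · rw [hA]
          simp only [addEdge, List.mem_cons, Prod.mk.injEq, or_assoc]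
    · refine .inl ⟨a, b, ?_, hu, hn, hd⟩
      simp only [checkPairs]
      by_cases h1 : {c | U.Adj a c} ⊆ {b}
      · have h2 : {c | U.Adj a c} = ∅ := by
          refine Set.eq_empty_of_forall_notMem fun c hc => ?_
          have hcb : c = b := h1 hc
          subst hcb
          exact hd (hU a c hc).1
        rw [if_neg (not_not.2 h1), if_pos ⟨h2, hd⟩]
      · rw [if_pos h1]

/-- Both tests report the same quadruple, so it is enough that one of them fires at the head of the
list; the tail is never examined. -/
theorem checkPairs_eq_error {v w a b : V} (hu : Unsafe G v w) (l : List (V × V)) (U : Digraph V)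
    (hl : ∀ p ∈ (a, b) :: l, IsNext G v w p.1 p.2)
    (hU : ∀ a b, U.Adj a b → Dominates G b a ∧ ∃ v' w', IsNext G v' w' a b)
    (hd : ¬ Dominates G b a) :
    checkPairs G v w ((a, b) :: l) U = .error (v, a, w, b) := by
  rcases checkPairs_spec hu [(a, b)] U (fun p hp => hl p (by simp_all)) hU with
    ⟨x, y, he, -⟩ | ⟨U', -, hD, -⟩
  · simp only [checkPairs] at he ⊢
    split_ifs at he ⊢ with h1 h2 <;> rfl
  · exact absurd (hD (a, b) (by simp)) hd

/-- The state of the algorithm after the high vertices in `T` have been treated. -/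
structure AlgInv (G : SimpleGraph V) (T : Set V) (st : AlgState V) : Prop where
  dlt : ∀ w, st.dlt w = {a | G.Adj w a ∧ a ∉ T}.ncard
  marked : ∀ a, a ∈ st.marked ↔ MarkIn G T a
  dig : ∀ a b, st.dig.Adj a b ↔ EdgeIn G T a b
  good : GoodOn G T

/-- A safe triple is never selected: the count agrees since `L(v, w)` is all of the neighbors of `w`
not above `v`, and a triple that marked `w` also contains `v`, so its successor chain leads from `w`
to `v`. An unsafe triple that escapes the count has `w` marked by `Unsafe.markIn`, and membership in
`REACH` would make `v` dominate `w`. -/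
theorem selected_iff_unsafe [Finite V] (hG : G.CliqueFree 3) {v w : V} {st : AlgState V}
    (h : AlgInv G (Set.Ioi v) st) : Selected G st v w ↔ Unsafe G v w := by
  have hfin : ∀ v : V, (Set.Iio v).Finite := fun _ => Set.toFinite _
  have hdom : ∀ a b, st.dig.Adj a b → Dominates G b a := fun a b hab =>
    ((h.dig a b).1 hab).dominates h.good
  have hsub : leastCommon G v w ⊆ {a | G.Adj w a ∧ a ∉ Set.Ioi v} := fun a ha =>
    ⟨ha.2.1, fun hlt => lt_asymm ha.2.2 hlt⟩
  have hcard : (leastCommon G v w).ncard = st.dlt w ↔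
      leastCommon G v w = {a | G.Adj w a ∧ a ∉ Set.Ioi v} := by
    rw [h.dlt]
    refine ⟨fun he => Set.eq_of_subset_of_ncard_le hsub he.ge (Set.toFinite _), fun he => ?_⟩
    rw [he]
  constructor
  · rintro ⟨ht, hsel⟩
    refine ⟨ht, fun hd => ?_⟩
    obtain ⟨hwv, c, hc⟩ := ht
    rcases hsel with hne | ⟨hm, hr⟩
    · refine hne (hcard.2 (hsub.antisymm ?_))
      rintro a ⟨hwa, ha⟩
      refine ⟨hd.adj hwa, hwa, lt_of_le_of_ne (le_of_not_gt ha) ?_⟩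
      rintro rfl
      exact (hd.adj hwa).ne rfl
    · obtain ⟨v', hv', w', hu, hwL⟩ := (h.marked w).1 hm
      have hvL : v ∈ leastCommon G v' w' :=
        ⟨(hd.adj hwL.1.symm).symm, (hd.adj hwL.2.1.symm).symm, hv'⟩
      refine hr ⟨?_, Relation.ReflTransGen.mono
        (fun a b hab => (h.dig a b).2 ⟨v', hv', w', hu, hab⟩)
        _ _ (reflTransGen_isNext hfin hvL w hwL hwv.le)⟩
      rw [h.dlt, Set.ncard_pos (Set.toFinite _)]
      exact ⟨c, hsub hc⟩
  · intro hu
    refine ⟨hu.1, ?_⟩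
    by_contra hcon
    push Not at hcon
    obtain ⟨heq, hr⟩ := hcon
    have hm : MarkIn G (Set.Ioi v) w := hu.markIn hG fun a hwa hav =>
      ((hcard.1 heq).ge ⟨hwa, fun hlt => lt_asymm hav hlt⟩).1
    exact hu.2 (dominates_of_reflTransGen hdom (hr ((h.marked w).2 hm)).2)

open Classical in
theorem checkTriples_spec (sch : Schedule V) {v : V} (ws : List V) (st : AlgState V)
    (hws : ∀ w ∈ ws, Unsafe G v w)
    (hU : ∀ a b, st.dig.Adj a b → Dominates G b a ∧ ∃ v' w', IsNext G v' w' a b) :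
    (∃ w a b, checkTriples G sch v ws st = .error (v, a, w, b) ∧ Bad G v w a b) ∨
    ∃ st', checkTriples G sch v ws st = .ok st' ∧ st'.dlt = st.dlt ∧
      (∀ w ∈ ws, ∀ a b, IsNext G v w a b → Dominates G b a) ∧
      (∀ a b, st'.dig.Adj a b ↔ st.dig.Adj a b ∨ ∃ w ∈ ws, IsNext G v w a b) ∧
      ∀ a, a ∈ st'.marked ↔ a ∈ st.marked ∨ ∃ w ∈ ws, a ∈ leastCommon G v w := by
  induction ws generalizing st with
  | nil => exact .inr ⟨st, rfl, rfl, by simp, by simp, by simp⟩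
  | cons w ws ih =>
    have hmem : ∀ a b, (a, b) ∈ (sch.pairs v w).filter (fun p => IsNext G v w p.1 p.2) ↔
        IsNext G v w a b := by
      intro a b
      simp [sch.mem_pairs v w (a, b)]
    rcases checkPairs_spec (hws w (by simp)) ((sch.pairs v w).filter
      (fun p => IsNext G v w p.1 p.2)) st.dig (fun p hp => (hmem p.1 p.2).1 hp) hU with
      ⟨a, b, he, hb⟩ | ⟨U', he, hD, hA⟩
    · refine .inl ⟨w, a, b, ?_, hb⟩
      simp only [checkTriples, he]
    · have hD' : ∀ a b, IsNext G v w a b → Dominates G b a := fun a b hab =>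
        hD (a, b) ((hmem a b).2 hab)
      have heq : checkTriples G sch v (w :: ws) st = checkTriples G sch v ws
          { st with dig := U', marked := st.marked ∪ leastCommon G v w } := by
        simp only [checkTriples, he]
      rcases ih { st with dig := U', marked := st.marked ∪ leastCommon G v w }
        (fun w hw => hws w (by simp [hw])) (fun a b hab => by
          rcases (hA a b).1 hab with hab | hab
          · exact hU a b hab
          · exact ⟨hD _ hab, v, w, (hmem a b).1 hab⟩) with
        ⟨w', a, b, he', hb⟩ | ⟨st', he', h1, h2, h3, h4⟩
      · exact .inl ⟨w', a, b, heq.trans he', hb⟩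
      · refine .inr ⟨st', heq.trans he', h1, ?_, fun a b => ?_, fun a => ?_⟩
        · rintro w' (_ | ⟨_, hw'⟩)
          · exact hD'
          · exact h2 w' hw'
        · rw [h3]
          simp only [hA, hmem, List.exists_mem_cons_iff, or_assoc]
        · rw [h4]
          simp only [Set.mem_union, List.exists_mem_cons_iff, or_assoc]

theorem EdgeIn.Ici_iff {v a b : V} : EdgeIn G (Set.Ici v) a b ↔
    EdgeIn G (Set.Ioi v) a b ∨ ∃ w, Unsafe G v w ∧ IsNext G v w a b := by
  simp only [EdgeIn, ← Set.Ioi_insert, Set.mem_insert_iff, or_and_right, exists_or,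
    exists_eq_left]
  exact or_comm

theorem MarkIn.Ici_iff {v a : V} : MarkIn G (Set.Ici v) a ↔
    MarkIn G (Set.Ioi v) a ∨ ∃ w, Unsafe G v w ∧ a ∈ leastCommon G v w := by
  simp only [MarkIn, ← Set.Ioi_insert, Set.mem_insert_iff, or_and_right, exists_or,
    exists_eq_left]
  exact or_comm

theorem GoodOn.Ici_iff {v : V} : GoodOn G (Set.Ici v) ↔
    GoodOn G (Set.Ioi v) ∧ ∀ w a b, ¬ Bad G v w a b := by
  simp only [GoodOn, ← Set.Ioi_insert, Set.mem_insert_iff, forall_eq_or_imp]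
  exact and_comm

/-- The state after a vertex whose triples have passed the check. -/
noncomputable def AlgState.next (G : SimpleGraph V) (v : V) (st : AlgState V) : AlgState V :=
  open Classical in
  { st with dlt := fun w => if G.Adj v w then st.dlt w - 1 else st.dlt w }

open Classical in
theorem checkTriples_selected [Finite V] (hG : G.CliqueFree 3) (sch : Schedule V) {v : V}
    {st : AlgState V} (h : AlgInv G (Set.Ioi v) st) :
    (∃ w a b, checkTriples G sch v ((sch.lows v).filter fun w => Selected G st v w) st =
      .error (v, a, w, b) ∧ Bad G v w a b) ∨
    ∃ st', checkTriples G sch v ((sch.lows v).filter fun w => Selected G st v w) st = .ok st' ∧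
      AlgInv G (Set.Ici v) (st'.next G v) := by
  have hmem : ∀ w, w ∈ (sch.lows v).filter (fun w => Selected G st v w) ↔ Unsafe G v w := by
    intro w
    simp [sch.mem_lows v w, selected_iff_unsafe hG h]
  rcases checkTriples_spec sch ((sch.lows v).filter fun w => Selected G st v w) st
    (fun w hw => (hmem w).1 hw) (fun a b hab => by
      have hab' := (h.dig a b).1 hab
      refine ⟨hab'.dominates h.good, ?_⟩
      obtain ⟨v', -, w', -, hn⟩ := hab'
      exact ⟨v', w', hn⟩) with hl | ⟨st', he, h1, h2, h3, h4⟩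
  · exact .inl hl
  · refine .inr ⟨st', he, ?_, fun a => ?_, fun a b => ?_, ?_⟩
    · intro w
      have hset : {a | G.Adj w a ∧ a ∉ Set.Ici v} = {a | G.Adj w a ∧ a ∉ Set.Ioi v} \ {v} := by
        ext a
        simp only [Set.mem_Ici, Set.mem_ofPred_eq, Set.mem_Ioi, not_lt, not_le, Set.mem_sdiff,
          Set.mem_singleton_iff, and_assoc]
        rw [lt_iff_le_and_ne]
      simp only [AlgState.next, h1, h.dlt, hset]
      split_ifs with hvw
      · rw [Set.ncard_sdiff_singleton_of_mem]
        exact ⟨hvw.symm, lt_irrefl v⟩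
      · rw [Set.sdiff_singleton_eq_self]
        exact fun hv => hvw hv.1.symm
    · simp only [AlgState.next, h4, h.marked, MarkIn.Ici_iff, hmem]
    · simp only [AlgState.next, h3, h.dig, EdgeIn.Ici_iff, hmem]
    · refine GoodOn.Ici_iff.2 ⟨h.good, fun w a b hb => ?_⟩
      exact hb.2.2 (h2 w ((hmem w).2 hb.1) a b hb.2.1)

/-- `(v, w, a, b)` is bad and its high vertex is as high as possible. -/
def FirstBad (G : SimpleGraph V) (v w a b : V) : Prop :=
  Bad G v w a b ∧ GoodOn G (Set.Ioi v)

theorem compl_cons_of_sorted {v : V} {l : List V} (hs : (v :: l).SortedGT)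
    (huniv : ∀ x, x ∉ v :: l → ∀ y ∈ v :: l, y < x) :
    {x | x ∉ v :: l} = Set.Ioi v ∧ {x | x ∉ l} = Set.Ici v ∧
      ∀ x, x ∉ l → ∀ y ∈ l, y < x := by
  have hlt : ∀ y ∈ l, y < v := fun y hy => List.rel_of_pairwise_cons hs.pairwise hy
  have h1 : {x | x ∉ v :: l} = Set.Ioi v := by
    ext x
    refine ⟨fun hx => huniv x hx v (by simp), fun hx hmem => ?_⟩
    rcases List.mem_cons.1 hmem with rfl | hm
    · exact lt_irrefl _ hx
    · exact lt_asymm hx (hlt x hm)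
  have h2 : {x | x ∉ l} = Set.Ici v := by
    rw [← Set.Ioi_insert, ← h1]
    ext x
    by_cases hx : x = v
    · subst hx
      simpa using fun hm => lt_irrefl _ (hlt x hm)
    · simp [hx]
  refine ⟨h1, h2, fun x hx y hy => ?_⟩
  have hx' : v ≤ x := h2.le hx
  exact (hlt y hy).trans_le hx'

theorem mainLoop_spec [Finite V] (hG : G.CliqueFree 3) (sch : Schedule V) (l : List V)
    (st : AlgState V) (hs : l.SortedGT)
    (hl : ∀ x, x ∉ l → ∀ y ∈ l, y < x) (h : AlgInv G {x | x ∉ l} st) :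
    (∃ v w a b, mainLoop G sch l st = .error (v, a, w, b) ∧ FirstBad G v w a b) ∨
    ∃ st', mainLoop G sch l st = .ok st' ∧ AlgInv G Set.univ st' := by
  induction l generalizing st with
  | nil => exact .inr ⟨st, rfl, by simpa using h⟩
  | cons v l ih =>
    obtain ⟨h1, h2, h3⟩ := compl_cons_of_sorted hs hl
    rw [h1] at h
    rcases checkTriples_selected hG sch h with ⟨w, a, b, he, hb⟩ | ⟨st', he, hst'⟩
    · exact .inl ⟨v, w, a, b, by simp only [mainLoop, he], hb, h.good⟩
    · rw [← h2] at hst'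
      have heq : mainLoop G sch (v :: l) st = mainLoop G sch l (st'.next G v) := by
        simp only [mainLoop, he, AlgState.next]
      rw [heq]
      exact ih _ hs.pairwise.of_cons.sortedGT h3 hst'

/-- The initial state of the algorithm. -/
noncomputable def AlgState.init (G : SimpleGraph V) : AlgState V :=
  { marked := ∅, dig := ⟨fun _ _ => False⟩, dlt := fun v => (G.neighborSet v).ncard }

theorem algInv_init (l : List V) (hl : ∀ x, x ∈ l) : AlgInv G {x | x ∉ l} (AlgState.init G) := by
  have : {x | x ∉ l} = ∅ := by simp [hl]
  rw [this]
  refine ⟨fun w => ?_, fun a => ?_, fun a b => ?_, fun v hv => hv.elim⟩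
  · simp only [AlgState.init, Set.mem_empty_iff_false, not_false_iff, and_true]
    rfl
  · simp [AlgState.init, MarkIn]
  · simp [AlgState.init, EdgeIn]

theorem algorithm_spec [Fintype V] (hG : G.CliqueFree 3) (sch : Schedule V) :
    (∃ v w a b, algorithm G sch = .error (v, a, w, b) ∧ FirstBad G v w a b) ∨
    (algorithm G sch = .ok (unsafeDigraph G) ∧ GoodOn G Set.univ) := by
  have hmem : ∀ x, x ∈ (Finset.univ : Finset V).sort (· ≥ ·) := by simp
  rcases mainLoop_spec hG sch ((Finset.univ : Finset V).sort (· ≥ ·)) (AlgState.init G)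
    (Finset.sortedGT_sort _) (fun x hx => absurd (hmem x) hx) (algInv_init _ hmem) with
    ⟨v, w, a, b, he, hb⟩ | ⟨st, he, hst⟩
  · refine .inl ⟨v, w, a, b, ?_, hb⟩
    rw [AlgState.init] at he
    simp only [algorithm, he]
  · refine .inr ⟨?_, hst.good⟩
    rw [AlgState.init] at he
    simp only [algorithm, he]
    congr 1
    ext a b
    rw [hst.dig]
    simp only [EdgeIn, Unsafe, unsafeDigraph, Set.mem_univ, true_and, and_assoc]

theorem algorithm_correct [Fintype V] (hG : G.CliqueFree 3) (hdeg : IsDegreeOrdered G)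
    (sch : Schedule V) :
    (∃ v a w b, algorithm G sch = .error (v, a, w, b) ∧
      NonDominatedC4 G v a w b ∧ ¬ C4Dominated G) ∨
    (algorithm G sch = .ok (unsafeDigraph G) ∧ C4Dominated G) := by
  rcases algorithm_spec hG sch with ⟨v, w, a, b, he, hb⟩ | ⟨he, hgood⟩
  · exact .inl ⟨v, a, w, b, he, hb.1.nonDominatedC4 hdeg, hb.1.not_c4Dominated hdeg⟩
  · exact .inr ⟨he, c4Dominated_of_goodOn (fun _ => Set.toFinite _) hgood⟩

open Classical in
/-- The schedule that examines `w` first among the low vertices and `(a, b)` first among the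
pairs. -/
noncomputable def Schedule.headed [Fintype V] (w a b : V) : Schedule V where
  lows _ := w :: (Finset.univ : Finset V).toList.erase w
  lows_nodup _ := List.nodup_cons.2
    ⟨(Finset.nodup_toList _).not_mem_erase, (Finset.nodup_toList _).erase _⟩
  mem_lows _ x := by
    by_cases h : x = w
    · simp [h]
    · simp [h, List.mem_erase_of_ne h]
  pairs _ _ := (a, b) :: (Finset.univ : Finset (V × V)).toList.erase (a, b)
  pairs_nodup _ _ := List.nodup_cons.2
    ⟨(Finset.nodup_toList _).not_mem_erase, (Finset.nodup_toList _).erase _⟩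
  mem_pairs _ _ p := by
    by_cases h : p = (a, b)
    · simp [h]
    · simp [h, List.mem_erase_of_ne h]

/-- Above `v` there are no bad pairs, so the earlier rounds pass under any schedule. In the round of
`v` the triple of `w` and its pair `(a, b)` come first, and the failure names them. An
implementation may thus report whichever first bad quadruple it meets. -/
theorem mainLoop_headed [Fintype V] (hG : G.CliqueFree 3) {v w a b : V}
    (hb : FirstBad G v w a b) (l : List V) (st : AlgState V) (hs : l.SortedGT)
    (hl : ∀ x, x ∉ l → ∀ y ∈ l, y < x) (h : AlgInv G {x | x ∉ l} st) (hv : v ∈ l) :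
    mainLoop G (Schedule.headed w a b) l st = .error (v, a, w, b) := by
  classical
  induction l generalizing st with
  | nil => simp at hv
  | cons x l ih =>
    obtain ⟨h1, h2, h3⟩ := compl_cons_of_sorted hs hl
    rw [h1] at h
    rcases List.mem_cons.1 hv with rfl | hv'
    · have hsel : Selected G st v w := (selected_iff_unsafe hG h).2 hb.1.1
      have hU : ∀ a b, st.dig.Adj a b → Dominates G b a ∧ ∃ v' w', IsNext G v' w' a b := by
        intro a b hab
        have hab' := (h.dig a b).1 hab
        refine ⟨hab'.dominates h.good, ?_⟩
        obtain ⟨v', -, w', -, hn⟩ := hab'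
        exact ⟨v', w', hn⟩
      have hlows : ((Schedule.headed w a b).lows v).filter (fun w => Selected G st v w) =
          w :: ((Finset.univ : Finset V).toList.erase w).filter (fun w => Selected G st v w) := by
        simp [Schedule.headed, hsel]
      have hpairs : ((Schedule.headed w a b).pairs v w).filter
          (fun p => IsNext G v w p.1 p.2) = (a, b) ::
            ((Finset.univ : Finset (V × V)).toList.erase (a, b)).filter
              (fun p => IsNext G v w p.1 p.2) := by
        simp [Schedule.headed, hb.1.2.1]
      have herr := checkPairs_eq_error hb.1.1
        (((Finset.univ : Finset (V × V)).toList.erase (a, b)).filter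
          (fun p => IsNext G v w p.1 p.2)) st.dig (by
          rintro p (_ | ⟨_, hp⟩)
          · exact hb.1.2.1
          · simpa using (List.mem_filter.1 hp).2) hU hb.1.2.2
      simp only [mainLoop, hlows, checkTriples, hpairs, herr]
    · have hvx : v < x := List.rel_of_pairwise_cons hs.pairwise hv'
      rcases checkTriples_selected hG (Schedule.headed w a b) h with
        ⟨w', a', b', -, hb'⟩ | ⟨st', he, hst'⟩
      · exact absurd hb' (hb.2 x hvx w' a' b')
      · rw [← h2] at hst'
        have heq : mainLoop G (Schedule.headed w a b) (x :: l) st =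
            mainLoop G (Schedule.headed w a b) l (st'.next G x) := by
          simp only [mainLoop, he, AlgState.next]
        rw [heq]
        exact ih _ hs.pairwise.of_cons.sortedGT h3 hst' hv'

theorem algorithm_headed [Fintype V] (hG : G.CliqueFree 3) {v w a b : V}
    (hb : FirstBad G v w a b) :
    algorithm G (Schedule.headed w a b) = .error (v, a, w, b) := by
  have hmem : ∀ x, x ∈ (Finset.univ : Finset V).sort (· ≥ ·) := by simp
  have he := mainLoop_headed hG hb ((Finset.univ : Finset V).sort (· ≥ ·)) (AlgState.init G)
    (Finset.sortedGT_sort _) (fun x hx => absurd (hmem x) hx) (algInv_init _ hmem) (hmem v)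
  rw [AlgState.init] at he
  simp only [algorithm, he]

end Correctness

/-! ### A program logic with frames, word bounds and amortized time -/

section Logic

/-- A bound for the values that occur in an evaluation: the value of an expression is at most
`weight * M` if all words are at most `M`. -/
def Exp.weight : Exp → ℕ
  | lit c => c
  | reg _ => 1
  | cell _ i => i.weight + 1
  | plus e f => e.weight + f.weight
  | minus e f => e.weight + f.weight

/-- Syntactic and Boolean, so that frame conditions of concrete programs are settled by `decide`. -/
def Cmd.writesReg (z : ℕ) : Cmd → Bool
  | skip => false
  | setReg x _ => x == z
  | setCell _ _ _ => false
  | seq P Q => P.writesReg z || Q.writesReg z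
  | ifNonzero _ P Q => P.writesReg z || Q.writesReg z
  | whileNonzero _ P => P.writesReg z

def Cmd.writesArr (A : ℕ) : Cmd → Bool
  | skip => false
  | setReg _ _ => false
  | setCell B _ _ => B == A
  | seq P Q => P.writesArr A || Q.writesArr A
  | ifNonzero _ P Q => P.writesArr A || Q.writesArr A
  | whileNonzero _ P => P.writesArr A

/-- All words of the store are at most `M`. -/
def Store.Bdd (M : ℕ) (s : Store) : Prop := (∀ x, s.reg x ≤ M) ∧ ∀ A i, s.arr A i ≤ M

/-- The stores agree except on what `P` writes. -/
def Frame (P : Cmd) (s s' : Store) : Prop :=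
  (∀ x, P.writesReg x = false → s'.reg x = s.reg x) ∧
    ∀ A, P.writesArr A = false → s'.arr A = s.arr A

theorem Frame.refl (P : Cmd) (s : Store) : Frame P s s := ⟨fun _ _ => rfl, fun _ _ => rfl⟩

theorem Frame.trans {P : Cmd} {s s₁ s₂ : Store} (h : Frame P s s₁) (h' : Frame P s₁ s₂) :
    Frame P s s₂ :=
  ⟨fun x hx => (h'.1 x hx).trans (h.1 x hx), fun A hA => (h'.2 A hA).trans (h.2 A hA)⟩

theorem Frame.mono {P R : Cmd} {s s' : Store} (h : Frame P s s')
    (hr : ∀ x, R.writesReg x = false → P.writesReg x = false)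
    (ha : ∀ A, R.writesArr A = false → P.writesArr A = false) : Frame R s s' :=
  ⟨fun x hx => h.1 x (hr x hx), fun A hA => h.2 A (ha A hA)⟩

theorem Exec.frame {W : ℕ} {P : Cmd} {s s' : Store} {t : ℕ} (h : Exec W P s t s') :
    Frame P s s' := by
  induction h with
  | skip s => exact .refl _ _
  | setReg s x e he =>
    refine ⟨fun z hz => ?_, fun _ _ => rfl⟩
    have : z ≠ x := by
      rintro rfl
      simp [Cmd.writesReg] at hz
    simp [Store.setReg, this]
  | setCell s A i e hi he =>
    refine ⟨fun _ _ => rfl, fun z hz => ?_⟩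
    have : z ≠ A := by
      rintro rfl
      simp [Cmd.writesArr] at hz
    simp [Store.setCell, this]
  | seq _ _ ih₁ ih₂ =>
    refine Frame.trans (ih₁.mono ?_ ?_) (ih₂.mono ?_ ?_) <;> intro x hx <;>
      simp only [Cmd.writesReg, Cmd.writesArr, Bool.or_eq_false_iff] at hx <;> simp [hx]
  | ifTrue _ _ _ ih =>
    refine ih.mono ?_ ?_ <;> intro x hx <;>
      simp only [Cmd.writesReg, Cmd.writesArr, Bool.or_eq_false_iff] at hx <;> simp [hx]
  | ifFalse _ _ _ ih =>
    refine ih.mono ?_ ?_ <;> intro x hx <;>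
      simp only [Cmd.writesReg, Cmd.writesArr, Bool.or_eq_false_iff] at hx <;> simp [hx]
  | whileFalse => exact .refl _ _
  | whileTrue _ _ _ _ ih₁ ih₂ => exact (ih₁.mono (fun _ h => h) fun _ h => h).trans ih₂

theorem Exp.fits_of_bdd {M W : ℕ} {s : Store} (hM : 1 ≤ M) (hs : s.Bdd M) (e : Exp)
    (h : e.weight * M < W) : e.Fits W s ∧ e.val s ≤ e.weight * M := by
  induction e with
  | lit c =>
    have : c ≤ c * M := Nat.le_mul_of_pos_right c hM
    exact ⟨lt_of_le_of_lt this h, this⟩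
  | reg x =>
    simp only [weight, one_mul] at h
    exact ⟨lt_of_le_of_lt (hs.1 x) h, by simpa [weight, val] using hs.1 x⟩
  | cell A i ih =>
    simp only [weight, add_mul, one_mul] at h
    have := hs.2 A (i.val s)
    exact ⟨⟨(ih (by omega)).1, by omega⟩, by simp only [weight, val, add_mul]; omega⟩
  | plus e f ihe ihf =>
    simp only [weight, add_mul] at h
    have he := ihe (by omega)
    have hf := ihf (by omega)
    exact ⟨⟨he.1, hf.1, by omega⟩, by simp only [weight, val, add_mul]; omega⟩
  | minus e f ihe ihf =>
    simp only [weight, add_mul] at h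
    have he := ihe (by omega)
    have hf := ihf (by omega)
    exact ⟨⟨he.1, hf.1⟩, by simp only [weight, val, add_mul]; omega⟩

/-- On a machine whose size is large compared to `M`, the program `P`, started in a store bounded
by `M`, halts in a store bounded by `M`, and the time and this store satisfy `Q`. -/
def Runs (W M : ℕ) (P : Cmd) (s : Store) (Q : ℕ → Store → Prop) : Prop :=
  1 ≤ M → 20 * M < W → s.Bdd M → ∃ t s', Exec W P s t s' ∧ s'.Bdd M ∧ Q t s'

variable {W M : ℕ} {P R : Cmd} {s : Store} {Q Q' : ℕ → Store → Prop}

/-- The constant `20` is the slack built into `Runs`: an expression of this weight evaluates within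
the machine although its intermediate values may exceed `M`. -/
theorem Exp.fits {e : Exp} (he : e.weight ≤ 20) (hM : 1 ≤ M) (hW : 20 * M < W) (hs : s.Bdd M) :
    e.Fits W s :=
  (e.fits_of_bdd hM hs (lt_of_le_of_lt (Nat.mul_le_mul_right M he) hW)).1

theorem Runs.mono (h : Runs W M P s Q)
    (hQ : ∀ t s', 1 ≤ M → s'.Bdd M → Frame P s s' → Q t s' → Q' t s') : Runs W M P s Q' :=
  fun hM hW hs => by
    obtain ⟨t, s', he, hs', hq⟩ := h hM hW hs
    exact ⟨t, s', he, hs', hQ t s' hM hs' he.frame hq⟩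

theorem Runs.of_bdd (h : 1 ≤ M → s.Bdd M → Runs W M P s Q) : Runs W M P s Q :=
  fun hM hW hs => h hM hs hM hW hs

theorem Runs.skip (h : Q 1 s) : Runs W M .skip s Q :=
  fun _ _ hs => ⟨1, s, .skip s, hs, h⟩

theorem Store.Bdd.setReg (hs : s.Bdd M) {x k : ℕ} (hk : k ≤ M) : (s.setReg x k).Bdd M := by
  refine ⟨fun z => ?_, hs.2⟩
  simp only [Store.setReg, Function.update_apply]
  split_ifs
  · exact hk
  · exact hs.1 z

theorem Store.Bdd.setCell (hs : s.Bdd M) {A i k : ℕ} (hk : k ≤ M) : (s.setCell A i k).Bdd M := by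
  refine ⟨hs.1, fun B j => ?_⟩
  by_cases hB : B = A
  · subst hB
    by_cases hj : j = i
    · subst hj
      simpa [Store.setCell] using hk
    · simpa [Store.setCell, hj] using hs.2 B j
  · simpa [Store.setCell, hB] using hs.2 B j

/-- Only stored values must stay below `M`. Since the bound is the same before and after, it does
not grow over the rounds of a loop. -/
theorem Runs.setReg {x : ℕ} {e : Exp} (he : e.weight ≤ 20)
    (hv : 1 ≤ M → s.Bdd M → e.val s ≤ M)
    (h : Q (e.cost + 1) (s.setReg x (e.val s))) : Runs W M (.setReg x e) s Q :=
  fun hM hW hs => ⟨_, _, .setReg s x e (e.fits he hM hW hs), hs.setReg (hv hM hs), h⟩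

theorem Runs.setCell {A : ℕ} {i e : Exp} (hi : i.weight ≤ 20) (he : e.weight ≤ 20)
    (hv : 1 ≤ M → s.Bdd M → e.val s ≤ M)
    (h : Q (i.cost + e.cost + 1) (s.setCell A (i.val s) (e.val s))) :
    Runs W M (.setCell A i e) s Q :=
  fun hM hW hs => ⟨_, _, .setCell s A i e (i.fits hi hM hW hs) (e.fits he hM hW hs),
    hs.setCell (hv hM hs), h⟩

theorem Runs.seq (h : Runs W M P s fun t s₁ => Runs W M R s₁ fun t' s₂ => Q (t + t') s₂) :
    Runs W M (.seq P R) s Q :=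
  fun hM hW hs => by
    obtain ⟨t, s₁, he, hs₁, hr⟩ := h hM hW hs
    obtain ⟨t', s₂, he', hs₂, hq⟩ := hr hM hW hs₁
    exact ⟨_, _, .seq he he', hs₂, hq⟩

theorem Runs.ifNonzero {e : Exp} (he : e.weight ≤ 20)
    (ht : e.val s ≠ 0 → Runs W M P s fun t s' => Q (e.cost + 1 + t) s')
    (hf : e.val s = 0 → Runs W M R s fun t s' => Q (e.cost + 1 + t) s') :
    Runs W M (.ifNonzero e P R) s Q :=
  fun hM hW hs => by
    by_cases h : e.val s = 0
    · obtain ⟨t, s', hx, hs', hq⟩ := hf h hM hW hs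
      exact ⟨_, _, .ifFalse (e.fits he hM hW hs) h hx, hs', hq⟩
    · obtain ⟨t, s', hx, hs', hq⟩ := ht h hM hW hs
      exact ⟨_, _, .ifTrue (e.fits he hM hW hs) h hx, hs', hq⟩

/-- `for x in [e₁, e₂) do P`, where register `y` keeps the upper end. -/
def forTo (x y : ℕ) (e₁ e₂ : Exp) (P : Cmd) : Cmd :=
  .seq (.setReg y e₂) (.seq (.setReg x e₁)
    (.whileNonzero (.minus (.reg y) (.reg x)) (.seq P (.setReg x (.plus (.reg x) (.lit 1))))))

/-- Induction on the number of remaining rounds. The potential stands on both sides of the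
inequality so that no truncated subtraction occurs. Each round pays `4` for the test and `4` for the
increment; the last test accounts for the extra `4`. -/
theorem Runs.while_forTo {x y : ℕ} (hi : ℕ) (s₀ : Store) (hxy : x ≠ y)
    (hx : P.writesReg x = false) (hy : P.writesReg y = false)
    (I : ℕ → (ℕ → ℕ → ℕ) → Prop) (Φ : (ℕ → ℕ → ℕ) → ℕ) (c : ℕ → ℕ) {e₁ e₂ : Exp} {lo : ℕ}
    (hstep : ∀ k s', lo ≤ k → k < hi → 1 ≤ M → s'.Bdd M → Frame (forTo x y e₁ e₂ P) s₀ s' →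
      s'.reg x = k → s'.reg y = hi → I k s'.arr →
      Runs W M P s' fun t s'' => t + Φ s''.arr ≤ c k + Φ s'.arr ∧ I (k + 1) s''.arr)
    (d : ℕ) : ∀ k s, d = hi - k → lo ≤ k → k ≤ hi → Frame (forTo x y e₁ e₂ P) s₀ s → s.reg x = k →
      s.reg y = hi → I k s.arr →
      Runs W M (.whileNonzero (.minus (.reg y) (.reg x))
        (.seq P (.setReg x (.plus (.reg x) (.lit 1))))) s fun t s' =>
          t + Φ s'.arr ≤ 4 + ∑ j ∈ Finset.Ico k hi, (c j + 8) + Φ s.arr ∧ I hi s'.arr := by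
  induction d with
  | zero =>
    intro k s hd _ hk _ hsx hsy hI hM hW hs
    have hk : k = hi := by omega
    subst hk
    refine ⟨_, s, .whileFalse (Exp.fits (by simp [Exp.weight]) hM hW hs) ?_, hs, ?_, hI⟩
    · simp [Exp.val, hsx, hsy]
    · simp [Exp.cost]
  | succ d ih =>
    intro k s hd hlo hk hF hsx hsy hI hM hW hs
    have hlt : k < hi := by omega
    obtain ⟨t₁, s₁, he₁, hs₁, ht₁, hI₁⟩ := hstep k s hlo hlt hM hs hF hsx hsy hI hM hW hs
    have hf := he₁.frame
    have h1x : s₁.reg x = k := (hf.1 x hx).trans hsx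
    have h1y : s₁.reg y = hi := (hf.1 y hy).trans hsy
    have hval : Exp.val s₁ (.plus (.reg x) (.lit 1)) = k + 1 := by simp [Exp.val, h1x]
    -- The counter never passes `hi`, which is a stored word and hence at most `M`.
    have hle : k + 1 ≤ M := by
      have := hs₁.1 y
      omega
    have he₂ := Exec.setReg (W := W) s₁ x (.plus (.reg x) (.lit 1))
      (Exp.fits (by simp [Exp.weight]) hM hW hs₁)
    rw [hval] at he₂
    have hs₂ : (s₁.setReg x (k + 1)).Bdd M := hs₁.setReg hle
    have hF₂ : Frame (forTo x y e₁ e₂ P) s₀ (s₁.setReg x (k + 1)) := by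
      refine ⟨fun z hz => ?_, fun A hA => ?_⟩
      · have hz' := hz
        simp only [forTo, Cmd.writesReg, Bool.or_eq_false_iff, beq_eq_false_iff_ne] at hz'
        simp only [Store.setReg]
        rw [Function.update_of_ne hz'.2.1.symm, hf.1 z hz'.2.2.1, hF.1 z hz]
      · have hA' := hA
        simp only [forTo, Cmd.writesArr, Bool.or_eq_false_iff] at hA'
        exact (hf.2 A hA'.2.2.1).trans (hF.2 A hA)
    obtain ⟨t₂, s₃, he₃, hs₃, ht₃, hI₃⟩ := ih (k + 1) (s₁.setReg x (k + 1)) (by omega) (by omega)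
      (by omega) hF₂ (by simp [Store.setReg]) (by simp [Store.setReg, hxy.symm, h1y]) hI₁
      hM hW hs₂
    refine ⟨_, _, .whileTrue (Exp.fits (by simp [Exp.weight]) hM hW hs) ?_ (.seq he₁ he₂) he₃, hs₃, ?_, hI₃⟩
    · simp only [Exp.val, hsx, hsy]
      omega
    · rw [Finset.sum_eq_sum_Ico_succ_bot hlt]
      simp only [Exp.cost] at ht₃ ⊢
      have : (s₁.setReg x (k + 1)).arr = s₁.arr := rfl
      rw [this] at ht₃
      omega

/-- The rule for loops with an invariant `I`, a potential `Φ` and a bound `c` for the amortized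
time of a round. -/
theorem Runs.forTo {x y : ℕ} {e₁ e₂ : Exp} {lo hi : ℕ}
    (I : ℕ → (ℕ → ℕ → ℕ) → Prop) (Φ : (ℕ → ℕ → ℕ) → ℕ) (c : ℕ → ℕ) (hxy : x ≠ y)
    (hx : P.writesReg x = false) (hy : P.writesReg y = false)
    (hw₁ : e₁.weight ≤ 20) (hw₂ : e₂.weight ≤ 20)
    (hlo : e₁.val (s.setReg y hi) = lo) (hhi : e₂.val s = hi) (hle : lo ≤ hi)
    (hM : 1 ≤ M → s.Bdd M → hi ≤ M) (h0 : I lo s.arr)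
    (hstep : ∀ k s', lo ≤ k → k < hi → 1 ≤ M → s'.Bdd M → Frame (C4Dom.forTo x y e₁ e₂ P) s s' →
      s'.reg x = k → s'.reg y = hi → I k s'.arr →
      Runs W M P s' fun t s'' => t + Φ s''.arr ≤ c k + Φ s'.arr ∧ I (k + 1) s''.arr) :
    Runs W M (C4Dom.forTo x y e₁ e₂ P) s fun t s' =>
      t + Φ s'.arr ≤ e₁.cost + e₂.cost + 6 + ∑ j ∈ Finset.Ico lo hi, (c j + 8) + Φ s.arr ∧
        I hi s'.arr := by
  refine Runs.seq (Runs.setReg hw₂ (fun h1 h2 => hhi ▸ hM h1 h2) ?_)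
  refine Runs.of_bdd fun h1 hb => ?_
  have hhiM : hi ≤ M := by
    have := hb.1 y
    simpa [Store.setReg, hhi] using this
  rw [hhi]
  refine Runs.seq (Runs.setReg hw₁ (fun _ _ => hlo ▸ hle.trans hhiM) ?_)
  rw [hlo]
  refine (Runs.while_forTo hi s hxy hx hy I Φ c hstep _ lo ((s.setReg y hi).setReg x lo) rfl le_rfl hle ⟨?_, ?_⟩
    (by simp [Store.setReg]) (by simp [Store.setReg, hxy.symm]) h0).mono ?_
  · intro z hz
    simp only [C4Dom.forTo, Cmd.writesReg, Bool.or_eq_false_iff, beq_eq_false_iff_ne] at hz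
    simp [Store.setReg, hz.1.symm, hz.2.1.symm]
  · intro A _
    rfl
  · rintro t s' - - - ⟨ht, hI⟩
    refine ⟨?_, hI⟩
    have : ((s.setReg y hi).setReg x lo).arr = s.arr := rfl
    rw [this] at ht
    omega

end Logic

/-! ### Checking fewer triples without computing reachability -/

section Core

variable {H : SimpleGraph ℕ} {v : ℕ}

/-- The test for the triples with high vertex `v` that the program checks: it replaces the
search for `REACH` by a look at the out-neighbor of the low vertex. -/
def Checked (H : SimpleGraph ℕ) (v w : ℕ) : Prop :=
  IsTriple H v w ∧ ((∃ a, H.Adj w a ∧ a < v ∧ ¬ H.Adj v a) ∨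
    (MarkIn H (Set.Ioi v) w ∧ ¬ ∃ p ≤ v, EdgeIn H (Set.Ioi v) w p))

/-- Suppose `v` dominates `w`. Then no neighbor of `w` misses `N(v)`. If `(v', w')` marked `w`, then
`v` belongs to `L(v', w')` and lies above `w`, so the successor of `w` there is an out-neighbor not
above `v`. -/
theorem Checked.isUnsafe {w : ℕ} (h : Checked H v w) : Unsafe H v w := by
  obtain ⟨ht, hsel⟩ := h
  refine ⟨ht, fun hd => ?_⟩
  rcases hsel with ⟨a, hwa, -, hva⟩ | ⟨⟨v', hv', w', hu, hwL⟩, hno⟩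
  · exact hva (hd.adj hwa)
  · have hvL : v ∈ leastCommon H v' w' :=
      ⟨(hd.adj hwL.1.symm).symm, (hd.adj hwL.2.1.symm).symm, hv'⟩
    obtain ⟨p, hp, hn⟩ := exists_isNext Set.finite_Iio hwL hvL ht.1
    exact hno ⟨p, hp, v', hv', w', hu, hn⟩

/-- If `(v, w)` is skipped, `w` is marked and has an out-neighbor `p ≤ v` that dominates it. Then `p
≠ v`, the triple `(v, p)` is again unsafe, and its least common neighborhood contains the old one.
Since `w < p`, the difference `v - w` decreases and the climb ends. -/
theorem Unsafe.exists_checked (hH : H.CliqueFree 3) (hgood : GoodOn H (Set.Ioi v)) {w : ℕ}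
    (h : Unsafe H v w) : ∃ q, Checked H v q ∧ leastCommon H v w ⊆ leastCommon H v q := by
  induction hd : v - w using Nat.strong_induction_on generalizing w with
  | _ d ih =>
    by_cases hc : Checked H v w
    · exact ⟨w, hc, subset_rfl⟩
    · simp only [Checked, h.1, true_and, not_or, not_and, not_not] at hc
      have hm : MarkIn H (Set.Ioi v) w := h.markIn hH fun a hwa hav => by
        by_contra hva
        exact hc.1 ⟨a, hwa, hav, hva⟩
      obtain ⟨p, hpv, hE⟩ := hc.2 hm
      have hpw : Dominates H p w := hE.dominates hgood
      have hwp : w < p := by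
        obtain ⟨_, _, _, _, hn⟩ := hE
        exact hn.2.2.1
      have hne : p ≠ v := by
        rintro rfl
        exact h.2 hpw
      have hsub : leastCommon H v w ⊆ leastCommon H v p := fun a ha =>
        ⟨ha.1, hpw.adj ha.2.1, ha.2.2⟩
      have hu : Unsafe H v p :=
        ⟨⟨lt_of_le_of_ne hpv hne, h.1.2.mono hsub⟩, fun hvp => h.2 (hvp.trans hpw)⟩
      obtain ⟨q, hq, hsub'⟩ := ih (v - p) (by omega) hu rfl
      exact ⟨q, hq, hsub.trans hsub'⟩

/-- The successor of `a` in the larger set dominates `a`, hence is adjacent to `w` and already lies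
in the smaller set. No edge is lost by checking only the larger triple. -/
theorem IsNext.of_subset {w q a b : ℕ} (h : IsNext H v w a b)
    (hsub : leastCommon H v w ⊆ leastCommon H v q)
    (hdom : ∀ a b, IsNext H v q a b → Dominates H b a) : IsNext H v q a b := by
  obtain ⟨ha, hb, hab, hno⟩ := h
  obtain ⟨c, hcb, hn⟩ := exists_isNext Set.finite_Iio (hsub ha) (hsub hb) hab
  have hc : c ∈ leastCommon H v w :=
    ⟨hn.2.1.1, ((hdom a c hn).adj ha.2.1.symm).symm, hn.2.1.2.2⟩
  rcases hcb.lt_or_eq with hlt | rfl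
  · exact absurd ⟨c, hc, hn.2.2.1, hlt⟩ hno
  · exact hn

/-- The pairs `(a', w')` with `a' ∈ N(v)`, `a' < v`, `w' ∈ N(a')` that come before `(a, w)`. -/
def Before (H : SimpleGraph ℕ) (v a w a' w' : ℕ) : Prop :=
  H.Adj v a' ∧ a' < v ∧ H.Adj a' w' ∧ (a' < a ∨ a' = a ∧ w' < w)

/-- The set `D` of pairs together with `(a, w)`. -/
def insertPair (D : ℕ → ℕ → Prop) (a w a' w' : ℕ) : Prop := D a' w' ∨ (a' = a ∧ w' = w)

/-- The pairs `(a, w)` with `a ∈ N(v)`, `a < v` and `w ∈ N(a)`. -/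
def AllPairs (H : SimpleGraph ℕ) (v a w : ℕ) : Prop := H.Adj v a ∧ a < v ∧ H.Adj a w

/-- The invariant of the checks for the high vertex `v`, when the pairs `(b, w)` in `D` have been
treated. -/
structure PassInv (H : SimpleGraph ℕ) (v : ℕ) (D : ℕ → ℕ → Prop) (next mark last fl : ℕ → ℕ) :
    Prop where
  flag : fl 0 = 0 ∨ (fl 0 = 1 ∧ fl 1 = v ∧ Bad H v (fl 3) (fl 2) (fl 4))
  next_iff : fl 0 = 0 → ∀ a b, next a = b + 1 ↔ EdgeIn H (Set.Ioi v) a b ∨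
    ∃ w, Checked H v w ∧ IsNext H v w a b ∧ D b w
  dom : fl 0 = 0 → ∀ a b, next a = b + 1 → Dominates H b a
  mark_iff : fl 0 = 0 → ∀ a, mark a ≠ 0 ↔ MarkIn H (Set.Ioi v) a ∨ ∃ w, Checked H v w ∧ D a w
  last : fl 0 = 0 → ∀ w, Checked H v w → (last w = 0 ∧ ∀ b, ¬ D b w) ∨
    ∃ a, last w = a + 1 ∧ D a w ∧ ∀ b, D b w → b ≤ a

variable {D : ℕ → ℕ → Prop} {next mark last fl : ℕ → ℕ} {a b w : ℕ}

theorem PassInv.of_flag (h : PassInv H v D next mark last fl) (hf : fl 0 ≠ 0) (D' : ℕ → ℕ → Prop)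
    (next' mark' last' : ℕ → ℕ) : PassInv H v D' next' mark' last' fl :=
  ⟨h.flag, fun h => absurd h hf, fun h => absurd h hf, fun h => absurd h hf,
    fun h => absurd h hf⟩

theorem PassInv.of_bad (hbad : Bad H v w a b) (h0 : fl 0 = 1) (h1 : fl 1 = v) (h2 : fl 2 = a)
    (h3 : fl 3 = w) (h4 : fl 4 = b) (D : ℕ → ℕ → Prop) (next mark last : ℕ → ℕ) :
    PassInv H v D next mark last fl := by
  have hf : fl 0 ≠ 0 := by omega
  refine ⟨.inr ⟨h0, h1, ?_⟩, fun h => absurd h hf, fun h => absurd h hf, fun h => absurd h hf,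
    fun h => absurd h hf⟩
  rwa [h2, h3, h4]

theorem PassInv.of_not_checked (h : PassInv H v D next mark last fl) (hc : ¬ Checked H v w) :
    PassInv H v (insertPair D b w) next mark last fl := by
  have key : ∀ {w' b'}, Checked H v w' → (insertPair D b w b' w' ↔ D b' w') := by
    intro w' b' hw'
    refine or_iff_left ?_
    rintro ⟨-, rfl⟩
    exact hc hw'
  refine ⟨h.flag, fun hf x y => (h.next_iff hf x y).trans ?_, h.dom, fun hf x =>
    (h.mark_iff hf x).trans ?_, fun hf x hx => ?_⟩
  · refine or_congr_right (exists_congr fun w' => and_congr_right fun hw' => ?_)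
    rw [key hw']
  · refine or_congr_right (exists_congr fun w' => and_congr_right fun hw' => ?_)
    rw [key hw']
  · simpa only [key hx] using h.last hf x hx

theorem Before.mem_leastCommon {w' a' : ℕ} (h : Before H v a w a' w') :
    a' ∈ leastCommon H v w' := ⟨h.1, h.2.2.1.symm, h.2.1⟩

/-- The last vertex of `L(v, w)` before `b` that was met is the predecessor of `b`. -/
theorem PassInv.isNext (h : PassInv H v D next mark last fl) (hf : fl 0 = 0)
    (hD : D = Before H v b w) (hb : AllPairs H v b w) (hc : Checked H v w) (ha : last w = a + 1) :
    IsNext H v w a b := by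
  rcases h.last hf w hc with ⟨h0, -⟩ | ⟨a', ha', hDa, hmax⟩
  · omega
  · obtain rfl : a = a' := by omega
    subst hD
    refine ⟨hDa.mem_leastCommon, ⟨hb.1, hb.2.2.symm, hb.2.1⟩, ?_, ?_⟩
    · have := hDa.2.2.2
      omega
    · rintro ⟨c, hcL, hac, hcb⟩
      have := hmax c ⟨hcL.1, hcL.2.2, hcL.2.1.symm, .inl hcb⟩
      omega

theorem PassInv.last_insert (h : PassInv H v D next mark last fl) (hf : fl 0 = 0)
    (hD : D = Before H v b w) : ∀ w', Checked H v w' →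
      (Function.update last w (b + 1) w' = 0 ∧ ∀ b', ¬ insertPair D b w b' w') ∨
      ∃ a, Function.update last w (b + 1) w' = a + 1 ∧ insertPair D b w a w' ∧
        ∀ b', insertPair D b w b' w' → b' ≤ a := by
  intro w' hw'
  by_cases hww : w' = w
  · subst hww
    refine .inr ⟨b, by simp, .inr ⟨rfl, rfl⟩, ?_⟩
    rintro b' (hb' | ⟨rfl, -⟩)
    · subst hD
      have := hb'.2.2.2
      omega
    · exact le_rfl
  · simpa [insertPair, hww] using h.last hf w' hw'

theorem PassInv.mark_insert (h : PassInv H v D next mark last fl) (hf : fl 0 = 0)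
    (hc : Checked H v w) (x : ℕ) : Function.update mark b 1 x ≠ 0 ↔
      MarkIn H (Set.Ioi v) x ∨ ∃ w', Checked H v w' ∧ insertPair D b w x w' := by
  by_cases hxb : x = b
  · subst hxb
    simp only [Function.update_self, ne_eq, one_ne_zero, not_false_eq_true, true_iff]
    exact .inr ⟨w, hc, .inr ⟨rfl, rfl⟩⟩
  · simp only [Function.update_of_ne hxb, insertPair, hxb, false_and, or_false]
    exact h.mark_iff hf x

/-- No pair is completed here: a predecessor of `b` in the triple would have been met earlier and
recorded in `last`. -/
theorem PassInv.first (h : PassInv H v D next mark last fl) (hD : D = Before H v b w)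
    (hc : Checked H v w) (h0 : last w = 0) :
    PassInv H v (insertPair D b w) next (Function.update mark b 1)
      (Function.update last w (b + 1)) fl := by
  refine ⟨h.flag, fun hf x y => (h.next_iff hf x y).trans ?_, h.dom,
    fun hf => h.mark_insert hf hc, fun hf => h.last_insert hf hD⟩
  refine or_congr_right (exists_congr fun w' => and_congr_right fun hw' =>
    and_congr_right fun hn => (or_iff_left ?_).symm)
  rintro ⟨rfl, rfl⟩
  rcases h.last hf w' hw' with ⟨-, hno⟩ | ⟨a, ha, -, -⟩
  · subst hD
    exact hno x ⟨hn.1.1, hn.1.2.2, hn.1.2.1.symm, .inl hn.2.2.1⟩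
  · omega

/-- The pair completed by `b` reproduces an edge that is already present, so `next` remains correct
without a test. -/
theorem PassInv.again (h : PassInv H v D next mark last fl) (hD : D = Before H v b w)
    (hb : AllPairs H v b w) (hc : Checked H v w) (ha : last w = a + 1) (hn : next a = b + 1) :
    PassInv H v (insertPair D b w) next (Function.update mark b 1)
      (Function.update last w (b + 1)) fl := by
  refine ⟨h.flag, fun hf x y => ⟨fun hxy => ?_, ?_⟩, h.dom,
    fun hf => h.mark_insert hf hc, fun hf => h.last_insert hf hD⟩
  · rcases (h.next_iff hf x y).1 hxy with hE | ⟨w', hw', hn', hDw⟩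
    · exact .inl hE
    · exact .inr ⟨w', hw', hn', .inl hDw⟩
  · rintro (hE | ⟨w', hw', hn', hDw | ⟨rfl, rfl⟩⟩)
    · exact (h.next_iff hf x y).2 (.inl hE)
    · exact (h.next_iff hf x y).2 (.inr ⟨w', hw', hn', hDw⟩)
    · have hab := h.isNext hf hD hb hc ha
      obtain rfl : x = a := by
        rcases lt_trichotomy x a with hlt | heq | hgt
        · exact absurd ⟨a, hab.1, hlt, hab.2.2.1⟩ hn'.2.2.2
        · exact heq
        · exact absurd ⟨x, hn'.1, hgt, hn'.2.2.1⟩ hab.2.2.2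
      exact hn

/-- The pair completed by `b` gives `a` its first out-edge. This is the only case in which dominance
has to be tested. -/
theorem PassInv.new (h : PassInv H v D next mark last fl) (hD : D = Before H v b w)
    (hb : AllPairs H v b w) (hc : Checked H v w) (ha : last w = a + 1) (hn : next a = 0)
    (hd : Dominates H b a) :
    PassInv H v (insertPair D b w) (Function.update next a (b + 1)) (Function.update mark b 1)
      (Function.update last w (b + 1)) fl := by
  refine ⟨h.flag, fun hf x y => ?_, fun hf x y hxy => ?_,
    fun hf => h.mark_insert hf hc, fun hf => h.last_insert hf hD⟩
  · have hab := h.isNext hf hD hb hc ha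
    by_cases hx : x = a
    · subst hx
      have hold := h.next_iff hf x y
      rw [hn] at hold
      simp only [Function.update_self]
      constructor
      · intro hy
        obtain rfl : b = y := by omega
        exact .inr ⟨w, hc, hab, .inr ⟨rfl, rfl⟩⟩
      · rintro (hE | ⟨w', hw', hn', hDw | ⟨rfl, rfl⟩⟩)
        · exact absurd (hold.2 (.inl hE)) (by omega)
        · exact absurd (hold.2 (.inr ⟨w', hw', hn', hDw⟩)) (by omega)
        · rfl
    · rw [Function.update_of_ne hx, h.next_iff hf x y]
      refine or_congr_right (exists_congr fun w' => and_congr_right fun hw' =>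
        and_congr_right fun hn' => (or_iff_left ?_).symm)
      rintro ⟨rfl, rfl⟩
      refine hx ?_
      rcases lt_trichotomy x a with hlt | heq | hgt
      · exact absurd ⟨a, hab.1, hlt, hab.2.2.1⟩ hn'.2.2.2
      · exact heq
      · exact absurd ⟨x, hn'.1, hgt, hn'.2.2.1⟩ hab.2.2.2
  · by_cases hx : x = a
    · subst hx
      simp only [Function.update_self] at hxy
      obtain rfl : b = y := by omega
      exact hd
    · rw [Function.update_of_ne hx] at hxy
      exact h.dom hf x y hxy

/-- The recorded out-neighbor of `a` dominates `a`. If `b` did so too, uniqueness of dominating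
successors would identify the two, so the mismatch alone proves the pair bad. -/
theorem PassInv.bad_of_ne (h : PassInv H v D next mark last fl) (hf : fl 0 = 0)
    (hD : D = Before H v b w) (hb : AllPairs H v b w) (hc : Checked H v w) (ha : last w = a + 1)
    (h0 : next a ≠ 0) (hne : next a ≠ b + 1) : Bad H v w a b := by
  have hab := h.isNext hf hD hb hc ha
  refine ⟨hc.isUnsafe, hab, fun hd => ?_⟩
  obtain ⟨c, hc'⟩ := Nat.exists_eq_add_one_of_ne_zero h0
  have hdc := h.dom hf a c hc'
  have : ∃ v' w', IsNext H v' w' a c := by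
    rcases (h.next_iff hf a c).1 hc' with ⟨v', -, w', -, hn⟩ | ⟨w', -, hn, -⟩
    · exact ⟨v', w', hn⟩
    · exact ⟨v, w', hn⟩
  obtain ⟨v', w', hn⟩ := this
  rw [hn.unique hab hdc hd] at hc'
  exact hne hc'

/-- The pass writes marks and out-edges only at neighbors of `v`. As the graph has no triangle, `w`
is not one of them, so its mark and its out-edge are still those left by the higher vertices.
Out-neighbors are stored increased by one, whence `v + 1 < next w` says that the out-neighbor is
above `v`. The count `dlt` includes `v` in its range, which is harmless because `v` and `w` are not
adjacent. -/
theorem PassInv.checked_iff (hH : H.CliqueFree 3) (h : PassInv H v D next mark last fl)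
    (hf : fl 0 = 0) (hD : D = Before H v b w) (hb : AllPairs H v b w) (hw : w < v)
    {cnt dlt : ℕ} (hcnt : cnt = {a | AllPairs H v a w}.ncard)
    (hdlt : dlt = {a | H.Adj w a ∧ a < v + 1}.ncard) :
    Checked H v w ↔ cnt ≠ dlt ∨ (mark w ≠ 0 ∧ (next w = 0 ∨ v + 1 < next w)) := by
  have hvw : ¬ H.Adj v w := CliqueFree.not_adj hH hb.1 hb.2.2
  have ht : IsTriple H v w := ⟨hw, b, hb.1, hb.2.2.symm, hb.2.1⟩
  subst hD
  have hmark : mark w ≠ 0 ↔ MarkIn H (Set.Ioi v) w := by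
    rw [h.mark_iff hf, or_iff_left]
    rintro ⟨w', -, hw'⟩
    exact hvw hw'.1
  have hnext : ∀ p, next w = p + 1 ↔ EdgeIn H (Set.Ioi v) w p := by
    intro p
    rw [h.next_iff hf, or_iff_left]
    rintro ⟨w', -, hw', -⟩
    exact hvw hw'.1.1
  have hcard : cnt ≠ dlt ↔ ∃ a, H.Adj w a ∧ a < v ∧ ¬ H.Adj v a := by
    have hfin : {a | H.Adj w a ∧ a < v + 1}.Finite :=
      (Set.finite_Iio (v + 1)).subset fun a ha => ha.2
    have hsub : {a | AllPairs H v a w} ⊆ {a | H.Adj w a ∧ a < v + 1} := fun a ha =>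
      ⟨ha.2.2.symm, ha.2.1.trans (Nat.lt_succ_self v)⟩
    rw [← not_iff_not, not_not, hcnt, hdlt]
    constructor
    · rintro he ⟨a, hwa, hav, hva⟩
      have := (Set.eq_of_subset_of_ncard_le hsub he.ge hfin).ge ⟨hwa, hav.trans (Nat.lt_succ_self v)⟩
      exact hva this.1
    · intro hno
      congr 1
      refine hsub.antisymm fun a ha => ?_
      have hav : a < v := by
        have h1 := ha.2
        have : a ≠ v := by
          rintro rfl
          exact hvw ha.1.symm
        omega
      refine ⟨?_, hav, ha.1.symm⟩
      by_contra hva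
      exact hno ⟨a, ha.1, hav, hva⟩
  have hP : (next w = 0 ∨ v + 1 < next w) ↔ ¬ ∃ p ≤ v, EdgeIn H (Set.Ioi v) w p := by
    constructor
    · rintro hor ⟨p, hp, hE⟩
      have := (hnext p).2 hE
      omega
    · intro hno
      by_contra hcon
      push Not at hcon
      obtain ⟨p, hp⟩ := Nat.exists_eq_add_one_of_ne_zero hcon.1
      exact hno ⟨p, by omega, (hnext p).1 hp⟩
  simp only [Checked, ht, true_and, hcard, hmark, hP]

/-- The invariant of the main loop, when the high vertices from `k` on have been treated. -/
structure CoreInv (H : SimpleGraph ℕ) (k : ℕ) (next mark dlt fl : ℕ → ℕ) : Prop where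
  flag : fl 0 = 0 ∨ (fl 0 = 1 ∧ FirstBad H (fl 1) (fl 3) (fl 2) (fl 4))
  next_iff : fl 0 = 0 → ∀ a b, next a = b + 1 ↔ EdgeIn H (Set.Ici k) a b
  mark_iff : fl 0 = 0 → ∀ a, mark a ≠ 0 ↔ MarkIn H (Set.Ici k) a
  good : fl 0 = 0 → GoodOn H (Set.Ici k)
  dlt_eq : fl 0 = 0 → ∀ w < k, dlt w = {a | H.Adj w a ∧ a < k}.ncard

theorem Ici_succ_nat (v : ℕ) : Set.Ici (v + 1) = Set.Ioi v := by
  ext x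
  simp

theorem CoreInv.passInv {dlt : ℕ → ℕ} (h : CoreInv H (v + 1) next mark dlt fl) (hf : fl 0 = 0)
    (hlast : ∀ a w, AllPairs H v a w → last w = 0) :
    PassInv H v (fun _ _ => False) next mark last fl := by
  have hgood := h.good hf
  rw [Ici_succ_nat] at hgood
  refine ⟨.inl hf, fun _ x y => ?_, fun _ x y hxy => ?_, fun _ x => ?_, fun _ w hw => ?_⟩
  · simpa [Ici_succ_nat] using h.next_iff hf x y
  · rw [h.next_iff hf, Ici_succ_nat] at hxy
    exact hxy.dominates hgood
  · simpa [Ici_succ_nat] using h.mark_iff hf x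
  · obtain ⟨⟨-, c, hc⟩, -⟩ := hw
    exact .inl ⟨hlast c w ⟨hc.1, hc.2.2, hc.2.1.symm⟩, fun _ h => h⟩

/-- After the full pass every pair of a checked triple is recorded in `next` and thus dominated.
Each unsafe triple is covered by a checked one that has all of its vertices and successor pairs, so
edges, marks and absence of bad pairs carry over from checked to unsafe triples. -/
theorem PassInv.coreInv (hH : H.CliqueFree 3) (h : PassInv H v (AllPairs H v) next mark last fl)
    (hgood : GoodOn H (Set.Ioi v)) {dlt : ℕ → ℕ}
    (hdlt : ∀ w < v, dlt w = {a | H.Adj w a ∧ a < v}.ncard) :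
    CoreInv H v next mark dlt fl := by
  have hmem : ∀ {a w}, a ∈ leastCommon H v w → AllPairs H v a w := fun h =>
    ⟨h.1, h.2.2, h.2.1.symm⟩
  have hchk : fl 0 = 0 → ∀ q, Checked H v q → ∀ a b, IsNext H v q a b → Dominates H b a :=
    fun hf q hq a b hab => h.dom hf a b ((h.next_iff hf a b).2 (.inr ⟨q, hq, hab, hmem hab.2.1⟩))
  have hE : fl 0 = 0 → ∀ w a b, Unsafe H v w → IsNext H v w a b →
      ∃ q, Checked H v q ∧ IsNext H v q a b := by
    intro hf w a b hu hab
    obtain ⟨q, hq, hsub⟩ := hu.exists_checked hH hgood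
    exact ⟨q, hq, hab.of_subset hsub (hchk hf q hq)⟩
  refine ⟨?_, fun hf a b => ?_, fun hf a => ?_, fun hf => ?_, fun _ => hdlt⟩
  · refine h.flag.imp_right ?_
    rintro ⟨h0, h1, hb⟩
    rw [h1]
    exact ⟨h0, hb, hgood⟩
  · rw [h.next_iff hf, EdgeIn.Ici_iff]
    refine or_congr_right ⟨?_, ?_⟩
    · rintro ⟨w, hw, hab, -⟩
      exact ⟨w, hw.isUnsafe, hab⟩
    · rintro ⟨w, hw, hab⟩
      obtain ⟨q, hq, hab'⟩ := hE hf w a b hw hab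
      exact ⟨q, hq, hab', hmem hab'.2.1⟩
  · rw [h.mark_iff hf, MarkIn.Ici_iff]
    refine or_congr_right ⟨?_, ?_⟩
    · rintro ⟨w, hw, hab⟩
      exact ⟨w, hw.isUnsafe, hab.1, hab.2.2.symm, hab.2.1⟩
    · rintro ⟨w, hw, ha⟩
      obtain ⟨q, hq, hsub⟩ := hw.exists_checked hH hgood
      exact ⟨q, hq, hmem (hsub ha)⟩
  · refine GoodOn.Ici_iff.2 ⟨hgood, fun w a b hb => hb.2.2 ?_⟩
    obtain ⟨q, hq, hab'⟩ := hE hf w a b hb.1 hb.2.1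
    exact hchk hf q hq a b hab'

end Core

/-! ### Loops over sorted adjacency lists -/

section Loops

/-- The neighbors of `u` in `H` are listed in increasing order in the cells `off u, …,
off (u + 1) - 1` of `adj`. -/
structure SortedAdj (n : ℕ) (H : SimpleGraph ℕ) (off adj : ℕ → ℕ) : Prop where
  off_zero : off 0 = 0
  off_le : ∀ u < n, off u ≤ off (u + 1)
  lt : ∀ u x, H.Adj u x → u < n
  mem : ∀ u < n, ∀ x, H.Adj u x ↔ ∃ k, off u ≤ k ∧ k < off (u + 1) ∧ adj k = x
  strict : ∀ u < n, ∀ k l, off u ≤ k → k < l → l < off (u + 1) → adj k < adj l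

/-- `for z in N(u) do P`, where `u` and `z` are registers. -/
def forNbr (x y u z : ℕ) (P : Cmd) : Cmd :=
  forTo x y (.cell 3 (.reg u)) (.cell 3 (.plus (.reg u) (.lit 1)))
    (.seq (.setReg z (.cell 4 (.reg x))) P)

variable {n : ℕ} {H : SimpleGraph ℕ} {off adj : ℕ → ℕ} {W M : ℕ} {P : Cmd} {s : Store}

/-- Since the list increases strictly, a visited prefix is an initial segment of `N(a)`. Loop
invariants can then speak of vertices below the current one instead of positions. -/
theorem SortedAdj.prefix_iff (hA : SortedAdj n H off adj) {a k : ℕ} (ha : a < n) (hk : off a ≤ k)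
    (hk' : k < off (a + 1)) (y : ℕ) :
    (∃ l, off a ≤ l ∧ l < k ∧ adj l = y) ↔ H.Adj a y ∧ y < adj k := by
  rw [hA.mem a ha]
  constructor
  · rintro ⟨l, h1, h2, rfl⟩
    exact ⟨⟨l, h1, by omega, rfl⟩, hA.strict a ha l k h1 h2 hk'⟩
  · rintro ⟨⟨l, h1, h2, rfl⟩, hlt⟩
    refine ⟨l, h1, ?_, rfl⟩
    by_contra hkl
    rcases (not_lt.1 hkl).lt_or_eq with h | h
    · exact absurd (hA.strict a ha k l hk h h2) (by omega)
    · subst h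
      omega

/-- The predicate passed to `I` is the set of neighbors visited so far. Of the `11` steps per round,
`8` are loop control and `3` load the neighbor. -/
theorem Runs.forNbr {x y u z a : ℕ} (hA : SortedAdj n H off adj) (h3 : s.arr 3 = off)
    (h4 : s.arr 4 = adj)
    (I : (ℕ → Prop) → (ℕ → ℕ → ℕ) → Prop) (Φ : (ℕ → ℕ → ℕ) → ℕ) (c : ℕ → ℕ)
    (hu : s.reg u = a) (ha : a < n)
    (hne : x ≠ y ∧ x ≠ u ∧ y ≠ u ∧ z ≠ x ∧ z ≠ y)
    (hx : P.writesReg x = false) (hy : P.writesReg y = false)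
    (hP3 : P.writesArr 3 = false) (hP4 : P.writesArr 4 = false)
    (h0 : I (fun _ => False) s.arr)
    (hstep : ∀ w s', H.Adj a w → s'.Bdd M → Frame (C4Dom.forNbr x y u z P) s s' → s'.reg z = w →
      I (fun y => H.Adj a y ∧ y < w) s'.arr →
      Runs W M P s' fun t s'' => t + Φ s''.arr ≤ c w + Φ s'.arr ∧
        I (fun y => (H.Adj a y ∧ y < w) ∨ y = w) s''.arr) :
    Runs W M (C4Dom.forNbr x y u z P) s fun t s' =>
      t + Φ s'.arr ≤ 12 + ∑ k ∈ Finset.Ico (off a) (off (a + 1)), (c (adj k) + 11) + Φ s.arr ∧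
        I (H.Adj a) s'.arr := by
  obtain ⟨hxy, hxu, hyu, hzx, hzy⟩ := hne
  refine (Runs.forTo (lo := off a) (hi := off (a + 1))
    (fun k arr => I (fun y => ∃ l, off a ≤ l ∧ l < k ∧ adj l = y) arr) Φ
    (fun k => c (adj k) + 3) hxy ?_ ?_ (by simp [Exp.weight]) (by simp [Exp.weight]) ?_ ?_
    (hA.off_le a ha) ?_ ?_ ?_).mono ?_
  · simp [Cmd.writesReg, hzx, hx]
  · simp [Cmd.writesReg, hzy, hy]
  · simp [Exp.val, Store.setReg, hyu.symm, hu, h3]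
  · simp [Exp.val, hu, h3]
  · intro _ hb
    have := hb.2 3 (a + 1)
    rwa [h3] at this
  · have : (fun y => ∃ l, off a ≤ l ∧ l < off a ∧ adj l = y) = fun _ => False := by
      ext y
      simp only [iff_false, not_exists]
      omega
    simpa only [this] using h0
  · intro k s' hk hk' hM hb hF hsx hsy hI
    have hs3 : s'.arr 3 = off := by
      rw [hF.2 3 (by simp [C4Dom.forTo, Cmd.writesArr, hP3]), h3]
    have hs4 : s'.arr 4 = adj := by
      rw [hF.2 4 (by simp [C4Dom.forTo, Cmd.writesArr, hP4]), h4]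
    have hval : Exp.val s' (.cell 4 (.reg x)) = adj k := by simp [Exp.val, hsx, hs4]
    refine Runs.seq (Runs.setReg (by simp [Exp.weight]) (fun _ hb => hb.2 4 _) ?_)
    rw [hval]
    have hfun : (fun y => ∃ l, off a ≤ l ∧ l < k ∧ adj l = y) =
        fun y => H.Adj a y ∧ y < adj k := by
      ext y
      exact hA.prefix_iff ha hk hk' y
    have hfun' : (fun y => ∃ l, off a ≤ l ∧ l < k + 1 ∧ adj l = y) =
        fun y => (H.Adj a y ∧ y < adj k) ∨ y = adj k := by
      ext y
      rw [← hA.prefix_iff ha hk hk' y]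
      constructor
      · rintro ⟨l, h1, h2, rfl⟩
        rcases (Nat.lt_succ_iff.1 h2).lt_or_eq with h | rfl
        · exact .inl ⟨l, h1, h, rfl⟩
        · exact .inr rfl
      · rintro (⟨l, h1, h2, rfl⟩ | rfl)
        · exact ⟨l, h1, by omega, rfl⟩
        · exact ⟨k, hk, by omega, rfl⟩
    rw [hfun] at hI
    rw [hfun']
    have hle : adj k ≤ M := by
      have := hb.2 4 k
      rwa [hs4] at this
    refine (hstep (adj k) (s'.setReg z (adj k)) ((hA.mem a ha _).2 ⟨k, hk, hk', rfl⟩)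
      (hb.setReg hle) ⟨fun r hr => ?_, fun A hA => hF.2 A hA⟩ (by simp [Store.setReg]) hI).mono ?_
    · have hr' := hr
      simp only [C4Dom.forNbr, C4Dom.forTo, Cmd.writesReg, Bool.or_eq_false_iff,
        beq_eq_false_iff_ne] at hr'
      simp only [Store.setReg]
      rw [Function.update_of_ne hr'.2.2.1.1.symm]
      exact hF.1 r hr
    · rintro t s'' - - - ⟨ht, hI'⟩
      refine ⟨?_, hI'⟩
      have : (s'.setReg z (adj k)).arr = s'.arr := rfl
      rw [this] at ht
      simp only [Exp.cost]
      omega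
  · rintro t s' - - - ⟨ht, hI⟩
    refine ⟨?_, ?_⟩
    · simpa [Exp.cost, add_assoc] using ht
    · have : (fun y => ∃ l, off a ≤ l ∧ l < off (a + 1) ∧ adj l = y) = H.Adj a := by
        ext y
        exact (hA.mem a ha y).symm
      rwa [this] at hI

/-- `for a in N(v) with a < v do (P; for w in N(a) do R)`, with `v`, `a`, `w` in the registers
`10`, `13`, `16`. -/
def forNN (P R : Cmd) : Cmd :=
  forNbr 11 12 10 13 (.ifNonzero (.minus (.reg 10) (.reg 13)) (.seq P (forNbr 14 15 13 16 R)) .skip)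

/-- A bound for the number of steps of the double loop for `v`. -/
def stepsNN (off adj : ℕ → ℕ) (v : ℕ) : ℕ :=
  1 + ∑ k ∈ Finset.Ico (off v) (off (v + 1)),
    (1 + if adj k < v then off (adj k + 1) - off (adj k) else 0)

/-- `P` runs once for each `a`, with a budget proportional to `d(a) + 1`, and establishes `J a`,
which the inner rounds may use and must preserve. This leaves room to stamp `N(a)` before scanning
it. The inner rounds follow the lexicographic order, so each `L(v, w)` is met in increasing order.
-/
theorem Runs.forNN {v : ℕ} {R : Cmd} (hA : SortedAdj n H off adj) (h3 : s.arr 3 = off)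
    (h4 : s.arr 4 = adj) (hv : s.reg 10 = v) (hvn : v < n)
    (I : (ℕ → ℕ → Prop) → (ℕ → ℕ → ℕ) → Prop) (J : ℕ → (ℕ → ℕ → ℕ) → Prop)
    (Φ : (ℕ → ℕ → ℕ) → ℕ) (c : ℕ)
    (hP : ∀ r, 10 ≤ r → r ≤ 13 → P.writesReg r = false ∧ R.writesReg r = false)
    (hR : ∀ r, 14 ≤ r → r ≤ 15 → R.writesReg r = false)
    (hP3 : P.writesArr 3 = false ∧ R.writesArr 3 = false)
    (hP4 : P.writesArr 4 = false ∧ R.writesArr 4 = false)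
    (h0 : I (fun _ _ => False) s.arr)
    (hpre : ∀ D a s', H.Adj v a → a < v → s'.Bdd M → Frame (C4Dom.forNN P R) s s' →
      s'.reg 13 = a → I D s'.arr →
      Runs W M P s' fun t s'' => t + Φ s''.arr ≤ c * (off (a + 1) - off a + 1) + Φ s'.arr ∧
        I D s''.arr ∧ J a s''.arr)
    (hbody : ∀ D a w s', AllPairs H v a w → D = Before H v a w → s'.Bdd M →
      Frame (C4Dom.forNN P R) s s' → s'.reg 13 = a → s'.reg 16 = w → I D s'.arr → J a s'.arr →
      Runs W M R s' fun t s'' => t + Φ s''.arr ≤ c + Φ s'.arr ∧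
        I (insertPair D a w) s''.arr ∧ J a s''.arr) :
    Runs W M (C4Dom.forNN P R) s fun t s' =>
      t + Φ s'.arr ≤ (2 * c + 50) * stepsNN off adj v + Φ s.arr ∧ I (AllPairs H v) s'.arr := by
  have hPr : ∀ r, 10 ≤ r → r ≤ 13 → (Cmd.ifNonzero (.minus (.reg 10) (.reg 13))
      (.seq P (C4Dom.forNbr 14 15 13 16 R)) .skip).writesReg r = false := by
    intro r h1 h2
    simp only [Cmd.writesReg, C4Dom.forNbr, C4Dom.forTo, (hP r h1 h2).1, (hP r h1 h2).2,
      Bool.false_or, Bool.or_false, Bool.or_eq_false_iff, beq_eq_false_iff_ne]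
    omega
  refine (Runs.forNbr hA h3 h4
    (fun S arr => I (fun a w => (H.Adj v a ∧ a < v ∧ H.Adj a w) ∧ S a) arr) Φ
    (fun a => 17 + c + if a < v then (2 * c + 13) * (off (a + 1) - off a) else 0) hv hvn
    (by decide) (hPr 11 (by omega) (by omega)) (hPr 12 (by omega) (by omega)) ?_ ?_ ?_ ?_).mono ?_
  · simp [Cmd.writesArr, C4Dom.forNbr, C4Dom.forTo, hP3]
  · simp [Cmd.writesArr, C4Dom.forNbr, C4Dom.forTo, hP4]
  · simpa using h0
  · intro a s₀ hva hb hF hs₀ hI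
    have hF10 : s₀.reg 10 = v := by
      rw [hF.1 10 ?_, hv]
      simpa [C4Dom.forNbr, C4Dom.forTo, Cmd.writesReg] using hPr 10 (by omega) (by omega)
    have hFR : ∀ s', Frame (.seq P (C4Dom.forNbr 14 15 13 16 R)) s₀ s' →
        Frame (C4Dom.forNN P R) s s' := by
      intro s' h
      refine hF.trans (h.mono ?_ ?_) <;> intro r hr <;>
        simp_all [C4Dom.forNN, C4Dom.forNbr, C4Dom.forTo, Cmd.writesReg, Cmd.writesArr]
    refine Runs.ifNonzero (by simp [Exp.weight]) (fun hne => ?_) (fun he => ?_)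
    · have hav : a < v := by
        simp only [Exp.val, hF10, hs₀] at hne
        omega
      have han : a < n := hav.trans hvn
      refine Runs.seq ((hpre _ a s₀ hva hav hb hF hs₀ hI).mono ?_)
      rintro t₁ s₁ - hb₁ hF₁ ⟨ht₁, hI₁, hJ₁⟩
      have hFP : Frame (.seq P (C4Dom.forNbr 14 15 13 16 R)) s₀ s₁ := by
        refine hF₁.mono ?_ ?_ <;> intro r hr <;> simp_all [Cmd.writesReg, Cmd.writesArr]
      have hNN₁ := hFR s₁ hFP
      have h13 : s₁.reg 13 = a := (hF₁.1 13 (hP 13 (by omega) (by omega)).1).trans hs₀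
      have hs3 : s₁.arr 3 = off := by
        rw [hNN₁.2 3 ?_, h3]
        simp [Cmd.writesArr, C4Dom.forNN, C4Dom.forNbr, C4Dom.forTo, hP3]
      have hs4 : s₁.arr 4 = adj := by
        rw [hNN₁.2 4 ?_, h4]
        simp [Cmd.writesArr, C4Dom.forNN, C4Dom.forNbr, C4Dom.forTo, hP4]
      refine (Runs.forNbr (P := R) hA hs3 hs4 (fun S arr => I (fun a' w' => ((H.Adj v a' ∧ a' < v ∧
        H.Adj a' w') ∧ H.Adj v a' ∧ a' < a) ∨ (a' = a ∧ S w')) arr ∧ J a arr) Φ (fun _ => c) h13 han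
        (by decide) (hR 14 (by omega) (by omega)) (hR 15 (by omega) (by omega)) hP3.2 hP4.2
        ⟨by simpa using hI₁, hJ₁⟩ ?_).mono ?_
      · rintro w s' haw hb' hF' hs16 ⟨hI', hJ'⟩
        have hFN : Frame (C4Dom.forNN P R) s s' := by
          refine hFR s' (hFP.trans (hF'.mono ?_ ?_)) <;> intro r hr <;>
            simp_all [Cmd.writesReg, Cmd.writesArr]
        have hD : (fun a' w' => ((H.Adj v a' ∧ a' < v ∧ H.Adj a' w') ∧ H.Adj v a' ∧ a' < a) ∨
            (a' = a ∧ (H.Adj a w' ∧ w' < w))) = Before H v a w := by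
          ext a' w'
          simp only [Before]
          constructor
          · rintro (⟨⟨h1, h2, h3⟩, -, h5⟩ | ⟨rfl, h1, h2⟩)
            · exact ⟨h1, h2, h3, .inl h5⟩
            · exact ⟨hva, hav, h1, .inr ⟨rfl, h2⟩⟩
          · rintro ⟨h1, h2, h3, h4 | ⟨rfl, h4⟩⟩
            · exact .inl ⟨⟨h1, h2, h3⟩, h1, h4⟩
            · exact .inr ⟨rfl, h3, h4⟩
        have hD' : (fun a' w' => ((H.Adj v a' ∧ a' < v ∧ H.Adj a' w') ∧ H.Adj v a' ∧ a' < a) ∨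
            (a' = a ∧ ((H.Adj a w' ∧ w' < w) ∨ w' = w))) = insertPair (Before H v a w) a w := by
          rw [← hD]
          ext a' w'
          simp only [insertPair]
          tauto
        rw [hD] at hI'
        rw [hD']
        have h13' : s'.reg 13 = a := by
          rw [hF'.1 13 ?_, h13]
          simpa [C4Dom.forNbr, C4Dom.forTo, Cmd.writesReg] using (hP 13 (by omega) (by omega)).2
        exact hbody _ a w s' ⟨hva, hav, haw⟩ rfl hb' hFN h13' hs16 hI' hJ'
      · rintro t₂ s₂ - - - ⟨ht₂, hI₂, -⟩
        refine ⟨?_, ?_⟩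
        · simp only [Finset.sum_const, Nat.card_Ico, smul_eq_mul] at ht₂
          simp only [Exp.cost, hav, if_true]
          have e1 : (off (a + 1) - off a) * (c + 11) + c * (off (a + 1) - off a + 1) ≤
              c + (2 * c + 13) * (off (a + 1) - off a) := by
            ring_nf
            omega
          omega
        · have hD : (fun a' w' => ((H.Adj v a' ∧ a' < v ∧ H.Adj a' w') ∧ H.Adj v a' ∧ a' < a) ∨
              (a' = a ∧ H.Adj a w')) = fun a' w' => (H.Adj v a' ∧ a' < v ∧ H.Adj a' w') ∧
                ((H.Adj v a' ∧ a' < a) ∨ a' = a) := by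
            ext a' w'
            constructor
            · rintro (h | ⟨rfl, h⟩)
              · exact ⟨h.1, .inl h.2⟩
              · exact ⟨⟨hva, hav, h⟩, .inr rfl⟩
            · rintro ⟨h1, h2 | rfl⟩
              · exact .inl ⟨h1, h2⟩
              · exact .inr ⟨rfl, h1.2.2⟩
          rwa [hD] at hI₂
    · have hav : ¬ a < v := by
        simp only [Exp.val, hF10, hs₀] at he
        omega
      refine Runs.skip ⟨?_, ?_⟩
      · simp only [Exp.cost]
        omega
      · have hD : (fun a' w' => (H.Adj v a' ∧ a' < v ∧ H.Adj a' w') ∧ (H.Adj v a' ∧ a' < a)) =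
            fun a' w' => (H.Adj v a' ∧ a' < v ∧ H.Adj a' w') ∧
              ((H.Adj v a' ∧ a' < a) ∨ a' = a) := by
          ext a' w'
          constructor
          · rintro ⟨h1, h2⟩
            exact ⟨h1, .inl h2⟩
          · rintro ⟨h1, h2 | rfl⟩
            · exact ⟨h1, h2⟩
            · exact absurd h1.2.1 hav
        rwa [hD] at hI
  · rintro t s' - - - ⟨ht, hI⟩
    refine ⟨ht.trans (Nat.add_le_add_right ?_ _), ?_⟩
    · rw [stepsNN, mul_add, Finset.mul_sum]
      refine Nat.add_le_add (by omega) (Finset.sum_le_sum fun k _ => ?_)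
      have : (2 * c + 13) * (off (adj k + 1) - off (adj k)) ≤
          (2 * c + 50) * (off (adj k + 1) - off (adj k)) := Nat.mul_le_mul_right _ (by omega)
      split_ifs <;> rw [mul_add] <;> omega
    · have hD : (fun a' w' => (H.Adj v a' ∧ a' < v ∧ H.Adj a' w') ∧ H.Adj v a') =
          AllPairs H v := by
        ext a' w'
        simp only [AllPairs]
        tauto
      rwa [hD] at hI

end Loops

/-! ### The program for one high vertex and its elementary steps -/

section CoreProgram

/-- Nonzero if and only if the values of `e` and `f` differ. -/
def Exp.differ (e f : Exp) : Exp := .plus (.minus e f) (.minus f e)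

/-- Vertices are stored increased by one, so that a zero cell means that there is none. -/
def succReg (x : ℕ) : Exp := .plus (.reg x) (.lit 1)

/-- `CNT[w] := 0; LAST[w] := 0` for the low vertices `w`. -/
def resetPass : Cmd :=
  forNN .skip (.seq (.setCell 10 (.reg 16) (.lit 0)) (.setCell 11 (.reg 16) (.lit 0)))

/-- `CNT[w] := |L(v, w)|` for the low vertices `w`. -/
def countPass : Cmd :=
  forNN .skip (.setCell 10 (.reg 16) (.plus (.cell 10 (.reg 16)) (.lit 1)))

/-- `STAMP[x] := b + 1` for `x` in `N(b)`, where `b` is in register `13`. -/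
def stampNbrs : Cmd := forNbr 17 18 13 19 (.setCell 13 (.reg 19) (succReg 13))

/-- Record the quadruple `v, a, w, b` in the array `FL`. -/
def failCmd : Cmd :=
  .seq (.setCell 14 (.lit 0) (.lit 1)) <| .seq (.setCell 14 (.lit 1) (.reg 10)) <|
    .seq (.setCell 14 (.lit 2) (.reg 20)) <| .seq (.setCell 14 (.lit 3) (.reg 16)) <|
      .setCell 14 (.lit 4) (.reg 13)

/-- Test whether `b` dominates `a`, when `N(b)` is stamped. -/
def domTest : Cmd :=
  forNbr 21 22 20 23
    (.ifNonzero (.differ (.cell 13 (.reg 23)) (succReg 13)) failCmd .skip)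

/-- Check the pair `a, b`. -/
def checkCmd : Cmd :=
  .ifNonzero (.cell 2 (.reg 20))
    (.ifNonzero (.differ (.cell 2 (.reg 20)) (succReg 13)) failCmd .skip)
    (.seq (.setCell 2 (.reg 20) (succReg 13)) domTest)

def treatCmd : Cmd :=
  .seq (.ifNonzero (.cell 11 (.reg 16))
    (.seq (.setReg 20 (.minus (.cell 11 (.reg 16)) (.lit 1))) checkCmd) .skip) <|
  .seq (.setCell 11 (.reg 16) (succReg 13)) (.setCell 12 (.reg 13) (.lit 1))

/-- Set register `24` to a nonzero value if the triple `(v, w)` is to be checked. -/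
def selectCmd : Cmd :=
  .seq (.setReg 24 (.differ (.cell 10 (.reg 16)) (.cell 9 (.reg 16)))) <|
  .ifNonzero (.cell 12 (.reg 16))
    (.ifNonzero (.cell 2 (.reg 16))
      (.ifNonzero (.minus (.cell 2 (.reg 16)) (succReg 10)) (.setReg 24 (.lit 1)) .skip)
      (.setReg 24 (.lit 1)))
    .skip

def checkPass : Cmd :=
  forNN stampNbrs <| .ifNonzero (.minus (.reg 10) (.reg 16))
    (.ifNonzero (.cell 14 (.lit 0)) .skip (.seq selectCmd (.ifNonzero (.reg 24) treatCmd .skip)))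
    .skip

/-- `DLT[w] := DLT[w] - 1` for `w` in `N(v)`. -/
def decreasePass : Cmd :=
  forNbr 11 12 10 13 (.setCell 9 (.reg 13) (.minus (.cell 9 (.reg 13)) (.lit 1)))

/-- Register `25` counts upwards, while the vertex `n - 1 - k` of round `k` descends. -/
def roundCmd : Cmd :=
  .seq (.setReg 10 (.minus (.minus (.reg 0) (.lit 1)) (.reg 25))) <|
  .ifNonzero (.cell 14 (.lit 0)) .skip
    (.seq resetPass (.seq countPass (.seq checkPass decreasePass)))

def initDlt : Cmd :=
  forTo 25 26 (.lit 0) (.reg 0)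
    (.setCell 9 (.reg 25) (.minus (.cell 3 (succReg 25)) (.cell 3 (.reg 25))))

def coreCmd : Cmd := .seq initDlt (forTo 25 26 (.lit 0) (.reg 0) roundCmd)

variable {n : ℕ} {H : SimpleGraph ℕ} {off adj : ℕ → ℕ} {W M : ℕ} {s : Store} {v : ℕ}

theorem Store.setReg_reg (s : Store) (x k y : ℕ) :
    (s.setReg x k).reg y = if y = x then k else s.reg y := by
  simp [Store.setReg, Function.update_apply]

theorem Store.setReg_arr (s : Store) (x k : ℕ) : (s.setReg x k).arr = s.arr := rfl

theorem Store.setCell_reg (s : Store) (A i k : ℕ) : (s.setCell A i k).reg = s.reg := rfl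

theorem Store.setCell_arr (s : Store) (A i k B : ℕ) : (s.setCell A i k).arr B =
    if B = A then Function.update (s.arr A) i k else s.arr B := by
  simp [Store.setCell, Function.update_apply]

/-- Only cells that the double loop of `v` can reach are cleared, so that a round costs `stepsNN`
and not `n`. -/
theorem runs_resetPass (hA : SortedAdj n H off adj) (h3 : s.arr 3 = off) (h4 : s.arr 4 = adj)
    (hv : s.reg 10 = v) (hvn : v < n) :
    Runs W M resetPass s fun t s' => t ≤ 70 * stepsNN off adj v ∧
      ∀ a w, AllPairs H v a w → s'.arr 10 w = 0 ∧ s'.arr 11 w = 0 := by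
  refine (Runs.forNN hA h3 h4 hv hvn
    (fun D arr => ∀ a w, D a w → arr 10 w = 0 ∧ arr 11 w = 0) (fun _ _ => True) (fun _ => 0) 10
    ?_ ?_ (by decide) (by decide) ?_ ?_ ?_).mono ?_
  · intro r _ _
    simp [Cmd.writesReg]
  · intro r _ _
    simp [Cmd.writesReg]
  · simp
  · intro D a s' _ _ _ _ _ hI
    exact Runs.skip ⟨by omega, hI, trivial⟩
  · intro D a w s' _ _ _ _ _ hw hI _
    refine Runs.seq (Runs.setCell (by decide) (by decide) (fun _ _ => Nat.zero_le _)
      (Runs.setCell (by decide) (by decide) (fun _ _ => Nat.zero_le _) ⟨by simp [Exp.cost], ?_,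
        trivial⟩))
    rintro a' w' (hD | ⟨-, rfl⟩)
    · have := hI a' w' hD
      simp [Store.setCell_arr, Exp.val, Function.update_apply, this]
    · simp [Store.setCell_arr, Store.setCell_reg, Exp.val, hw]
  · rintro t s' - - - ⟨ht, hI⟩
    exact ⟨by omega, hI⟩

theorem finite_before (a w : ℕ) : {a' | Before H v a w a' w}.Finite :=
  (Set.finite_Iio v).subset fun _ h => h.2.1

theorem runs_countPass (hA : SortedAdj n H off adj) (h3 : s.arr 3 = off) (h4 : s.arr 4 = adj)
    (hv : s.reg 10 = v) (hvn : v < n) (h0 : ∀ a w, AllPairs H v a w → s.arr 10 w = 0) :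
    Runs W M countPass s fun t s' => t ≤ 70 * stepsNN off adj v ∧
      ∀ a w, AllPairs H v a w → s'.arr 10 w = {a | AllPairs H v a w}.ncard := by
  refine (Runs.forNN hA h3 h4 hv hvn
    (fun D arr => ∀ a w, AllPairs H v a w → arr 10 w = {a | D a w}.ncard) (fun _ _ => True)
    (fun _ => 0) 10 ?_ ?_ (by decide) (by decide) ?_ ?_ ?_).mono ?_
  · intro r _ _
    simp [Cmd.writesReg]
  · intro r _ _
    simp [Cmd.writesReg]
  · intro a w haw
    simpa using h0 a w haw
  · intro D a s' _ _ _ _ _ hI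
    exact Runs.skip ⟨by omega, hI, trivial⟩
  · intro D a w s' haw hD hb hF _ hw hI _
    have hcard : {a' | insertPair D a w a' w}.ncard = {a' | D a' w}.ncard + 1 := by
      have hset : {a' | insertPair D a w a' w} = insert a {a' | D a' w} := by
        ext a'
        simp [insertPair, or_comm]
      subst hD
      rw [hset, Set.ncard_insert_of_notMem _ (finite_before a w)]
      intro hmem
      have := hmem.2.2.2
      omega
    have hle : {a' | insertPair D a w a' w}.ncard ≤ v := by
      have hsub : {a' | insertPair D a w a' w} ⊆ Set.Iio v := by
        rintro a' (h | ⟨rfl, -⟩)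
        · subst hD
          exact h.2.1
        · exact haw.2.1
      calc _ ≤ (Set.Iio v).ncard := Set.ncard_le_ncard hsub (Set.finite_Iio v)
        _ = v := by rw [← Finset.coe_Iio, Set.ncard_coe_finset, Nat.card_Iio]
    have hw0 := hI a w haw
    have h10 : s'.reg 10 = v := by rw [hF.1 10 (by decide), hv]
    refine Runs.setCell (by decide) (by decide) (fun _ _ => ?_) ⟨by simp [Exp.cost], ?_, trivial⟩
    · have := hb.1 10
      simp only [Exp.val, hw, hw0]
      omega
    · intro a' w' haw'
      by_cases hww : w' = w
      · subst hww
        simp [Store.setCell_arr, Exp.val, hw, hw0, hcard]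
      · have : {x | insertPair D a w x w'} = {x | D x w'} := by
          ext x
          simp [insertPair, hww]
        simp [Store.setCell_arr, Exp.val, hw, hww, hI a' w' haw', this]
  · rintro t s' - - - ⟨ht, hI⟩
    exact ⟨by omega, hI⟩

/-- Stamps witness adjacency. -/
def StampInv (H : SimpleGraph ℕ) (stamp : ℕ → ℕ) : Prop := ∀ x b, stamp x = b + 1 → H.Adj b x

/-- Stamps are never erased. A stamp names the vertex that set it, so an old one still witnesses a
true adjacency and cannot be mistaken for another vertex. After the loop, carrying the stamp of `b`
is equivalent to being a neighbor of `b`. -/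
theorem runs_stampNbrs (hA : SortedAdj n H off adj) (h3 : s.arr 3 = off) (h4 : s.arr 4 = adj)
    {b : ℕ} (hb : s.reg 13 = b) (hbn : b < n) (hn : n ≤ s.reg 0) (hst : StampInv H (s.arr 13)) :
    Runs W M stampNbrs s fun t s' => t ≤ 20 * (off (b + 1) - off b + 1) ∧
      StampInv H (s'.arr 13) ∧ ∀ x, H.Adj b x → s'.arr 13 x = b + 1 := by
  refine (Runs.forNbr hA h3 h4 (fun S arr => StampInv H (arr 13) ∧ ∀ x, S x → arr 13 x = b + 1)
    (fun _ => 0) (fun _ => 8) hb hbn (by decide) (by decide) (by decide) (by decide) (by decide)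
    ⟨hst, by simp⟩ ?_).mono ?_
  · rintro w s' hbw hbd hF hw ⟨hI₁, hI₂⟩
    have h13 : s'.reg 13 = b := by rw [hF.1 13 (by decide), hb]
    have h0 : s'.reg 0 = s.reg 0 := hF.1 0 (by decide)
    refine Runs.setCell (by decide) (by decide) (fun _ _ => ?_) ⟨by simp [Exp.cost, succReg], ?_, ?_⟩
    · have := hbd.1 0
      simp only [Exp.val, succReg, h13]
      omega
    · intro x c
      by_cases hx : x = w
      · subst hx
        simp only [Store.setCell_arr, Exp.val, succReg, h13, hw, if_true, Function.update_self,
          Nat.add_right_cancel_iff]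
        rintro rfl
        exact hbw
      · simpa [Store.setCell_arr, Exp.val, succReg, h13, hw, Function.update_apply, hx]
          using hI₁ x c
    · intro x hx
      by_cases hxw : x = w
      · simp [Store.setCell_arr, Exp.val, succReg, h13, hw, hxw]
      · simpa [Store.setCell_arr, Exp.val, succReg, h13, hw, Function.update_apply, hxw]
          using hI₂ x (hx.resolve_right hxw)
  · rintro t s' - - - ⟨ht, hI⟩
    refine ⟨?_, hI⟩
    simp only [Finset.sum_const, Nat.card_Ico, smul_eq_mul] at ht
    omega

/-- The quadruple `v, a, w, b` is recorded. -/
def Failed (v a w b : ℕ) (fl : ℕ → ℕ) : Prop :=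
  fl 0 = 1 ∧ fl 1 = v ∧ fl 2 = a ∧ fl 3 = w ∧ fl 4 = b

variable {a b w : ℕ}

theorem runs_failCmd (h10 : s.reg 10 = v) (h13 : s.reg 13 = b) (h16 : s.reg 16 = w)
    (h20 : s.reg 20 = a) :
    Runs W M failCmd s fun t s' => t ≤ 20 ∧ Failed v a w b (s'.arr 14) := by
  refine Runs.seq (Runs.setCell (by decide) (by decide) (fun h _ => by simpa [Exp.val] using h) ?_)
  refine Runs.seq (Runs.setCell (by decide) (by decide) (fun _ h => h.1 _) ?_)
  refine Runs.seq (Runs.setCell (by decide) (by decide) (fun _ h => h.1 _) ?_)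
  refine Runs.seq (Runs.setCell (by decide) (by decide) (fun _ h => h.1 _) ?_)
  refine Runs.setCell (by decide) (by decide) (fun _ h => h.1 _) ⟨by simp [Exp.cost], ?_⟩
  simp [Failed, Store.setCell_arr, Store.setCell_reg, Exp.val, h10, h13, h16, h20]

theorem Exp.differ_val (e f : Exp) : (Exp.differ e f).val s ≠ 0 ↔ e.val s ≠ f.val s := by
  simp only [differ, val]
  omega

theorem Exp.differ_val_eq (e f : Exp) : (Exp.differ e f).val s = 0 ↔ e.val s = f.val s := by
  simp only [differ, val]
  omega

theorem runs_domTest (hA : SortedAdj n H off adj) (h3 : s.arr 3 = off) (h4 : s.arr 4 = adj)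
    (h10 : s.reg 10 = v) (h13 : s.reg 13 = b) (h16 : s.reg 16 = w) (h20 : s.reg 20 = a)
    (han : a < n) (hst : ∀ x, s.arr 13 x = b + 1 ↔ H.Adj b x) :
    Runs W M domTest s fun t s' => t ≤ 60 * (off (a + 1) - off a) + 20 ∧
      ((Dominates H b a ∧ s'.arr 14 = s.arr 14) ∨
        (¬ Dominates H b a ∧ Failed v a w b (s'.arr 14))) := by
  refine (Runs.forNbr hA h3 h4 (fun S arr => ((∀ y, S y → H.Adj b y) ∧ arr 14 = s.arr 14) ∨
      (¬ Dominates H b a ∧ Failed v a w b (arr 14)))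
    (fun _ => 0) (fun _ => 40) h20 han (by decide) (by decide) (by decide) (by decide) (by decide)
    (.inl ⟨by simp, rfl⟩) ?_).mono ?_
  · intro y s' hay hbd hF hy hI
    have h13' : s'.reg 13 = b := by rw [hF.1 13 (by decide), h13]
    have hst' : s'.arr 13 = s.arr 13 := hF.2 13 (by decide)
    refine Runs.ifNonzero (by decide) (fun hne => ?_) (fun he => ?_)
    · rw [Exp.differ_val] at hne
      simp only [Exp.val, succReg, hy, h13', hst', ne_eq, hst] at hne
      refine (runs_failCmd (v := v) (b := b) (w := w) (a := a) (by rw [hF.1 10 (by decide), h10])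
        h13' (by rw [hF.1 16 (by decide), h16]) (by rw [hF.1 20 (by decide), h20])).mono ?_
      rintro t s'' - - - ⟨ht, hfail⟩
      refine ⟨?_, .inr ⟨fun hd => hne (hd.adj hay), hfail⟩⟩
      simp only [Exp.cost, Exp.differ, succReg]
      omega
    · rw [Exp.differ_val_eq] at he
      simp only [Exp.val, succReg, hy, h13', hst', hst] at he
      refine Runs.skip ⟨by simp [Exp.cost, Exp.differ, succReg], ?_⟩
      refine hI.imp_left fun h => ⟨?_, h.2⟩
      rintro z (hz | rfl)
      · exact h.1 z hz
      · exact he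
  · rintro t s' - - - ⟨ht, hI⟩
    simp only [Finset.sum_const, Nat.card_Ico, smul_eq_mul] at ht
    refine ⟨by omega, hI.imp_left fun h => ⟨fun y hy => h.1 y hy, h.2⟩⟩

/-- The potential: the time for the tests of dominance that are still to come. -/
def potential (n : ℕ) (off : ℕ → ℕ) (arr : ℕ → ℕ → ℕ) : ℕ :=
  ∑ a ∈ Finset.range n, if arr 2 a = 0 then 60 * (off (a + 1) - off a) else 0

theorem potential_congr {arr arr' : ℕ → ℕ → ℕ} (h : arr 2 = arr' 2) :
    potential n off arr = potential n off arr' := by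
  simp only [potential, h]

/-- Giving `a` its first out-edge removes the term of `a`, and this term pays for scanning `N(a)` in
the test of dominance. -/
theorem potential_update {arr arr' : ℕ → ℕ → ℕ} (han : a < n) (h0 : arr 2 a = 0)
    (h : arr' 2 = Function.update (arr 2) a (b + 1)) :
    60 * (off (a + 1) - off a) + potential n off arr' = potential n off arr := by
  have hmem : a ∈ Finset.range n := Finset.mem_range.2 han
  rw [potential, potential, ← Finset.add_sum_erase _ _ hmem, ← Finset.add_sum_erase _ _ hmem]
  rw [if_pos h0, h, Function.update_self, if_neg (by omega), zero_add]
  congr 1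
  refine Finset.sum_congr rfl fun x hx => ?_
  rw [Function.update_of_ne (Finset.ne_of_mem_erase hx)]

variable {D : ℕ → ℕ → Prop}

theorem runs_checkCmd (hA : SortedAdj n H off adj) (h3 : s.arr 3 = off) (h4 : s.arr 4 = adj)
    (h10 : s.reg 10 = v) (h13 : s.reg 13 = b) (h16 : s.reg 16 = w) (h20 : s.reg 20 = a)
    (hn : n ≤ s.reg 0) (hst : ∀ x, s.arr 13 x = b + 1 ↔ H.Adj b x) (hf : s.arr 14 0 = 0)
    (hD : D = Before H v b w) (hb : AllPairs H v b w) (hc : Checked H v w)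
    (hP : PassInv H v D (s.arr 2) (s.arr 12) (s.arr 11) (s.arr 14))
    (ha : s.arr 11 w = a + 1) :
    Runs W M checkCmd s fun t s' => t + potential n off s'.arr ≤ 60 + potential n off s.arr ∧
      PassInv H v (insertPair D b w) (s'.arr 2) (Function.update (s.arr 12) b 1)
        (Function.update (s.arr 11) w (b + 1)) (s'.arr 14) := by
  have hab := hP.isNext hf hD hb hc ha
  have han : a < n := hA.lt a v hab.1.1.symm
  have hbn : b < n := hA.lt b v hb.1.symm
  refine Runs.ifNonzero (by decide) (fun hne => ?_) (fun he => ?_)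
  · simp only [Exp.val, h20] at hne
    refine Runs.ifNonzero (by decide) (fun hne' => ?_) (fun he' => ?_)
    · rw [Exp.differ_val] at hne'
      simp only [Exp.val, succReg, h20, h13] at hne'
      have hbad := hP.bad_of_ne hf hD hb hc ha hne hne'
      refine (runs_failCmd h10 h13 h16 h20).mono ?_
      rintro t s' - - hF ⟨ht, hfl⟩
      refine ⟨?_, PassInv.of_bad hbad hfl.1 hfl.2.1 hfl.2.2.1 hfl.2.2.2.1 hfl.2.2.2.2 _ _ _ _⟩
      rw [potential_congr (hF.2 2 (by decide))]
      simp only [Exp.cost, Exp.differ, succReg]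
      omega
    · rw [Exp.differ_val_eq] at he'
      simp only [Exp.val, succReg, h20, h13] at he'
      refine Runs.skip ⟨?_, hP.again hD hb hc ha he'⟩
      simp only [Exp.cost, Exp.differ, succReg]
      omega
  · simp only [Exp.val, h20] at he
    -- The edge is written before the test. If the test fails, the flag is set and the invariant no
    -- longer says anything about `next`.
    refine Runs.seq (Runs.setCell (by decide) (by decide) (fun _ h => ?_) ?_)
    · have := h.1 0
      simp only [Exp.val, succReg, h13]
      omega
    · simp only [Exp.val, succReg, h13, h20]
      refine (runs_domTest (s := s.setCell 2 a (b + 1)) (v := v) (b := b) (w := w) hA (by simpa [Store.setCell_arr] using h3)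
        (by simpa [Store.setCell_arr] using h4) h10 h13 h16 h20 han
        (by simpa [Store.setCell_arr] using hst)).mono ?_
      rintro t s' - - hF ⟨ht, hor⟩
      have h2 : s'.arr 2 = Function.update (s.arr 2) a (b + 1) := by
        rw [hF.2 2 (by decide)]
        simp [Store.setCell_arr]
      refine ⟨?_, ?_⟩
      · have := potential_update (off := off) han he h2
        simp only [Exp.cost]
        omega
      · rw [h2]
        rcases hor with ⟨hd, h14⟩ | ⟨hd, hfl⟩
        · rw [h14]
          simpa [Store.setCell_arr] using hP.new hD hb hc ha he hd
        · exact PassInv.of_bad ⟨hc.isUnsafe, hab, hd⟩ hfl.1 hfl.2.1 hfl.2.2.1 hfl.2.2.2.1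
            hfl.2.2.2.2 _ _ _ _

theorem runs_treatCmd (hA : SortedAdj n H off adj) (h3 : s.arr 3 = off) (h4 : s.arr 4 = adj)
    (h10 : s.reg 10 = v) (h13 : s.reg 13 = b) (h16 : s.reg 16 = w)
    (hn : n ≤ s.reg 0) (hst : ∀ x, s.arr 13 x = b + 1 ↔ H.Adj b x) (hf : s.arr 14 0 = 0)
    (hD : D = Before H v b w) (hb : AllPairs H v b w) (hc : Checked H v w)
    (hP : PassInv H v D (s.arr 2) (s.arr 12) (s.arr 11) (s.arr 14)) :
    Runs W M treatCmd s fun t s' => t + potential n off s'.arr ≤ 100 + potential n off s.arr ∧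
      PassInv H v (insertPair D b w) (s'.arr 2) (s'.arr 12) (s'.arr 11) (s'.arr 14) := by
  have hbn : b < n := hA.lt b v hb.1.symm
  refine Runs.seq (Runs.mono (Q := fun t s' =>
    t + potential n off s'.arr ≤ 80 + potential n off s.arr ∧
      PassInv H v (insertPair D b w) (s'.arr 2) (Function.update (s.arr 12) b 1)
        (Function.update (s.arr 11) w (b + 1)) (s'.arr 14)) ?_ ?_)
  · refine Runs.ifNonzero (by decide) (fun hne => ?_) (fun he => ?_)
    · simp only [Exp.val, h16] at hne
      obtain ⟨a, ha⟩ := Nat.exists_eq_add_one_of_ne_zero hne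
      refine Runs.seq (Runs.setReg (by decide) (fun _ h => ?_) ?_)
      · exact (Nat.sub_le _ _).trans (h.2 11 _)
      · simp only [Exp.val, h16, ha, Nat.add_sub_cancel]
        refine (runs_checkCmd (s := s.setReg 20 a) hA h3 h4 h10 h13 h16
          (by simp [Store.setReg_reg]) hn hst hf hD hb hc hP ha).mono ?_
        rintro t s' - - hF ⟨ht, hP'⟩
        refine ⟨?_, hP'⟩
        have : (s.setReg 20 a).arr = s.arr := rfl
        rw [this] at ht
        simp only [Exp.cost]
        omega
    · simp only [Exp.val, h16] at he
      refine Runs.skip ⟨?_, hP.first hD hc he⟩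
      simp only [Exp.cost]
      omega
  · rintro t s' - - hF ⟨ht, hP'⟩
    have h13' : s'.reg 13 = b := by rw [hF.1 13 (by decide), h13]
    have h16' : s'.reg 16 = w := by rw [hF.1 16 (by decide), h16]
    have h0' : s'.reg 0 = s.reg 0 := hF.1 0 (by decide)
    have h12 : s'.arr 12 = s.arr 12 := hF.2 12 (by decide)
    have h11 : s'.arr 11 = s.arr 11 := hF.2 11 (by decide)
    refine Runs.seq (Runs.setCell (by decide) (by decide) (fun _ h => ?_) ?_)
    · have := h.1 0
      simp only [Exp.val, succReg, h13']
      omega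
    · refine Runs.setCell (by decide) (by decide) (fun h _ => h) ⟨?_, ?_⟩
      · rw [potential_congr (arr' := s'.arr) (by simp [Store.setCell_arr])]
        simp only [Exp.cost, succReg]
        omega
      · simpa [Store.setCell_arr, Store.setCell_reg, Exp.val, succReg, h13', h16', h11, h12]
          using hP'

theorem runs_selectCmd (h10 : s.reg 10 = v) (h16 : s.reg 16 = w) :
    Runs W M selectCmd s fun t s' => t ≤ 30 ∧ (s'.reg 24 ≠ 0 ↔ s.arr 10 w ≠ s.arr 9 w ∨
      (s.arr 12 w ≠ 0 ∧ (s.arr 2 w = 0 ∨ v + 1 < s.arr 2 w))) := by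
  have hdiff : (Exp.differ (.cell 10 (.reg 16)) (.cell 9 (.reg 16))).val s ≠ 0 ↔
      s.arr 10 w ≠ s.arr 9 w := by
    rw [Exp.differ_val]
    simp only [Exp.val, h16]
  refine Runs.seq (Runs.setReg (by decide) (fun _ h => ?_) ?_)
  · have h1 := h.2 10 w
    have h2 := h.2 9 w
    simp only [Exp.differ, Exp.val, h16]
    omega
  generalize (Exp.differ (.cell 10 (.reg 16)) (.cell 9 (.reg 16))).val s = k at hdiff
  refine Runs.ifNonzero (by decide) (fun h12 => ?_) (fun h12 => ?_)
  · refine Runs.ifNonzero (by decide) (fun h2 => ?_) (fun h2 => ?_)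
    · refine Runs.ifNonzero (by decide) (fun hlt => ?_) (fun hlt => ?_)
      · refine Runs.setReg (by decide) (fun h _ => h) ⟨by simp [Exp.cost, Exp.differ, succReg], ?_⟩
        simp only [Exp.val, succReg, Store.setReg_reg, Store.setReg_arr] at h12 h2 hlt ⊢
        simp only [h10, h16, Nat.reduceEqDiff, if_false] at h12 h2 hlt
        simp only [if_true, ne_eq, one_ne_zero, not_false_iff, true_iff]
        exact .inr ⟨h12, .inr (by omega)⟩
      · refine Runs.skip ⟨by simp [Exp.cost, Exp.differ, succReg], ?_⟩
        simp only [Exp.val, succReg, Store.setReg_reg, Store.setReg_arr] at h12 h2 hlt ⊢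
        simp only [h10, h16, Nat.reduceEqDiff, if_false] at h12 h2 hlt
        simp only [if_true, hdiff]
        refine (or_iff_left ?_).symm
        rintro ⟨-, h | h⟩ <;> omega
    · refine Runs.setReg (by decide) (fun h _ => h) ⟨by simp [Exp.cost, Exp.differ], ?_⟩
      simp only [Exp.val, Store.setReg_reg, Store.setReg_arr] at h12 h2 ⊢
      simp only [h16, Nat.reduceEqDiff, if_false] at h12 h2
      simp only [if_true, ne_eq, one_ne_zero, not_false_iff, true_iff]
      exact .inr ⟨h12, .inl h2⟩
  · refine Runs.skip ⟨by simp [Exp.cost, Exp.differ], ?_⟩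
    simp only [Exp.val, Store.setReg_reg, Store.setReg_arr] at h12 ⊢
    simp only [h16, Nat.reduceEqDiff, if_false] at h12
    simp only [if_true, hdiff]
    refine (or_iff_left ?_).symm
    rintro ⟨h, -⟩
    exact h h12

end CoreProgram

/-! ### The main loop over all high vertices -/

section CoreRuns

variable {n : ℕ} {H : SimpleGraph ℕ} {off adj : ℕ → ℕ} {W M : ℕ} {s : Store} {v : ℕ}

/-- The sizes of the sets `L(v, w)` are needed before their first elements are treated, so they come
from an earlier pass. The flag is read in every inner round; after a failure nothing is checked any
more, and the recorded quadruple survives. -/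
theorem runs_checkPass (hH : H.CliqueFree 3) (hA : SortedAdj n H off adj) (h3 : s.arr 3 = off)
    (h4 : s.arr 4 = adj) (hv : s.reg 10 = v) (hvn : v < n) (hn : n ≤ s.reg 0)
    (hst : StampInv H (s.arr 13))
    (hcnt : ∀ a w, AllPairs H v a w → s.arr 10 w = {a | AllPairs H v a w}.ncard)
    (hdlt : ∀ w < v, s.arr 9 w = {a | H.Adj w a ∧ a < v + 1}.ncard)
    (hP : PassInv H v (fun _ _ => False) (s.arr 2) (s.arr 12) (s.arr 11) (s.arr 14)) :
    Runs W M checkPass s fun t s' =>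
      t + potential n off s'.arr ≤ 450 * stepsNN off adj v + potential n off s.arr ∧
      PassInv H v (AllPairs H v) (s'.arr 2) (s'.arr 12) (s'.arr 11) (s'.arr 14) ∧
      StampInv H (s'.arr 13) := by
  refine (Runs.forNN hA h3 h4 hv hvn
    (fun D arr => PassInv H v D (arr 2) (arr 12) (arr 11) (arr 14) ∧ StampInv H (arr 13))
    (fun b arr => ∀ x, H.Adj b x → arr 13 x = b + 1) (potential n off) 200
    ?_ ?_ (by decide) (by decide) ⟨hP, hst⟩ ?_ ?_).mono ?_
  · intro r h1 h2
    interval_cases r <;> decide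
  · intro r h1 h2
    interval_cases r <;> decide
  · rintro D b s' hvb hbv hbd hF hb ⟨hP', hst'⟩
    refine (runs_stampNbrs hA (by rw [hF.2 3 (by decide), h3]) (by rw [hF.2 4 (by decide), h4]) hb
      (hbv.trans hvn) (by rw [hF.1 0 (by decide)]; exact hn) hst').mono ?_
    rintro t s'' - - hF' ⟨ht, hst'', hJ⟩
    rw [potential_congr (hF'.2 2 (by decide)), hF'.2 2 (by decide), hF'.2 12 (by decide),
      hF'.2 11 (by decide), hF'.2 14 (by decide)]
    refine ⟨?_, ⟨hP', hst''⟩, hJ⟩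
    omega
  · rintro D b w s' hbw hD hbd hF hb hw ⟨hP', hst'⟩ hJ
    have h10 : s'.reg 10 = v := by rw [hF.1 10 (by decide), hv]
    refine Runs.ifNonzero (by decide) (fun hne => ?_) (fun he => ?_)
    · have hwv : w < v := by
        simp only [Exp.val, h10, hw] at hne
        omega
      refine Runs.ifNonzero (by decide) (fun hfl => ?_) (fun hfl => ?_)
      · simp only [Exp.val] at hfl
        refine Runs.skip ⟨?_, ⟨hP'.of_flag hfl _ _ _ _, hst'⟩, hJ⟩
        simp only [Exp.cost]
        omega
      · simp only [Exp.val] at hfl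
        refine Runs.seq ((runs_selectCmd h10 hw).mono ?_)
        rintro t₁ s₁ - - hF₁ ⟨ht₁, hsel⟩
        have harr : s₁.arr = s'.arr := by
          ext A : 1
          refine hF₁.2 A ?_
          simp [selectCmd, Cmd.writesArr]
        have hchk := hP'.checked_iff hH hfl hD hbw hwv (hcnt b w hbw) (hdlt w hwv)
        rw [hF.2 10 (by decide), hF.2 9 (by decide), ← hchk] at hsel
        refine Runs.ifNonzero (by decide) (fun h24 => ?_) (fun h24 => ?_)
        · have hc := hsel.1 h24
          refine (runs_treatCmd (s := s₁) (D := D) (v := v) (b := b) (w := w) hA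
            (by rw [harr, hF.2 3 (by decide), h3]) (by rw [harr, hF.2 4 (by decide), h4])
            (by rw [hF₁.1 10 (by decide), h10]) (by rw [hF₁.1 13 (by decide), hb])
            (by rw [hF₁.1 16 (by decide), hw])
            (by rw [hF₁.1 0 (by decide), hF.1 0 (by decide)]; exact hn)
            (fun x => by rw [harr]; exact ⟨hst' x b, hJ x⟩) (by rw [harr]; exact hfl) hD hbw hc
            (by rw [harr]; exact hP')).mono ?_
          rintro t s'' - - hF₂ ⟨ht, hP''⟩
          rw [harr] at ht
          rw [hF₂.2 13 (by decide), harr]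
          refine ⟨?_, ⟨hP'', hst'⟩, hJ⟩
          simp only [Exp.cost]
          omega
        · have hc : ¬ Checked H v w := fun hc => hsel.2 hc h24
          refine Runs.skip ?_
          rw [harr]
          refine ⟨?_, ⟨hP'.of_not_checked hc, hst'⟩, hJ⟩
          simp only [Exp.cost]
          omega
    · have hwv : ¬ w < v := by
        simp only [Exp.val, h10, hw] at he
        omega
      refine Runs.skip ⟨?_, ⟨hP'.of_not_checked fun hc => hwv hc.1.1, hst'⟩, hJ⟩
      simp only [Exp.cost]
      omega
  · rintro t s' - - - ⟨ht, hI, hst'⟩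
    exact ⟨by omega, hI, hst'⟩

theorem runs_decreasePass (hA : SortedAdj n H off adj) (h3 : s.arr 3 = off) (h4 : s.arr 4 = adj)
    (hv : s.reg 10 = v) (hvn : v < n) :
    Runs W M decreasePass s fun t s' => t ≤ 30 * stepsNN off adj v ∧
      (∀ w, H.Adj v w → s'.arr 9 w = s.arr 9 w - 1) ∧
      ∀ w, ¬ H.Adj v w → s'.arr 9 w = s.arr 9 w := by
  refine (Runs.forNbr hA h3 h4 (fun S arr => (∀ w, S w → arr 9 w = s.arr 9 w - 1) ∧
    ∀ w, ¬ S w → arr 9 w = s.arr 9 w) (fun _ => 0) (fun _ => 8) hv hvn (by decide) (by decide)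
    (by decide) (by decide) (by decide) ⟨by simp, by simp⟩ ?_).mono ?_
  · rintro w s' _ _ _ hw ⟨hI₁, hI₂⟩
    refine Runs.setCell (by decide) (by decide) (fun _ h => ?_) ⟨by simp [Exp.cost], ?_, ?_⟩
    · exact (Nat.sub_le _ _).trans (h.2 9 _)
    · intro x hx
      by_cases hxw : x = w
      · subst hxw
        simp [Store.setCell_arr, Exp.val, hw, hI₂ x (fun h => lt_irrefl _ h.2)]
      · simpa [Store.setCell_arr, Exp.val, hw, hxw] using hI₁ x (hx.resolve_right hxw)
    · intro x hx
      push Not at hx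
      simpa [Store.setCell_arr, Exp.val, hw, hx.2] using hI₂ x (fun h => absurd h.2 (by
        have := hx.1 h.1
        omega))
  · rintro t s' - - - ⟨ht, hI⟩
    refine ⟨?_, hI⟩
    simp only [Finset.sum_const, Nat.card_Ico, smul_eq_mul] at ht
    have : off (v + 1) - off v ≤ ∑ k ∈ Finset.Ico (off v) (off (v + 1)),
        (1 + if adj k < v then off (adj k + 1) - off (adj k) else 0) := by
      rw [Finset.sum_add_distrib]
      simp
    rw [stepsNN]
    omega

theorem ncard_adj_lt_succ (w : ℕ) : (H.Adj v w → {a | H.Adj w a ∧ a < v}.ncard =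
      {a | H.Adj w a ∧ a < v + 1}.ncard - 1) ∧
    (¬ H.Adj v w → {a | H.Adj w a ∧ a < v}.ncard = {a | H.Adj w a ∧ a < v + 1}.ncard) := by
  have hset : {a | H.Adj w a ∧ a < v} = {a | H.Adj w a ∧ a < v + 1} \ {v} := by
    ext a
    simp only [Set.mem_ofPred_eq, Set.mem_sdiff, Set.mem_singleton_iff, and_assoc]
    refine and_congr_right fun _ => ?_
    omega
  rw [hset]
  refine ⟨fun h => Set.ncard_sdiff_singleton_of_mem ⟨h.symm, Nat.lt_succ_self v⟩, fun h => ?_⟩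
  rw [Set.sdiff_singleton_eq_self]
  exact fun hv => h hv.1.symm

theorem CoreInv.of_flag {k l : ℕ} {next mark dlt fl : ℕ → ℕ} (h : CoreInv H k next mark dlt fl)
    (hf : fl 0 ≠ 0) : CoreInv H l next mark dlt fl :=
  ⟨h.flag, fun h => absurd h hf, fun h => absurd h hf, fun h => absurd h hf,
    fun h => absurd h hf⟩

theorem runs_roundCmd (hH : H.CliqueFree 3) (hA : SortedAdj n H off adj) (h3 : s.arr 3 = off)
    (h4 : s.arr 4 = adj) (hn : s.reg 0 = n) (hv : n - 1 - s.reg 25 = v) (hvn : v < n)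
    (hst : StampInv H (s.arr 13))
    (hC : CoreInv H (v + 1) (s.arr 2) (s.arr 12) (s.arr 9) (s.arr 14)) :
    Runs W M roundCmd s fun t s' =>
      t + potential n off s'.arr ≤ 650 * stepsNN off adj v + potential n off s.arr ∧
      CoreInv H v (s'.arr 2) (s'.arr 12) (s'.arr 9) (s'.arr 14) ∧ StampInv H (s'.arr 13) := by
  have hpos : 1 ≤ stepsNN off adj v := by
    rw [stepsNN]
    omega
  refine Runs.seq (Runs.setReg (by decide) (fun _ h => ?_) ?_)
  · have := h.1 0
    simp only [Exp.val, hn]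
    omega
  simp only [Exp.val, hn, hv]
  have h10 : (s.setReg 10 v).reg 10 = v := by simp [Store.setReg_reg]
  have h0 : n ≤ (s.setReg 10 v).reg 0 := by simp [Store.setReg_reg, hn]
  have harr : (s.setReg 10 v).arr = s.arr := rfl
  generalize s.setReg 10 v = s₀ at h10 h0 harr
  refine Runs.ifNonzero (by decide) (fun hfl => ?_) (fun hfl => ?_)
  · simp only [Exp.val] at hfl
    refine Runs.skip ?_
    rw [harr] at hfl ⊢
    refine ⟨?_, hC.of_flag hfl, hst⟩
    simp only [Exp.cost]
    omega
  · simp only [Exp.val, harr] at hfl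
    refine Runs.seq ((runs_resetPass hA (by rw [harr, h3]) (by rw [harr, h4]) h10 hvn).mono ?_)
    rintro t₁ s₁ - - hF₁ ⟨ht₁, hz⟩
    refine Runs.seq ((runs_countPass hA (by rw [hF₁.2 3 (by decide), harr, h3])
      (by rw [hF₁.2 4 (by decide), harr, h4]) (by rw [hF₁.1 10 (by decide), h10]) hvn
      fun a w haw => (hz a w haw).1).mono ?_)
    rintro t₂ s₂ - - hF₂ ⟨ht₂, hcnt⟩
    have hback : ∀ A, A ≠ 10 → A ≠ 11 → s₂.arr A = s.arr A := by
      intro A h1 h2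
      rw [hF₂.2 A, hF₁.2 A, harr] <;>
        simp [resetPass, countPass, forNN, forNbr, forTo, Cmd.writesArr, h1.symm, h2.symm]
    have h11 : s₂.arr 11 = s₁.arr 11 := hF₂.2 11 (by decide)
    have h2 := hback 2 (by decide) (by decide)
    have h10₂ : s₂.reg 10 = v := by rw [hF₂.1 10 (by decide), hF₁.1 10 (by decide), h10]
    have hfl₂ : s₂.arr 14 0 = 0 := by rw [hback 14 (by decide) (by decide), hfl]
    have hC₂ : CoreInv H (v + 1) (s₂.arr 2) (s₂.arr 12) (s₂.arr 9) (s₂.arr 14) := by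
      rwa [h2, hback 12 (by decide) (by decide), hback 9 (by decide) (by decide),
        hback 14 (by decide) (by decide)]
    refine Runs.seq ((runs_checkPass hH hA (by rw [hback 3 (by decide) (by decide), h3])
      (by rw [hback 4 (by decide) (by decide), h4]) h10₂ hvn
      (by rw [hF₂.1 0 (by decide), hF₁.1 0 (by decide)]; exact h0)
      (by rw [hback 13 (by decide) (by decide)]; exact hst) hcnt
      (fun w hw => hC₂.dlt_eq hfl₂ w (hw.trans (Nat.lt_succ_self v)))
      (hC₂.passInv hfl₂ fun a w haw => by rw [h11]; exact (hz a w haw).2)).mono ?_)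
    rintro t₃ s₃ - - hF₃ ⟨ht₃, hP₃, hst₃⟩
    refine (runs_decreasePass hA (by rw [hF₃.2 3 (by decide), hback 3 (by decide) (by decide), h3])
      (by rw [hF₃.2 4 (by decide), hback 4 (by decide) (by decide), h4])
      (by rw [hF₃.1 10 (by decide), h10₂]) hvn).mono ?_
    rintro t₄ s₄ - - hF₄ ⟨ht₄, hd₁, hd₂⟩
    have hgood := hC₂.good hfl₂
    rw [Ici_succ_nat] at hgood
    have h9 : s₃.arr 9 = s₂.arr 9 := hF₃.2 9 (by decide)
    refine ⟨?_, ?_, ?_⟩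
    · rw [potential_congr (hF₄.2 2 (by decide))]
      rw [potential_congr h2] at ht₃
      simp only [Exp.cost]
      omega
    · refine PassInv.coreInv (last := s₃.arr 11) hH ?_ hgood fun w hw => ?_
      · rwa [hF₄.2 2 (by decide), hF₄.2 12 (by decide), hF₄.2 14 (by decide)]
      · have hold := hC₂.dlt_eq hfl₂ w (hw.trans (Nat.lt_succ_self v))
        by_cases hvw : H.Adj v w
        · rw [hd₁ w hvw, h9, hold, (ncard_adj_lt_succ w).1 hvw]
        · rw [hd₂ w hvw, h9, hold, (ncard_adj_lt_succ w).2 hvw]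
    · rwa [hF₄.2 13 (by decide)]

theorem ncard_eq_of_injOn {S : Set ℕ} {f : ℕ → ℕ} {lo hi : ℕ}
    (hS : ∀ x, x ∈ S ↔ ∃ k, lo ≤ k ∧ k < hi ∧ f k = x) (hf : Set.InjOn f (Set.Ico lo hi)) :
    S.ncard = hi - lo := by
  have hset : S = f '' Set.Ico lo hi := by
    ext x
    simp only [hS, Set.mem_image, Set.mem_Ico, and_assoc]
  rw [hset, Set.InjOn.ncard_image hf, ← Finset.coe_Ico, Set.ncard_coe_finset, Nat.card_Ico]

theorem injOn_Ico_of_strict {f : ℕ → ℕ} {lo hi : ℕ}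
    (hf : ∀ k l, lo ≤ k → k < l → l < hi → f k < f l) : Set.InjOn f (Set.Ico lo hi) := by
  intro k hk l hl he
  rcases lt_trichotomy k l with h | h | h
  · exact absurd he (hf k l hk.1 h hl.2).ne
  · exact h
  · exact absurd he (hf l k hl.1 h hk.2).ne'

theorem SortedAdj.ncard_adj (hA : SortedAdj n H off adj) {u : ℕ} (hu : u < n) :
    {x | H.Adj u x}.ncard = off (u + 1) - off u :=
  ncard_eq_of_injOn (hA.mem u hu) (injOn_Ico_of_strict (hA.strict u hu))

theorem runs_initDlt (hA : SortedAdj n H off adj) (h3 : s.arr 3 = off) (hn : s.reg 0 = n) :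
    Runs W M initDlt s fun t s' => t ≤ 20 * n + 10 ∧
      ∀ w < n, s'.arr 9 w = {x | H.Adj w x}.ncard := by
  refine (Runs.forTo (lo := 0) (hi := n) (fun k arr => ∀ w < k, arr 9 w = {x | H.Adj w x}.ncard)
    (fun _ => 0) (fun _ => 12) (by decide) (by decide) (by decide) (by decide) (by decide) ?_ ?_
    (Nat.zero_le n) (fun _ h => hn ▸ h.1 0) (by simp) ?_).mono ?_
  · rfl
  · exact hn
  · intro k s' _ hk _ _ hF hk' _ hI
    refine Runs.setCell (by decide) (by decide) (fun _ h => ?_)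
      ⟨by simp [Exp.cost, succReg], ?_⟩
    · exact (Nat.sub_le _ _).trans (h.2 3 _)
    · intro w hw
      by_cases hwk : w = k
      · subst hwk
        simp [Store.setCell_arr, Exp.val, succReg, hk', hF.2 3 (by decide), h3, hA.ncard_adj hk]
      · simpa [Store.setCell_arr, Exp.val, hk', hwk] using hI w (by omega)
  · rintro t s' - - - ⟨ht, hI⟩
    refine ⟨?_, hI⟩
    simp only [Exp.cost, Finset.sum_const, Nat.card_Ico, smul_eq_mul] at ht
    omega

theorem runs_coreCmd (hH : H.CliqueFree 3) (hA : SortedAdj n H off adj) (h3 : s.arr 3 = off)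
    (h4 : s.arr 4 = adj) (hn : s.reg 0 = n) (h2 : ∀ i, s.arr 2 i = 0) (h12 : ∀ i, s.arr 12 i = 0)
    (h14 : s.arr 14 0 = 0) (hst : StampInv H (s.arr 13)) :
    Runs W M coreCmd s fun t s' =>
      t ≤ 1000 * (1 + ∑ v ∈ Finset.range n, stepsNN off adj v) ∧
      CoreInv H 0 (s'.arr 2) (s'.arr 12) (s'.arr 9) (s'.arr 14) := by
  refine Runs.seq ((runs_initDlt hA h3 hn).mono ?_)
  rintro t₁ s₁ - - hF₁ ⟨ht₁, hd⟩
  -- Labels from `n` on are isolated, so the initial invariant is vacuous about triples.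
  have hnoT : ∀ v ∈ Set.Ici n, ∀ w, ¬ Unsafe H v w := by
    rintro v hv w ⟨⟨-, a, ha⟩, -⟩
    exact absurd (hA.lt v a ha.1) (not_lt.2 hv)
  have hC : CoreInv H (n - 0) (s₁.arr 2) (s₁.arr 12) (s₁.arr 9) (s₁.arr 14) := by
    rw [hF₁.2 2 (by decide), hF₁.2 12 (by decide), hF₁.2 14 (by decide), Nat.sub_zero]
    refine ⟨.inl h14, fun _ a b => ?_, fun _ a => ?_, fun _ v hv w a b hb => hnoT v hv w hb.1,
      fun _ w hw => ?_⟩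
    · rw [h2]
      refine iff_of_false (by omega) ?_
      rintro ⟨v, hv, w, hu, -⟩
      exact hnoT v hv w hu
    · rw [h12]
      refine iff_of_false (by omega) ?_
      rintro ⟨v, hv, w, hu, -⟩
      exact hnoT v hv w hu
    · rw [hd w hw]
      congr 1
      ext x
      exact ⟨fun h => ⟨h, hA.lt x w h.symm⟩, fun h => h.1⟩
  have hn₁ : s₁.reg 0 = n := by rw [hF₁.1 0 (by decide), hn]
  refine (Runs.forTo (lo := 0) (hi := n)
    (fun k arr => CoreInv H (n - k) (arr 2) (arr 12) (arr 9) (arr 14) ∧ StampInv H (arr 13))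
    (potential n off) (fun k => 650 * stepsNN off adj (n - 1 - k)) (by decide) (by decide)
    (by decide) (by decide) (by decide) ?_ ?_ (Nat.zero_le n) (fun _ h => hn₁ ▸ h.1 0)
    ⟨hC, by rwa [hF₁.2 13 (by decide)]⟩ ?_).mono ?_
  · rfl
  · exact hn₁
  · rintro k s' - hk - - hF hk' - ⟨hI, hst'⟩
    have e : n - 1 - k + 1 = n - k := by omega
    refine (runs_roundCmd hH hA (v := n - 1 - k)
      (by rw [hF.2 3 (by decide), hF₁.2 3 (by decide), h3])
      (by rw [hF.2 4 (by decide), hF₁.2 4 (by decide), h4])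
      (by rw [hF.1 0 (by decide), hn₁]) (by rw [hk']) (by omega) hst' (by rwa [e])).mono ?_
    rintro t s'' - - - ⟨ht, hI', hst''⟩
    refine ⟨ht, ?_, hst''⟩
    rwa [show n - (k + 1) = n - 1 - k by omega]
  · rintro t s' - - - ⟨ht, hI, -⟩
    refine ⟨?_, by simpa using hI⟩
    -- The initial potential is linear in the sum of the degrees and prepays all tests of dominance.
    have hΦ : potential n off s₁.arr ≤ ∑ v ∈ Finset.range n, 60 * stepsNN off adj v := by
      refine Finset.sum_le_sum fun v _ => ?_
      have : off (v + 1) - off v ≤ stepsNN off adj v := by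
        rw [stepsNN, Finset.sum_add_distrib]
        simp only [Finset.sum_const, Nat.card_Ico, smul_eq_mul, mul_one]
        omega
      split_ifs <;> omega
    rw [← Finset.mul_sum] at hΦ
    rw [Nat.Ico_zero_eq_range, Finset.sum_add_distrib, ← Finset.mul_sum,
      Finset.sum_range_reflect (stepsNN off adj) n] at ht
    simp only [Finset.sum_const, Finset.card_range, smul_eq_mul, Exp.cost] at ht
    have hn' : n ≤ ∑ v ∈ Finset.range n, stepsNN off adj v := by
      have := Finset.card_nsmul_le_sum (Finset.range n) (stepsNN off adj) 1 fun v _ => by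
        rw [stepsNN]
        omega
      simpa using this
    omega

end CoreRuns

/-! ### Stable counting sort of the vertices by degree -/

section DegreeSort

variable {n : ℕ} {off : ℕ → ℕ} {W M : ℕ} {s : Store}

/-- The length of the list of `u`. -/
def listLength (off : ℕ → ℕ) (u : ℕ) : ℕ := off (u + 1) - off u

/-- The rank of `u` in the stable sorting of `0, …, n - 1` by the key `d`. -/
def keyRank (n : ℕ) (d : ℕ → ℕ) (u : ℕ) : ℕ :=
  ((Finset.range n).filter fun x => d x < d u ∨ (d x = d u ∧ x < u)).card

theorem keyRank_lt {d : ℕ → ℕ} {u : ℕ} (hu : u < n) : keyRank n d u < n := by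
  rw [keyRank]
  conv_rhs => rw [← Finset.card_range n]
  refine Finset.card_lt_card ⟨Finset.filter_subset _ _, fun h => ?_⟩
  have := (Finset.mem_filter.1 (h (Finset.mem_range.2 hu))).2
  omega

theorem keyRank_lt_keyRank {d : ℕ → ℕ} {u x : ℕ} (hx : x < n)
    (h : d x < d u ∨ (d x = d u ∧ x < u)) : keyRank n d x < keyRank n d u := by
  refine Finset.card_lt_card ⟨fun y hy => ?_, fun hsub => ?_⟩
  · simp only [Finset.mem_filter] at hy ⊢
    exact ⟨hy.1, by omega⟩
  · have := (Finset.mem_filter.1 (hsub (Finset.mem_filter.2 ⟨Finset.mem_range.2 hx, h⟩))).2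
    omega

theorem keyRank_injOn {d : ℕ → ℕ} {u x : ℕ} (hu : u < n) (hx : x < n)
    (h : keyRank n d u = keyRank n d x) : u = x := by
  by_contra hne
  have : (d x < d u ∨ (d x = d u ∧ x < u)) ∨ (d u < d x ∨ (d u = d x ∧ u < x)) := by omega
  rcases this with h' | h'
  · exact absurd h (keyRank_lt_keyRank hx h').ne'
  · exact absurd h (keyRank_lt_keyRank hu h').ne

theorem exists_keyRank_eq {d : ℕ → ℕ} {i : ℕ} (hi : i < n) : ∃ u < n, keyRank n d u = i := by
  have hinj : Function.Injective fun u : Fin n => (⟨keyRank n d u, keyRank_lt u.2⟩ : Fin n) :=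
    fun u x h => Fin.ext (keyRank_injOn u.2 x.2 (congrArg Fin.val h))
  obtain ⟨u, hu⟩ := (Finite.injective_iff_surjective.1 hinj) ⟨i, hi⟩
  exact ⟨u, u.2, congrArg Fin.val hu⟩

/-- Stability: a sequence of keys that is already sorted is not permuted. The implementation relies
on this to keep the given order of a degree-ordered input. -/
theorem keyRank_eq_self {d : ℕ → ℕ} (hd : ∀ x u, x < u → u < n → d x ≤ d u) {u : ℕ} (hu : u < n) :
    keyRank n d u = u := by
  rw [keyRank]
  conv_rhs => rw [← Finset.card_range u]
  congr 1
  ext x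
  simp only [Finset.mem_filter, Finset.mem_range]
  constructor
  · rintro ⟨hx, h⟩
    by_contra hxu
    rcases (not_lt.1 hxu).lt_or_eq with h' | rfl
    · have := hd u x h' hx
      omega
    · omega
  · intro hxu
    have := hd x u hxu hu
    exact ⟨hxu.trans hu, by omega⟩

/-- `rank` and `inv` are inverse permutations of `0, …, n - 1`. -/
structure IsRelabel (n : ℕ) (rank inv : ℕ → ℕ) : Prop where
  rank_lt : ∀ u < n, rank u < n
  inv_lt : ∀ i < n, inv i < n
  inv_rank : ∀ u < n, inv (rank u) = u
  rank_inv : ∀ i < n, rank (inv i) = i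

/-- The length of the list of the vertex in register `x`. -/
def lengthExp (x : ℕ) : Exp := .minus (.cell 0 (succReg x)) (.cell 0 (.reg x))

/-- Counting in the cell after the length makes the prefix sums strict: cell `x` then counts the
lengths below `x`, which is the first position for length `x`. -/
def countDegrees : Cmd :=
  forTo 25 26 (.lit 0) (.reg 0) <| .seq (.setReg 27 (.plus (lengthExp 25) (.lit 1)))
    (.setCell 8 (.reg 27) (.plus (.cell 8 (.reg 27)) (.lit 1)))

def prefixSums : Cmd :=
  forTo 25 26 (.lit 0) (.reg 0)
    (.setCell 8 (succReg 25) (.plus (.cell 8 (succReg 25)) (.cell 8 (.reg 25))))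

def placeVertices : Cmd :=
  forTo 25 26 (.lit 0) (.reg 0) <| .seq (.setReg 27 (lengthExp 25)) <|
    .seq (.setCell 6 (.reg 25) (.cell 8 (.reg 27))) <|
    .seq (.setCell 7 (.cell 8 (.reg 27)) (.reg 25))
      (.setCell 8 (.reg 27) (.plus (.cell 8 (.reg 27)) (.lit 1)))

def degreeSort : Cmd := .seq countDegrees (.seq prefixSums placeVertices)

theorem lengthExp_val {x k : ℕ} (hx : s.reg x = k) (h0 : s.arr 0 = off) :
    (lengthExp x).val s = listLength off k := by
  simp [lengthExp, Exp.val, succReg, hx, h0, listLength]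

theorem card_filter_range_le {n : ℕ} (p : ℕ → Prop) [DecidablePred p] :
    ((Finset.range n).filter p).card ≤ n :=
  (Finset.card_filter_le _ _).trans (Finset.card_range n).le

theorem runs_countDegrees (h0 : s.arr 0 = off) (hn : s.reg 0 = n)
    (hlt : ∀ u < n, listLength off u < n) (h8 : ∀ i, s.arr 8 i = 0) :
    Runs W M countDegrees s fun t s' => t ≤ 40 * n + 10 ∧ ∀ x, s'.arr 8 x =
      ((Finset.range n).filter fun u => listLength off u + 1 = x).card := by
  refine (Runs.forTo (lo := 0) (hi := n)
    (fun k arr => ∀ x, arr 8 x = ((Finset.range k).filter fun u => listLength off u + 1 = x).card)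
    (fun _ => 0) (fun _ => 30) (by decide) (by decide) (by decide) (by decide) (by decide) ?_ ?_
    (Nat.zero_le n) (fun _ h => hn ▸ h.1 0) (by simpa using h8) ?_).mono ?_
  · rfl
  · exact hn
  · intro k s' _ hk hM hb hF hk' _ hI
    have hs0 : s'.arr 0 = off := by rw [hF.2 0 (by decide), h0]
    have hnM : n ≤ M := by
      have := hb.1 0
      rwa [hF.1 0 (by decide), hn] at this
    have hl := hlt k hk
    refine Runs.seq (Runs.setReg (by decide) (fun _ _ => ?_) ?_)
    · rw [Exp.val, lengthExp_val hk' hs0, Exp.val]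
      omega
    rw [Exp.val, lengthExp_val hk' hs0, Exp.val]
    have hstep : ∀ x, ((Finset.range (k + 1)).filter fun u => listLength off u + 1 = x).card =
        if x = listLength off k + 1 then
          ((Finset.range k).filter fun u => listLength off u + 1 = x).card + 1
        else ((Finset.range k).filter fun u => listLength off u + 1 = x).card := by
      intro x
      rw [Finset.range_add_one, Finset.filter_insert]
      by_cases hx : listLength off k + 1 = x
      · rw [if_pos hx, if_pos hx.symm, Finset.card_insert_of_notMem (by simp)]
      · rw [if_neg hx, if_neg (Ne.symm hx)]
    refine Runs.setCell (by decide) (by decide) (fun _ _ => ?_)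
      ⟨by simp [Exp.cost, lengthExp, succReg], fun x => ?_⟩
    · have := card_filter_range_le (n := k + 1)
        fun u => listLength off u + 1 = listLength off k + 1
      rw [hstep, if_pos rfl, ← hI] at this
      simp only [Exp.val, Store.setReg_reg, Store.setReg_arr, if_true]
      omega
    · rw [hstep]
      simp only [Store.setCell_arr, Store.setReg_arr, Exp.val, Store.setReg_reg, if_true,
        Function.update_apply, hI]
      split_ifs with h
      · rw [h]
      · rfl
  · rintro t s' - - - ⟨ht, hI⟩
    refine ⟨?_, hI⟩
    simp only [Exp.cost, Finset.sum_const, Nat.card_Ico, smul_eq_mul] at ht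
    omega

theorem runs_prefixSums {d : ℕ → ℕ} (hn : s.reg 0 = n)
    (h8 : ∀ x, s.arr 8 x = ((Finset.range n).filter fun u => d u + 1 = x).card) :
    Runs W M prefixSums s fun t s' => t ≤ 40 * n + 10 ∧ ∀ x ≤ n, s'.arr 8 x =
      ((Finset.range n).filter fun u => d u < x).card := by
  refine (Runs.forTo (lo := 0) (hi := n)
    (fun k arr => (∀ x ≤ k, arr 8 x = ((Finset.range n).filter fun u => d u < x).card) ∧
      ∀ x, k < x → arr 8 x = ((Finset.range n).filter fun u => d u + 1 = x).card)
    (fun _ => 0) (fun _ => 30) (by decide) (by decide) (by decide) (by decide) (by decide) ?_ ?_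
    (Nat.zero_le n) (fun _ h => hn ▸ h.1 0) ⟨fun x hx => ?_, fun x _ => h8 x⟩ ?_).mono ?_
  · rfl
  · exact hn
  · rw [h8, Nat.le_zero.1 hx]
    simp
  · rintro k s' _ hk hM hb hF hk' _ ⟨hI₁, hI₂⟩
    have hnM : n ≤ M := by
      have := hb.1 0
      rwa [hF.1 0 (by decide), hn] at this
    have hstep : ((Finset.range n).filter fun u => d u < k + 1).card =
        ((Finset.range n).filter fun u => d u + 1 = k + 1).card +
          ((Finset.range n).filter fun u => d u < k).card := by
      rw [← Finset.card_union_of_disjoint, ← Finset.filter_or]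
      · congr 1
        ext u
        simp only [Finset.mem_filter]
        refine and_congr_right fun _ => ?_
        omega
      · rw [Finset.disjoint_filter]
        intro u _ h1
        omega
    have hval : Exp.val s' (.plus (.cell 8 (succReg 25)) (.cell 8 (.reg 25))) =
        ((Finset.range n).filter fun u => d u < k + 1).card := by
      simp only [Exp.val, succReg, hk', hstep, hI₁ k le_rfl, hI₂ (k + 1) (Nat.lt_succ_self k)]
    refine Runs.setCell (by decide) (by decide) (fun _ _ => ?_)
      ⟨by simp [Exp.cost, succReg], fun x hx => ?_, fun x hx => ?_⟩
    · rw [hval]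
      exact (card_filter_range_le _).trans hnM
    · rw [hval]
      by_cases hxk : x = k + 1
      · simp [Store.setCell_arr, Exp.val, succReg, hk', hxk]
      · simpa [Store.setCell_arr, Exp.val, succReg, hk', hxk] using hI₁ x (by omega)
    · have hxk : x ≠ k + 1 := by omega
      simpa [Store.setCell_arr, Exp.val, succReg, hk', hxk] using hI₂ x (by omega)
  · rintro t s' - - - ⟨ht, hI, -⟩
    refine ⟨?_, hI⟩
    simp only [Exp.cost, Finset.sum_const, Nat.card_Ico, smul_eq_mul] at ht
    omega

/-- Cell `x` holds the number of shorter lists plus the number of lists of length `x` already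
placed. When `k` is reached, the cell of its length is therefore its rank. -/
theorem runs_placeVertices (h0 : s.arr 0 = off) (hn : s.reg 0 = n)
    (hlt : ∀ u < n, listLength off u < n)
    (h8 : ∀ x ≤ n, s.arr 8 x = ((Finset.range n).filter fun u => listLength off u < x).card) :
    Runs W M placeVertices s fun t s' => t ≤ 60 * n + 10 ∧
      ∀ u < n, s'.arr 6 u = keyRank n (listLength off) u ∧
        s'.arr 7 (keyRank n (listLength off) u) = u := by
  refine (Runs.forTo (lo := 0) (hi := n)
    (fun k arr => (∀ u < k, arr 6 u = keyRank n (listLength off) u ∧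
        arr 7 (keyRank n (listLength off) u) = u) ∧
      ∀ x ≤ n, arr 8 x = ((Finset.range n).filter fun u =>
        listLength off u < x ∨ (listLength off u = x ∧ u < k)).card)
    (fun _ => 0) (fun _ => 40) (by decide) (by decide) (by decide) (by decide) (by decide) ?_ ?_
    (Nat.zero_le n) (fun _ h => hn ▸ h.1 0) ⟨by simp, by simpa using h8⟩ ?_).mono ?_
  · rfl
  · exact hn
  · rintro k s' _ hk hM hb hF hk' _ ⟨hI₁, hI₂⟩
    have hs0 : s'.arr 0 = off := by rw [hF.2 0 (by decide), h0]
    have hnM : n ≤ M := by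
      have := hb.1 0
      rwa [hF.1 0 (by decide), hn] at this
    have hl := hlt k hk
    have hrank : s'.arr 8 (listLength off k) = keyRank n (listLength off) k := hI₂ _ hl.le
    have hrlt := keyRank_lt (d := listLength off) hk
    have hstep : ∀ x, ((Finset.range n).filter fun u =>
        listLength off u < x ∨ (listLength off u = x ∧ u < k + 1)).card =
        if x = listLength off k then ((Finset.range n).filter fun u =>
          listLength off u < x ∨ (listLength off u = x ∧ u < k)).card + 1
        else ((Finset.range n).filter fun u =>
          listLength off u < x ∨ (listLength off u = x ∧ u < k)).card := by
      intro x
      split_ifs with hx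
      · subst hx
        rw [← Finset.card_insert_of_notMem (a := k) (by simp)]
        congr 1
        ext u
        simp only [Finset.mem_filter, Finset.mem_insert, Finset.mem_range]
        constructor
        · rintro ⟨h1, h2⟩
          by_cases huk : u = k
          · exact .inl huk
          · exact .inr ⟨h1, by omega⟩
        · rintro (rfl | ⟨h1, h2⟩)
          · exact ⟨hk, by omega⟩
          · exact ⟨h1, by omega⟩
      · congr 1
        ext u
        simp only [Finset.mem_filter]
        refine and_congr_right fun _ => ?_
        have : u = k → listLength off u = listLength off k := fun h => h ▸ rfl
        omega
    refine Runs.seq (Runs.setReg (by decide) (fun _ _ => ?_) ?_)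
    · rw [lengthExp_val hk' hs0]
      omega
    rw [lengthExp_val hk' hs0]
    refine Runs.seq (Runs.setCell (by decide) (by decide) (fun _ h => h.2 8 _) ?_)
    refine Runs.seq (Runs.setCell (by decide) (by decide) (fun _ h => h.1 25) ?_)
    simp only [Exp.val, Store.setReg_reg, Store.setReg_arr, Store.setCell_reg, Store.setCell_arr,
      hk', hrank, Nat.reduceEqDiff, if_true, if_false]
    refine Runs.setCell (by decide) (by decide) (fun _ _ => ?_)
      ⟨by simp [Exp.cost, lengthExp, succReg], fun u hu => ?_, fun x hx => ?_⟩
    · simp only [Exp.val, Store.setReg_reg, Store.setReg_arr, Store.setCell_reg, Store.setCell_arr,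
        hrank, Nat.reduceEqDiff, if_true, if_false]
      omega
    · by_cases huk : u = k
      · subst huk
        simp [Store.setCell_arr, Store.setReg_arr]
      · have hun : u < n := by omega
        have hne : keyRank n (listLength off) u ≠ keyRank n (listLength off) k := fun h =>
          huk (keyRank_injOn hun hk h)
        simpa [Store.setCell_arr, Store.setReg_arr, huk, hne] using hI₁ u (by omega)
    · rw [hstep, ← hI₂ x hx]
      simp only [Exp.val, Store.setReg_reg, Store.setReg_arr, Store.setCell_reg, Store.setCell_arr,
        Nat.reduceEqDiff, if_true, if_false, Function.update_apply]
      split_ifs with h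
      · rw [h]
      · rfl
  · rintro t s' - - - ⟨ht, hI, -⟩
    refine ⟨?_, hI⟩
    simp only [Exp.cost, Finset.sum_const, Nat.card_Ico, smul_eq_mul] at ht
    omega

theorem runs_degreeSort (h0 : s.arr 0 = off) (hn : s.reg 0 = n)
    (hlt : ∀ u < n, listLength off u < n) (h8 : ∀ i, s.arr 8 i = 0) :
    Runs W M degreeSort s fun t s' => t ≤ 140 * n + 30 ∧
      IsRelabel n (s'.arr 6) (s'.arr 7) ∧
      (∀ i j, i < j → j < n →
        listLength off (s'.arr 7 i) ≤ listLength off (s'.arr 7 j)) ∧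
      ((∀ x u, x < u → u < n → listLength off x ≤ listLength off u) →
        ∀ i < n, s'.arr 7 i = i) := by
  refine Runs.seq ((runs_countDegrees h0 hn hlt h8).mono ?_)
  rintro t₁ s₁ - - hF₁ ⟨ht₁, h8₁⟩
  refine Runs.seq ((runs_prefixSums (by rw [hF₁.1 0 (by decide), hn]) h8₁).mono ?_)
  rintro t₂ s₂ - - hF₂ ⟨ht₂, h8₂⟩
  refine (runs_placeVertices (by rw [hF₂.2 0 (by decide), hF₁.2 0 (by decide), h0])
    (by rw [hF₂.1 0 (by decide), hF₁.1 0 (by decide), hn]) hlt h8₂).mono ?_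
  rintro t₃ s₃ - - - ⟨ht₃, hI⟩
  have hinv : ∀ i < n, ∃ u < n, keyRank n (listLength off) u = i ∧ s₃.arr 7 i = u := by
    intro i hi
    obtain ⟨u, hu, rfl⟩ := exists_keyRank_eq (d := listLength off) hi
    exact ⟨u, hu, rfl, (hI u hu).2⟩
  refine ⟨by omega, ⟨fun u hu => ?_, fun i hi => ?_, fun u hu => ?_, fun i hi => ?_⟩,
    fun i j hij hj => ?_, fun hd i hi => ?_⟩
  · rw [(hI u hu).1]
    exact keyRank_lt hu
  · obtain ⟨u, hu, -, h⟩ := hinv i hi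
    rwa [h]
  · rw [(hI u hu).1, (hI u hu).2]
  · obtain ⟨u, hu, h', h⟩ := hinv i hi
    rw [h, (hI u hu).1, h']
  · obtain ⟨u, hu, hui, h⟩ := hinv i (hij.trans hj)
    obtain ⟨x, hx, hxj, h'⟩ := hinv j hj
    rw [h, h']
    by_contra hlt'
    have := keyRank_lt_keyRank hx (.inl (not_le.1 hlt'))
    omega
  · have := (hI i hi).2
    rwa [keyRank_eq_self hd hi] at this

end DegreeSort

/-! ### Sorting all adjacency lists at once by transposition -/

section Transpose

/-- The neighbors of `u` are listed, once each, in the cells `off u, …, off (u + 1) - 1`. -/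
structure InputAdj (n : ℕ) (H : SimpleGraph ℕ) (off adj : ℕ → ℕ) : Prop where
  off_zero : off 0 = 0
  off_le : ∀ u < n, off u ≤ off (u + 1)
  lt : ∀ u x, H.Adj u x → u < n
  mem : ∀ u < n, ∀ x, H.Adj u x ↔ ∃ k, off u ≤ k ∧ k < off (u + 1) ∧ adj k = x
  inj : ∀ u < n, Set.InjOn adj (Set.Ico (off u) (off (u + 1)))

/-- The graph in which `i` has the role that `inv i` has in `H`. -/
def relabel (n : ℕ) (H : SimpleGraph ℕ) (inv : ℕ → ℕ) : SimpleGraph ℕ where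
  Adj i j := i < n ∧ j < n ∧ H.Adj (inv i) (inv j)
  symm := ⟨fun _ _ h => ⟨h.2.1, h.1, h.2.2.symm⟩⟩
  loopless := ⟨fun _ h => h.2.2.ne rfl⟩

variable {n : ℕ} {H : SimpleGraph ℕ} {off adj rank inv : ℕ → ℕ} {W M : ℕ} {s : Store}

theorem InputAdj.ncard_adj (hA : InputAdj n H off adj) {u : ℕ} (hu : u < n) :
    {x | H.Adj u x}.ncard = listLength off u :=
  ncard_eq_of_injOn (hA.mem u hu) (hA.inj u hu)

theorem InputAdj.listLength_lt (hA : InputAdj n H off adj) {u : ℕ} (hu : u < n) :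
    listLength off u < n := by
  rw [← hA.ncard_adj hu]
  calc {x | H.Adj u x}.ncard < (Set.Iio n).ncard := by
        refine Set.ncard_lt_ncard ⟨fun x hx => hA.lt x u hx.symm, fun h => ?_⟩ (Set.finite_Iio n)
        exact H.loopless.irrefl u (h hu)
    _ = n := by rw [← Finset.coe_Iio, Set.ncard_coe_finset, Nat.card_Iio]

theorem IsRelabel.inv_injOn (hR : IsRelabel n rank inv) : Set.InjOn inv (Set.Iio n) := by
  intro i hi j hj h
  rw [← hR.rank_inv i hi, h, hR.rank_inv j hj]

theorem InputAdj.ncard_relabel (hA : InputAdj n H off adj) (hR : IsRelabel n rank inv) {i : ℕ}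
    (hi : i < n) : {x | (relabel n H inv).Adj i x}.ncard = listLength off (inv i) := by
  rw [← hA.ncard_adj (hR.inv_lt i hi), ← Set.InjOn.ncard_image (hR.inv_injOn.mono fun x hx => hx.2.1)]
  congr 1
  ext y
  constructor
  · rintro ⟨x, hx, rfl⟩
    exact hx.2.2
  · intro hy
    have hyn := hA.lt y _ hy.symm
    refine ⟨rank y, ⟨hi, hR.rank_lt y hyn, ?_⟩, hR.inv_rank y hyn⟩
    rwa [hR.inv_rank y hyn]

theorem IsRelabel.sum_comp (hR : IsRelabel n rank inv) (f : ℕ → ℕ) :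
    ∑ i ∈ Finset.range n, f (inv i) = ∑ u ∈ Finset.range n, f u :=
  Finset.sum_nbij' inv rank
    (fun i hi => Finset.mem_range.2 (hR.inv_lt i (Finset.mem_range.1 hi)))
    (fun u hu => Finset.mem_range.2 (hR.rank_lt u (Finset.mem_range.1 hu)))
    (fun i hi => hR.rank_inv i (Finset.mem_range.1 hi))
    (fun u hu => hR.inv_rank u (Finset.mem_range.1 hu)) fun _ _ => rfl

theorem sum_listLength (h0 : off 0 = 0) (hle : ∀ u < n, off u ≤ off (u + 1)) :
    ∑ u ∈ Finset.range n, listLength off u = off n := by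
  have key : ∀ k ≤ n, ∑ u ∈ Finset.range k, listLength off u = off k := by
    intro k hk
    induction k with
    | zero => simp [h0]
    | succ k ih =>
      rw [Finset.sum_range_succ, ih (by omega), listLength]
      have := hle k hk
      omega
  exact key n le_rfl

/-- Array `5` receives a copy of the offsets, to serve as write pointers while array `3` stays
fixed. -/
def offsetsCmd : Cmd :=
  forTo 25 26 (.lit 0) (.reg 0) <| .seq (.setReg 27 (.cell 7 (.reg 25))) <|
    .seq (.setCell 5 (.reg 25) (.cell 3 (.reg 25)))
      (.setCell 3 (succReg 25) (.plus (.cell 3 (.reg 25)) (lengthExp 27)))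

theorem runs_offsetsCmd (hA : InputAdj n H off adj) (hR : IsRelabel n rank inv)
    (h0 : s.arr 0 = off) (h7 : s.arr 7 = inv) (hn : s.reg 0 = n) (h3 : s.arr 3 0 = 0) :
    Runs W M offsetsCmd s fun t s' => t ≤ 40 * n + 10 ∧
      (∀ i ≤ n, s'.arr 3 i = ∑ j ∈ Finset.range i, listLength off (inv j)) ∧
      ∀ i < n, s'.arr 5 i = s'.arr 3 i := by
  refine (Runs.forTo (lo := 0) (hi := n)
    (fun k arr => (∀ i ≤ k, arr 3 i = ∑ j ∈ Finset.range i, listLength off (inv j)) ∧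
      ∀ i < k, arr 5 i = arr 3 i) (fun _ => 0) (fun _ => 30)
    (by decide) (by decide) (by decide) (by decide) (by decide) ?_ ?_
    (Nat.zero_le n) (fun _ h => hn ▸ h.1 0) ⟨fun i hi => ?_, by simp⟩ ?_).mono ?_
  · rfl
  · exact hn
  · simp [Nat.le_zero.1 hi, h3]
  · rintro k s' _ hk hM hb hF hk' _ ⟨hI₁, hI₂⟩
    have hs0 : s'.arr 0 = off := by rw [hF.2 0 (by decide), h0]
    have hs7 : s'.arr 7 = inv := by rw [hF.2 7 (by decide), h7]
    have hbound : ∑ j ∈ Finset.range (k + 1), listLength off (inv j) ≤ M := by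
      have h1 : ∑ j ∈ Finset.range (k + 1), listLength off (inv j) ≤
          ∑ j ∈ Finset.range n, listLength off (inv j) :=
        Finset.sum_le_sum_of_subset (Finset.range_mono hk)
      rw [hR.sum_comp, sum_listLength hA.off_zero hA.off_le] at h1
      have := hb.2 0 n
      rw [hs0] at this
      omega
    refine Runs.seq (Runs.setReg (by decide) (fun _ h => h.2 7 _) ?_)
    refine Runs.seq (Runs.setCell (by decide) (by decide) (fun _ h => h.2 3 _) ?_)
    have hval : ∀ A i x, A ≠ 0 → Exp.val (((s'.setReg 27 (inv k)).setCell A i x)) (lengthExp 27) =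
        listLength off (inv k) := by
      intro A i x hA0
      refine lengthExp_val ?_ ?_
      · simp [Store.setCell_reg, Store.setReg_reg]
      · simp [Store.setCell_arr, Store.setReg_arr, hA0.symm, hs0]
    simp only [Exp.val, Store.setReg_reg, Store.setReg_arr, hk', hs7, Nat.reduceEqDiff, if_false]
    refine Runs.setCell (by decide) (by decide) (fun _ _ => ?_)
      ⟨by simp [Exp.cost, lengthExp, succReg], fun i hi => ?_, fun i hi => ?_⟩
    · simp only [Exp.val, hval 5 _ _ (by decide), Store.setCell_reg, Store.setCell_arr,
        Store.setReg_reg, Store.setReg_arr, hk', Nat.reduceEqDiff, if_false, hI₁ k le_rfl]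
      rwa [← Finset.sum_range_succ]
    · simp only [Exp.val, hval 5 _ _ (by decide), Store.setCell_reg, Store.setCell_arr, succReg,
        Store.setReg_reg, Store.setReg_arr, hk', Nat.reduceEqDiff, if_false, if_true, hI₁ k le_rfl]
      by_cases hik : i = k + 1
      · subst hik
        rw [Function.update_self, Finset.sum_range_succ]
      · rw [Function.update_of_ne hik]
        exact hI₁ i (by omega)
    · simp only [Exp.val, Store.setCell_reg, Store.setCell_arr, succReg,
        Store.setReg_reg, Store.setReg_arr, hk', Nat.reduceEqDiff, if_false, if_true]
      rw [Function.update_of_ne (show i ≠ k + 1 by omega)]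
      by_cases hik : i = k
      · subst hik
        rw [Function.update_self]
      · rw [Function.update_of_ne hik]
        exact hI₂ i (by omega)
  · rintro t s' - - - ⟨ht, hI⟩
    refine ⟨?_, hI⟩
    simp only [Exp.cost, Finset.sum_const, Nat.card_Ico, smul_eq_mul] at ht
    omega

/-- The lists of the graph are filled up to `pos`; they contain the pairs in `D`. -/
structure FillInv (n : ℕ) (off : ℕ → ℕ) (D : ℕ → ℕ → Prop) (pos adj : ℕ → ℕ) : Prop where
  lo : ∀ j < n, off j ≤ pos j
  hi : ∀ j < n, pos j ≤ off (j + 1)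
  mem : ∀ j < n, ∀ x, D x j ↔ ∃ k, off j ≤ k ∧ k < pos j ∧ adj k = x
  strict : ∀ j < n, ∀ k l, off j ≤ k → k < l → l < pos j → adj k < adj l

variable {D : ℕ → ℕ → Prop} {pos : ℕ → ℕ}

theorem FillInv.ncard_eq (h : FillInv n off D pos adj) {j : ℕ} (hj : j < n) :
    {x | D x j}.ncard = pos j - off j :=
  ncard_eq_of_injOn (h.mem j hj) (injOn_Ico_of_strict (h.strict j hj))

/-- The list of `j` has room because it misses the neighbor `i`, and it stays sorted because `i`
exceeds all its entries. -/
theorem FillInv.insert (h : FillInv n off D pos adj)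
    (hmono : ∀ i j, i ≤ j → j ≤ n → off i ≤ off j) {i j : ℕ} (hj : j < n)
    (hcard : {x | H.Adj j x}.ncard = off (j + 1) - off j) (hfin : {x | H.Adj j x}.Finite)
    (hD : ∀ x, D x j → H.Adj j x) (hij : H.Adj j i) (hlt : ∀ x, D x j → x < i) :
    FillInv n off (insertPair D i j) (Function.update pos j (pos j + 1))
      (Function.update adj (pos j) i) := by
  have hpos : pos j < off (j + 1) := by
    have h1 : {x | D x j}.ncard < {x | H.Adj j x}.ncard :=
      Set.ncard_lt_ncard ⟨hD, fun hsub => lt_irrefl i (hlt i (hsub hij))⟩ hfin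
    rw [h.ncard_eq hj, hcard] at h1
    have := h.lo j hj
    omega
  -- The lists occupy disjoint intervals, so the write does not disturb another one.
  have hout : ∀ j' < n, j' ≠ j → ∀ k, off j' ≤ k → k < pos j' → k ≠ pos j := by
    intro j' hj' hne k h1 h2
    have hlo := h.lo j hj
    have hhi' := h.hi j' hj'
    rcases Nat.lt_or_gt_of_ne hne with hlt | hgt
    · have := hmono (j' + 1) j hlt (by omega)
      omega
    · have := hmono (j + 1) j' hgt (by omega)
      omega
  refine ⟨fun j' hj' => ?_, fun j' hj' => ?_, fun j' hj' x => ?_, fun j' hj' k l h1 h2 h3 => ?_⟩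
  · by_cases hjj : j' = j
    · subst hjj
      rw [Function.update_self]
      exact (h.lo j' hj').trans (Nat.le_succ _)
    · rw [Function.update_of_ne hjj]
      exact h.lo j' hj'
  · by_cases hjj : j' = j
    · subst hjj
      rwa [Function.update_self]
    · rw [Function.update_of_ne hjj]
      exact h.hi j' hj'
  · by_cases hjj : j' = j
    · subst hjj
      simp only [insertPair, and_true, Function.update_self, h.mem j' hj' x]
      constructor
      · rintro (⟨k, h1, h2, rfl⟩ | rfl)
        · exact ⟨k, h1, by omega, Function.update_of_ne (by omega) _ _⟩
        · exact ⟨pos j', h.lo j' hj', by omega, Function.update_self _ _ _⟩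
      · rintro ⟨k, h1, h2, hk⟩
        by_cases hkp : k = pos j'
        · subst hkp
          rw [Function.update_self] at hk
          exact .inr hk.symm
        · rw [Function.update_of_ne hkp] at hk
          exact .inl ⟨k, h1, by omega, hk⟩
    · simp only [insertPair, hjj, and_false, or_false, Function.update_of_ne hjj, h.mem j' hj' x]
      refine exists_congr fun k => and_congr_right fun h1 => and_congr_right fun h2 => ?_
      rw [Function.update_of_ne (hout j' hj' hjj k h1 h2)]
  · by_cases hjj : j' = j
    · subst hjj
      rw [Function.update_self] at h3
      rw [Function.update_of_ne (show k ≠ pos j' by omega)]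
      by_cases hlp : l = pos j'
      · subst hlp
        rw [Function.update_self]
        exact hlt _ ((h.mem j' hj' _).2 ⟨k, h1, h2, rfl⟩)
      · rw [Function.update_of_ne hlp]
        exact h.strict j' hj' k l h1 h2 (by omega)
    · rw [Function.update_of_ne hjj] at h3
      rw [Function.update_of_ne (hout j' hj' hjj k h1 (h2.trans h3)),
        Function.update_of_ne (hout j' hj' hjj l (h1.trans h2.le) h3)]
      exact h.strict j' hj' k l h1 h2 h3

def transposeCmd : Cmd :=
  forTo 25 26 (.lit 0) (.reg 0) <| .seq (.setReg 27 (.cell 7 (.reg 25))) <|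
    forTo 28 29 (.cell 0 (.reg 27)) (.cell 0 (succReg 27)) <|
      .seq (.setReg 30 (.cell 6 (.cell 1 (.reg 28)))) <|
      .seq (.setCell 4 (.cell 5 (.reg 30)) (.reg 25))
        (.setCell 5 (.reg 30) (.plus (.cell 5 (.reg 30)) (.lit 1)))

/-- The new labels `i` are taken in increasing order, and `i` is appended to the list of each of its
neighbors. By symmetry of adjacency every list is filled with the right entries, and by the order of
the outer loop it is increasing. -/
theorem runs_transposeCmd (hA : InputAdj n H off adj) (hR : IsRelabel n rank inv)
    (h0 : s.arr 0 = off) (h1 : s.arr 1 = adj) (h6 : s.arr 6 = rank) (h7 : s.arr 7 = inv)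
    (hn : s.reg 0 = n)
    (h3 : ∀ i ≤ n, s.arr 3 i = ∑ j ∈ Finset.range i, listLength off (inv j))
    (h5 : ∀ i < n, s.arr 5 i = s.arr 3 i) :
    Runs W M transposeCmd s fun t s' => t ≤ 40 * n + 40 * off n + 10 ∧
      SortedAdj n (relabel n H inv) (s.arr 3) (s'.arr 4) := by
  have hmono : ∀ i j, i ≤ j → j ≤ n → s.arr 3 i ≤ s.arr 3 j := by
    intro i j hij hj
    rw [h3 i (hij.trans hj), h3 j hj]
    exact Finset.sum_le_sum_of_subset (Finset.range_mono hij)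
  have hcard : ∀ j < n, {x | (relabel n H inv).Adj j x}.ncard = s.arr 3 (j + 1) - s.arr 3 j := by
    intro j hj
    rw [hA.ncard_relabel hR hj, h3 (j + 1) hj, h3 j hj.le, Finset.sum_range_succ]
    omega
  have hfin : ∀ j, {x | (relabel n H inv).Adj j x}.Finite := fun j =>
    (Set.finite_Iio n).subset fun x hx => hx.2.1
  refine (Runs.forTo (lo := 0) (hi := n)
    (fun k arr => FillInv n (s.arr 3) (fun x j => x < k ∧ (relabel n H inv).Adj j x)
      (arr 5) (arr 4)) (fun _ => 0) (fun k => 20 + 40 * listLength off (inv k))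
    (by decide) (by decide) (by decide) (by decide) (by decide) ?_ ?_
    (Nat.zero_le n) (fun _ h => hn ▸ h.1 0) ?_ ?_).mono ?_
  · rfl
  · exact hn
  · refine ⟨fun j hj => (h5 j hj).ge, fun j hj => ?_, fun j hj x => ?_, fun j hj k l h1 h2 h3 => ?_⟩
    · rw [h5 j hj]
      exact hmono j (j + 1) (Nat.le_succ j) hj
    · refine iff_of_false (fun h => absurd h.1 (Nat.not_lt_zero x)) ?_
      rintro ⟨k, hk, hk', -⟩
      rw [h5 j hj] at hk'
      omega
    · rw [h5 j hj] at h3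
      omega
  · rintro i s' _ hi hM hb hF hi' _ hI
    have hs0 : s'.arr 0 = off := by rw [hF.2 0 (by decide), h0]
    have hs7 : s'.arr 7 = inv := by rw [hF.2 7 (by decide), h7]
    have hun := hR.inv_lt i hi
    have hru := hR.rank_inv i hi
    refine Runs.seq (Runs.setReg (by decide) (fun _ h => h.2 7 _) ?_)
    simp only [Exp.val, hi', hs7]
    generalize hu : inv i = u at hun hru
    refine (Runs.forTo (lo := off u) (hi := off (u + 1)) (fun l arr => FillInv n (s.arr 3)
      (fun x j => (x < i ∧ (relabel n H inv).Adj j x) ∨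
        (x = i ∧ ∃ l', off u ≤ l' ∧ l' < l ∧ rank (adj l') = j)) (arr 5) (arr 4))
      (fun _ => 0) (fun _ => 25) (by decide) (by decide) (by decide) (by decide) (by decide) ?_ ?_
      (hA.off_le u hun) ?_ ?_ ?_).mono ?_
    · simp [Exp.val, Store.setReg_reg, Store.setReg_arr, hs0]
    · simp [Exp.val, succReg, Store.setReg_reg, Store.setReg_arr, hs0]
    · intro _ h
      have := h.2 0 (u + 1)
      rwa [Store.setReg_arr, hs0] at this
    · have : (fun x j => (x < i ∧ (relabel n H inv).Adj j x) ∨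
          (x = i ∧ ∃ l', off u ≤ l' ∧ l' < off u ∧ rank (adj l') = j)) =
          fun x j => x < i ∧ (relabel n H inv).Adj j x := by
        ext x j
        refine or_iff_left ?_
        rintro ⟨-, l', h1, h2, -⟩
        omega
      rwa [this, Store.setReg_arr]
    · rintro l s₁ hl hl' - hb₁ hF₁ hl₁ - hI₁
      have hs1 : s₁.arr 1 = adj := by
        rw [hF₁.2 1 (by decide), Store.setReg_arr, hF.2 1 (by decide), h1]
      have hs6 : s₁.arr 6 = rank := by
        rw [hF₁.2 6 (by decide), Store.setReg_arr, hF.2 6 (by decide), h6]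
      have hs3 : s₁.arr 3 = s.arr 3 := by
        rw [hF₁.2 3 (by decide), Store.setReg_arr, hF.2 3 (by decide)]
      have hi₁ : s₁.reg 25 = i := by
        rw [hF₁.1 25 (by decide), Store.setReg_reg, if_neg (by decide), hi']
      have hnbr : ∀ l', off u ≤ l' → l' < off (u + 1) → adj l' < n ∧
          (relabel n H inv).Adj (rank (adj l')) i := by
        intro l' hl₁ hl₂
        have huy : H.Adj u (adj l') := (hA.mem u hun _).2 ⟨l', hl₁, hl₂, rfl⟩
        have hyn := hA.lt _ u huy.symm
        refine ⟨hyn, hR.rank_lt _ hyn, hi, ?_⟩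
        rw [hR.inv_rank _ hyn, hu]
        exact huy.symm
      obtain ⟨hyn, hji⟩ := hnbr l hl hl'
      have hins := hI₁.insert hmono (hR.rank_lt _ hyn) (hcard _ (hR.rank_lt _ hyn)) (hfin _)
        (fun x hx => by
          rcases hx with ⟨-, hx⟩ | ⟨rfl, l', h1, h2, h3⟩
          · exact hx
          · rw [← h3]
            exact (hnbr l' h1 (by omega)).2) hji
        (fun x hx => by
          rcases hx with ⟨hx, -⟩ | ⟨rfl, l', h1, h2, h3⟩
          · exact hx
          · have hy' := (hnbr l' h1 (by omega)).1
            -- An input list has no repetitions and `rank` is injective, so `i` is appended only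
            -- once to each list.
            have : adj l' = adj l := by
              rw [← hR.inv_rank _ hy', h3, hR.inv_rank _ hyn]
            have := hA.inj u hun ⟨h1, by omega⟩ ⟨hl, hl'⟩ this
            omega)
      refine Runs.seq (Runs.setReg (by decide) (fun _ h => h.2 6 _) ?_)
      refine Runs.seq (Runs.setCell (by decide) (by decide) (fun _ h => h.1 25) ?_)
      simp only [Exp.val, Store.setReg_reg, Store.setReg_arr, hl₁, hs1, hs6, hi₁,
        Nat.reduceEqDiff, if_true, if_false]
      refine Runs.setCell (by decide) (by decide) (fun _ _ => ?_) ⟨by simp [Exp.cost], ?_⟩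
      · simp only [Exp.val, Store.setCell_reg, Store.setCell_arr, Store.setReg_reg,
          Store.setReg_arr, Nat.reduceEqDiff, if_true, if_false]
        have h1 := hins.hi _ (hR.rank_lt _ hyn)
        rw [Function.update_self] at h1
        have h2 := hb₁.2 3 (rank (adj l) + 1)
        rw [hs3] at h2
        omega
      · simp only [Exp.val, Store.setCell_reg, Store.setCell_arr, Store.setReg_reg,
          Store.setReg_arr, Nat.reduceEqDiff, if_true, if_false]
        convert hins using 1
        ext x j
        simp only [insertPair, or_assoc]
        refine or_congr_right ?_
        constructor
        · rintro ⟨rfl, l', h1, h2, rfl⟩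
          rcases (Nat.lt_succ_iff.1 h2).lt_or_eq with h | rfl
          · exact .inl ⟨rfl, l', h1, h, rfl⟩
          · exact .inr ⟨rfl, rfl⟩
        · rintro (⟨rfl, l', h1, h2, rfl⟩ | ⟨rfl, rfl⟩)
          · exact ⟨rfl, l', h1, by omega, rfl⟩
          · exact ⟨rfl, l, hl, by omega, rfl⟩
    · rintro t s₂ - - - ⟨ht, hI₂⟩
      refine ⟨?_, ?_⟩
      · simp only [Exp.cost, succReg, Finset.sum_const, Nat.card_Ico, smul_eq_mul] at ht ⊢
        rw [listLength]
        omega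
      · convert hI₂ using 1
        ext x j
        constructor
        · rintro ⟨h1, h2⟩
          rcases (Nat.lt_succ_iff.1 h1).lt_or_eq with h | rfl
          · exact .inl ⟨h, h2⟩
          · refine .inr ⟨rfl, ?_⟩
            have huj : H.Adj u (inv j) := by
              rw [← hu]
              exact h2.2.2.symm
            obtain ⟨l', h3, h4, h5⟩ := (hA.mem u hun _).1 huj
            exact ⟨l', h3, h4, by rw [h5, hR.rank_inv j h2.1]⟩
        · rintro (⟨h1, h2⟩ | ⟨rfl, l', h1, h2, rfl⟩)
          · exact ⟨by omega, h2⟩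
          · have huy : H.Adj u (adj l') := (hA.mem u hun _).2 ⟨l', h1, h2, rfl⟩
            have hyn := hA.lt _ u huy.symm
            refine ⟨by omega, hR.rank_lt _ hyn, hi, ?_⟩
            rw [hR.inv_rank _ hyn, hu]
            exact huy.symm
  · rintro t s' - - hF ⟨ht, hI⟩
    have hD : (fun x j => x < n ∧ (relabel n H inv).Adj j x) =
        fun x j => (relabel n H inv).Adj j x := by
      ext x j
      exact and_iff_right_of_imp fun h => h.2.1
    rw [hD] at hI
    refine ⟨?_, ?_, fun u hu => hmono u (u + 1) (Nat.le_succ u) hu, fun u x h => h.1,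
      fun u hu x => ?_, fun u hu k l h1 h2 h3 => ?_⟩
    · have hsum : ∑ k ∈ Finset.range n, listLength off (inv k) = off n := by
        rw [hR.sum_comp, sum_listLength hA.off_zero hA.off_le]
      rw [Nat.Ico_zero_eq_range, Finset.sum_add_distrib, Finset.sum_add_distrib, ← Finset.mul_sum,
        hsum] at ht
      simp only [Exp.cost, Finset.sum_const, Finset.card_range, smul_eq_mul] at ht
      omega
    · simp [h3 0 (Nat.zero_le n)]
    · have heq : s'.arr 5 u = s.arr 3 (u + 1) := by
        have h1 := hI.ncard_eq hu
        rw [hcard u hu] at h1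
        have := hI.lo u hu
        have := hI.hi u hu
        omega
      rw [← heq]
      exact hI.mem u hu x
    · have heq : s'.arr 5 u = s.arr 3 (u + 1) := by
        have h1 := hI.ncard_eq hu
        rw [hcard u hu] at h1
        have := hI.lo u hu
        have := hI.hi u hu
        omega
      rw [← heq] at h3
      exact hI.strict u hu k l h1 h2 h3

/-- Sort the vertices by degree, and build the sorted adjacency lists of the relabeled graph. -/
def prepCmd : Cmd := .seq degreeSort (.seq offsetsCmd transposeCmd)

theorem runs_prepCmd (hA : InputAdj n H off adj) (h0 : s.arr 0 = off) (h1 : s.arr 1 = adj)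
    (hn : s.reg 0 = n) (h3 : s.arr 3 0 = 0) (h8 : ∀ i, s.arr 8 i = 0) :
    Runs W M prepCmd s fun t s' => t ≤ 300 * (n + off n + 1) ∧ ∃ rank inv,
      IsRelabel n rank inv ∧ SortedAdj n (relabel n H inv) (s'.arr 3) (s'.arr 4) ∧
      (∀ i < n, listLength (s'.arr 3) i = listLength off (inv i)) ∧
      (∀ i j, i < j → j < n → listLength off (inv i) ≤ listLength off (inv j)) ∧
      ((∀ x u, x < u → u < n → listLength off x ≤ listLength off u) → ∀ i < n, inv i = i) := by
  refine Runs.seq ((runs_degreeSort h0 hn (fun u hu => hA.listLength_lt hu) h8).mono ?_)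
  rintro t₁ s₁ - - hF₁ ⟨ht₁, hR, hdeg, hid⟩
  refine Runs.seq ((runs_offsetsCmd hA hR (by rw [hF₁.2 0 (by decide), h0]) rfl
    (by rw [hF₁.1 0 (by decide), hn]) (by rw [hF₁.2 3 (by decide), h3])).mono ?_)
  rintro t₂ s₂ - - hF₂ ⟨ht₂, h3₂, h5₂⟩
  refine (runs_transposeCmd hA hR (by rw [hF₂.2 0 (by decide), hF₁.2 0 (by decide), h0])
    (by rw [hF₂.2 1 (by decide), hF₁.2 1 (by decide), h1]) (hF₂.2 6 (by decide))
    (hF₂.2 7 (by decide)) (by rw [hF₂.1 0 (by decide), hF₁.1 0 (by decide), hn]) h3₂ h5₂).mono ?_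
  rintro t₃ s₃ - - hF₃ ⟨ht₃, hS⟩
  rw [hF₃.2 3 (by decide)]
  refine ⟨by omega, _, _, hR, hS, fun i hi => ?_, hdeg, hid⟩
  rw [listLength, h3₂ (i + 1) hi, h3₂ i hi.le, Finset.sum_range_succ]
  omega

end Transpose

/-! ### Detection of triangles -/

section Triangles

/-- Record in `FL[5]` whether there is a triangle. -/
def triangleCmd : Cmd :=
  forTo 25 26 (.lit 0) (.reg 0) <| .seq (.setReg 10 (.reg 25)) <| .seq (.setReg 13 (.reg 25)) <|
    .seq stampNbrs <| forNN .skip <|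
      .ifNonzero (.differ (.cell 13 (.reg 16)) (succReg 10)) .skip (.setCell 14 (.lit 5) (.lit 1))

variable {n : ℕ} {H : SimpleGraph ℕ} {off adj : ℕ → ℕ} {W M : ℕ} {s : Store}

/-- Of two vertices of a triangle the larger serves as `v` and the other as `a`; the third may lie
anywhere. The double loop with `N(v)` stamped therefore meets every triangle. -/
theorem not_cliqueFree_three_iff (hlt : ∀ u x, H.Adj u x → u < n) :
    ¬ H.CliqueFree 3 ↔ ∃ v < n, ∃ a w, AllPairs H v a w ∧ H.Adj v w := by
  constructor
  · intro h
    simp only [SimpleGraph.CliqueFree, not_forall, not_not] at h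
    obtain ⟨t, ht⟩ := h
    obtain ⟨a, b, c, hab, hac, hbc, -⟩ := SimpleGraph.is3Clique_iff.1 ht
    rcases Nat.lt_or_gt_of_ne hab.ne with h | h
    · exact ⟨b, hlt b a hab.symm, a, c, ⟨hab.symm, h, hac⟩, hbc⟩
    · exact ⟨a, hlt a b hab, b, c, ⟨hab, h, hbc⟩, hac⟩
  · rintro ⟨v, -, a, w, ⟨hva, -, haw⟩, hvw⟩ hH
    exact CliqueFree.not_adj hH hva haw hvw

theorem runs_triangleCmd (hA : SortedAdj n H off adj) (h3 : s.arr 3 = off) (h4 : s.arr 4 = adj)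
    (hn : s.reg 0 = n) (hst : StampInv H (s.arr 13)) (h5 : s.arr 14 5 = 0) :
    Runs W M triangleCmd s fun t s' =>
      t ≤ 300 * (1 + ∑ v ∈ Finset.range n, stepsNN off adj v) ∧
      (s'.arr 14 5 = 0 ↔ H.CliqueFree 3) ∧ s'.arr 14 0 = s.arr 14 0 ∧ StampInv H (s'.arr 13) := by
  refine (Runs.forTo (lo := 0) (hi := n)
    (fun k arr => (arr 14 5 ≠ 0 ↔ ∃ v < k, ∃ a w, AllPairs H v a w ∧ H.Adj v w) ∧
      arr 14 0 = s.arr 14 0 ∧ StampInv H (arr 13)) (fun _ => 0)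
    (fun k => 190 * stepsNN off adj k) (by decide) (by decide) (by decide) (by decide) (by decide)
    ?_ ?_ (Nat.zero_le n) (fun _ h => hn ▸ h.1 0) ⟨by simp [h5], rfl, hst⟩ ?_).mono ?_
  · rfl
  · exact hn
  · rintro v s' _ hv hM hb hF hv' _ ⟨hI₁, hI₂, hI₃⟩
    refine Runs.seq (Runs.setReg (by decide) (fun _ h => h.1 25) ?_)
    refine Runs.seq (Runs.setReg (by decide) (fun _ h => h.1 25) ?_)
    simp only [Exp.val, Store.setReg_reg, hv', Nat.reduceEqDiff, if_false]
    have hr10 : ((s'.setReg 10 v).setReg 13 v).reg 10 = v := by simp [Store.setReg_reg]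
    have hr13 : ((s'.setReg 10 v).setReg 13 v).reg 13 = v := by simp [Store.setReg_reg]
    have hr0 : ((s'.setReg 10 v).setReg 13 v).reg 0 = n := by
      simp [Store.setReg_reg, hF.1 0 (by decide), hn]
    have harr : ((s'.setReg 10 v).setReg 13 v).arr = s'.arr := rfl
    generalize (s'.setReg 10 v).setReg 13 v = s₀ at hr10 hr13 hr0 harr
    have h3₀ : s₀.arr 3 = off := by rw [harr, hF.2 3 (by decide), h3]
    have h4₀ : s₀.arr 4 = adj := by rw [harr, hF.2 4 (by decide), h4]
    refine Runs.seq ((runs_stampNbrs hA h3₀ h4₀ hr13 hv hr0.ge (by rwa [harr])).mono ?_)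
    rintro t₁ s₁ - - hF₁ ⟨ht₁, hst₁, hst₁'⟩
    have h14₁ : s₁.arr 14 = s'.arr 14 := by rw [hF₁.2 14 (by decide), harr]
    refine (Runs.forNN (n := n) (v := v) (H := H) (off := off) (adj := adj) hA
      (by rw [hF₁.2 3 (by decide), h3₀])
      (by rw [hF₁.2 4 (by decide), h4₀]) (by rw [hF₁.1 10 (by decide), hr10]) hv
      (fun D arr => (arr 14 5 ≠ 0 ↔ s'.arr 14 5 ≠ 0 ∨ ∃ a w, D a w ∧ H.Adj v w) ∧
        arr 14 0 = s.arr 14 0) (fun _ _ => True) (fun _ => 0) 20 ?_ ?_ (by decide) (by decide)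
      ⟨by simp [h14₁], by rw [h14₁, hI₂]⟩ ?_ ?_).mono ?_
    · intro r h1 h2
      interval_cases r <;> decide
    · intro r h1 h2
      interval_cases r <;> decide
    · intro D a s₂ _ _ _ _ _ hI
      exact Runs.skip ⟨by omega, hI, trivial⟩
    · rintro D a w s₂ - - - hF₂ - hw ⟨hI, hI'⟩ -
      have h10₂ : s₂.reg 10 = v := by rw [hF₂.1 10 (by decide), hF₁.1 10 (by decide), hr10]
      have h13₂ : s₂.arr 13 w = v + 1 ↔ H.Adj v w := by
        rw [hF₂.2 13 (by decide)]
        exact ⟨hst₁ w v, hst₁' w⟩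
      refine Runs.ifNonzero (by decide) (fun hne => ?_) (fun he => ?_)
      · rw [Exp.differ_val] at hne
        simp only [Exp.val, succReg, hw, h10₂, ne_eq, h13₂] at hne
        refine Runs.skip ⟨by simp [Exp.cost, Exp.differ, succReg], ⟨?_, hI'⟩, trivial⟩
        rw [hI]
        refine or_congr_right (exists_congr fun a' => exists_congr fun w' => ?_)
        simp only [insertPair]
        constructor
        · rintro ⟨h1, h2⟩
          exact ⟨.inl h1, h2⟩
        · rintro ⟨h1 | ⟨-, rfl⟩, h2⟩
          · exact ⟨h1, h2⟩
          · exact absurd h2 hne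
      · rw [Exp.differ_val_eq] at he
        simp only [Exp.val, succReg, hw, h10₂, h13₂] at he
        refine Runs.setCell (by decide) (by decide) (fun h _ => h)
          ⟨by simp [Exp.cost, Exp.differ, succReg], ⟨?_, ?_⟩, trivial⟩
        · simp only [Store.setCell_arr, Exp.val, if_true, Function.update_self, ne_eq, one_ne_zero,
            not_false_iff, true_iff]
          exact .inr ⟨a, w, .inr ⟨rfl, rfl⟩, he⟩
        · simpa [Store.setCell_arr, Exp.val] using hI'
    · rintro t s₂ - - hF₂ ⟨ht, hI, hI'⟩
      have hdeg : off (v + 1) - off v + 1 ≤ stepsNN off adj v := by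
        rw [stepsNN, Finset.sum_add_distrib]
        simp only [Finset.sum_const, Nat.card_Ico, smul_eq_mul, mul_one]
        omega
      refine ⟨?_, ⟨?_, hI', by rwa [hF₂.2 13 (by decide)]⟩⟩
      · simp only [Exp.cost]
        omega
      · rw [hI, hI₁]
        constructor
        · rintro (⟨x, hx, h⟩ | h)
          · exact ⟨x, by omega, h⟩
          · exact ⟨v, by omega, h⟩
        · rintro ⟨x, hx, h⟩
          rcases (Nat.lt_succ_iff.1 hx).lt_or_eq with h' | rfl
          · exact .inl ⟨x, h', h⟩
          · exact .inr h
  · rintro t s' - - - ⟨ht, hI₁, hI₂, hI₃⟩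
    refine ⟨?_, ?_, hI₂, hI₃⟩
    · rw [Nat.Ico_zero_eq_range, Finset.sum_add_distrib, ← Finset.mul_sum] at ht
      simp only [Exp.cost, Finset.sum_const, Finset.card_range, smul_eq_mul] at ht
      have hn' : n ≤ ∑ v ∈ Finset.range n, stepsNN off adj v := by
        have := Finset.card_nsmul_le_sum (Finset.range n) (stepsNN off adj) 1 fun v _ => by
          rw [stepsNN]
          omega
        simpa using this
      omega
    · rw [← not_iff_not, not_cliqueFree_three_iff hA.lt]
      exact hI₁

end Triangles

/-! ### The sum of minimum degrees over the edges and the arboricity -/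

section Arboricity

universe v

variable {V : Type v}

/-- Root every component and let the parent of a vertex be the penultimate vertex on a path from the
root. Of two adjacent vertices, one lies on the root path of the other and, by acyclicity, is its
penultimate vertex. -/
theorem exists_parent {F : SimpleGraph V} (hF : F.IsAcyclic) :
    ∃ par : V → V, ∀ v w, F.Adj v w → w = par v ∨ v = par w := by
  let root : V → V := fun v => (F.connectedComponentMk v).out
  have hroot : ∀ v, ∃ q : F.Walk (root v) v, q.IsPath := fun v => by
    have : F.Reachable (root v) v := SimpleGraph.ConnectedComponent.exact (Quot.out_eq _)
    exact this.exists_isPath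
  choose p hp using hroot
  obtain ⟨par, hpar⟩ : ∃ par : V → V, ∀ v, ∃ q : F.Walk (root v) v,
      q.IsPath ∧ par v = q.penultimate := ⟨fun v => (p v).penultimate, fun v => ⟨p v, hp v, rfl⟩⟩
  refine ⟨par, fun v w hvw => ?_⟩
  obtain ⟨q', hq', hqv⟩ := hpar v
  -- Adjacent vertices share a component, so both paths start at the same root.
  have heq : root w = root v := by
    simp only [root, SimpleGraph.ConnectedComponent.connectedComponentMk_eq_of_adj hvw]
  obtain ⟨q, hq, hqw⟩ : ∃ q : F.Walk (root v) w, q.IsPath ∧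
      par w = q.penultimate := by
    have := hpar w
    rwa [heq] at this
  by_cases hw : w ∈ q'.support
  · exact .inl ((hF.eq_penultimate_of_adj_end hq' hvw hw).trans hqv.symm)
  · have hv : v ∈ q.support := hF.mem_support_of_ne_mem_support_of_adj_of_isPath hq hq'
      hvw.symm hw
    exact .inr ((hF.eq_penultimate_of_adj_end hq hvw.symm hv).trans hqw.symm)

/-- An infimum over an empty set would be `0`, so attainment needs some decomposition; one forest
for each edge provides it. -/
theorem exists_arboricity_decomposition [Finite V] (G : SimpleGraph V) :
    ∃ F : Fin (arboricity G) → SimpleGraph V,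
      (∀ i, (F i).IsAcyclic) ∧ (∀ i j, i ≠ j → Disjoint (F i) (F j)) ∧ (⨆ i, F i) = G := by
  refine Nat.sInf_mem (s := {k : ℕ | ∃ F : Fin k → SimpleGraph V,
    (∀ i, (F i).IsAcyclic) ∧ (∀ i j, i ≠ j → Disjoint (F i) (F j)) ∧ (⨆ i, F i) = G}) ?_
  let e := Finite.equivFin G.edgeSet
  refine ⟨Nat.card G.edgeSet, fun i => SimpleGraph.fromEdgeSet {((e.symm i : G.edgeSet) : Sym2 V)},
    fun i => ?_, fun i j hij => ?_, ?_⟩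
  · beta_reduce
    obtain ⟨x, hx⟩ := e.symm i
    induction x using Sym2.ind with
    | _ a b =>
      have hne : a ≠ b := G.ne_of_adj hx
      have := (SimpleGraph.isAcyclic_bot (V := V)).sup_edge_of_not_reachable (u := a) (v := b)
        (by simpa using hne)
      rwa [bot_sup_eq] at this
  · rw [SimpleGraph.fromEdgeSet_disjoint, SimpleGraph.edgeSet_fromEdgeSet,
      Set.disjoint_singleton_left]
    rintro ⟨h, -⟩
    exact hij (e.symm.injective (Subtype.ext h))
  · ext a b
    simp only [SimpleGraph.iSup_adj, SimpleGraph.fromEdgeSet_adj, Set.mem_singleton_iff]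
    constructor
    · rintro ⟨i, h, -⟩
      have := (e.symm i).2
      rwa [← h] at this
    · intro h
      exact ⟨e ⟨s(a, b), h⟩, by rw [Equiv.symm_apply_apply], h.ne⟩

open Classical in
-- Charge the edge between a vertex and its parent to the degree weight of the child. Each vertex is
-- charged for one edge only, and the factor `2` comes from ordered pairs.
theorem sum_min_le_of_isAcyclic [Fintype V] {F : SimpleGraph V} (hF : F.IsAcyclic) (d : V → ℕ) :
    ∑ v, ∑ w, (if F.Adj v w then min (d v) (d w) else 0) ≤ 2 * ∑ v, d v := by
  obtain ⟨par, hpar⟩ := exists_parent hF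
  calc ∑ v, ∑ w, (if F.Adj v w then min (d v) (d w) else 0)
      ≤ ∑ v, ∑ w, ((if w = par v then d v else 0) + if v = par w then d w else 0) := by
        refine Finset.sum_le_sum fun v _ => Finset.sum_le_sum fun w _ => ?_
        split_ifs with h h1 h2 h2 <;> try omega
        rcases hpar v w h with h' | h' <;> contradiction
    _ = 2 * ∑ v, d v := by
        simp only [Finset.sum_add_distrib]
        rw [Finset.sum_comm (f := fun v w => if v = par w then d w else 0)]
        simp only [Finset.sum_ite_eq', Finset.mem_univ, if_true]
        ring

open Classical in
theorem sum_min_le [Fintype V] (G : SimpleGraph V) (d : V → ℕ) :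
    ∑ v, ∑ w, (if G.Adj v w then min (d v) (d w) else 0) ≤ 2 * arboricity G * ∑ v, d v := by
  obtain ⟨F, hF, -, hG⟩ := exists_arboricity_decomposition G
  have hadj : ∀ v w, G.Adj v w → ∃ i, (F i).Adj v w := by
    intro v w h
    rwa [← hG, SimpleGraph.iSup_adj] at h
  calc ∑ v, ∑ w, (if G.Adj v w then min (d v) (d w) else 0)
      ≤ ∑ v, ∑ w, ∑ i, (if (F i).Adj v w then min (d v) (d w) else 0) := by
        refine Finset.sum_le_sum fun v _ => Finset.sum_le_sum fun w _ => ?_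
        split_ifs with h
        · obtain ⟨i, hi⟩ := hadj v w h
          calc min (d v) (d w) = if (F i).Adj v w then min (d v) (d w) else 0 := (if_pos hi).symm
            _ ≤ _ := Finset.single_le_sum
              (f := fun i => if (F i).Adj v w then min (d v) (d w) else 0)
              (fun _ _ => Nat.zero_le _) (Finset.mem_univ i)
        · exact Nat.zero_le _
    _ = ∑ i, ∑ v, ∑ w, (if (F i).Adj v w then min (d v) (d w) else 0) := by
        rw [Finset.sum_comm]
        conv_rhs => rw [Finset.sum_comm]
        rw [Finset.sum_comm]
        refine Finset.sum_congr rfl fun v _ => ?_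
        rw [Finset.sum_comm]
    _ ≤ ∑ _i : Fin (arboricity G), 2 * ∑ v, d v :=
        Finset.sum_le_sum fun i _ => sum_min_le_of_isAcyclic (hF i) d
    _ = 2 * arboricity G * ∑ v, d v := by
        simp only [Finset.sum_const, Finset.card_univ, Fintype.card_fin, smul_eq_mul]
        ring

theorem sum_ncard_neighborSet [Fintype V] (G : SimpleGraph V) :
    ∑ v, (G.neighborSet v).ncard = 2 * numEdges G := by
  classical
  rw [numEdges, ← SimpleGraph.coe_edgeFinset, Set.ncard_coe_finset,
    ← SimpleGraph.sum_degrees_eq_twice_card_edges]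
  refine Finset.sum_congr rfl fun v _ => ?_
  rw [← SimpleGraph.card_neighborFinset_eq_degree, ← Set.ncard_coe_finset,
    SimpleGraph.coe_neighborFinset]

open Classical in
theorem sum_min_degree_le [Fintype V] (G : SimpleGraph V) :
    ∑ v, ∑ w, (if G.Adj v w then min (G.neighborSet v).ncard (G.neighborSet w).ncard else 0) ≤
      4 * (arboricity G * numEdges G) := by
  refine (sum_min_le G _).trans (le_of_eq ?_)
  rw [sum_ncard_neighborSet]
  ring

/-- The minimum of the degrees over an edge is at least one. This absorbs the terms linear in `m`
into `αm`. -/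
theorem numEdges_le [Fintype V] (G : SimpleGraph V) :
    numEdges G ≤ 2 * (arboricity G * numEdges G) := by
  classical
  have h : ∑ v, (G.neighborSet v).ncard ≤ ∑ v, ∑ w,
      (if G.Adj v w then min (G.neighborSet v).ncard (G.neighborSet w).ncard else 0) := by
    refine Finset.sum_le_sum fun v _ => ?_
    have hcard : (G.neighborSet v).ncard = ∑ w, if G.Adj v w then 1 else 0 := by
      rw [Finset.sum_boole, Nat.cast_id, ← Set.ncard_coe_finset]
      congr 1
      ext w
      simp
    rw [hcard]
    refine Finset.sum_le_sum fun w _ => ?_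
    rw [← hcard]
    split_ifs with hvw
    · refine le_min ?_ ?_
      · exact (Set.ncard_pos (Set.toFinite _)).2 ⟨w, hvw⟩
      · exact (Set.ncard_pos (Set.toFinite _)).2 ⟨v, hvw.symm⟩
    · exact le_rfl
  have := sum_min_degree_le G
  rw [sum_ncard_neighborSet] at h
  omega

theorem card_le_of_forall_exists_adj [Fintype V] (G : SimpleGraph V) (h : ∀ v, ∃ w, G.Adj v w) :
    Fintype.card V ≤ 2 * numEdges G := by
  rw [← sum_ncard_neighborSet, ← smul_eq_mul (Fintype.card V) 1 |>.trans (mul_one _)]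
  refine Finset.card_nsmul_le_sum _ _ _ fun v _ => ?_
  obtain ⟨w, hw⟩ := h v
  exact (Set.ncard_pos (Set.toFinite _)).2 ⟨w, hw⟩

end Arboricity

/-! ### Graphs on `Fin n` as graphs on the natural numbers -/

section Transfer

variable {n : ℕ} {G : SimpleGraph (Fin n)}

theorem map_adj_iff {i : Fin n} {x : ℕ} :
    (G.map Fin.valEmbedding).Adj i x ↔ ∃ j : Fin n, x = j ∧ G.Adj i j := by
  constructor
  · rintro ⟨-, a, b, h, ha, hb⟩
    obtain rfl : a = i := Fin.ext ha
    exact ⟨b, hb.symm, h⟩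
  · rintro ⟨j, rfl, h⟩
    exact SimpleGraph.map_adj_apply.2 h

theorem exists_of_map_adj {x y : ℕ} (h : (G.map Fin.valEmbedding).Adj x y) :
    ∃ i : Fin n, x = i := by
  obtain ⟨-, a, b, h, ha, hb⟩ := h
  exact ⟨a, ha.symm⟩

theorem map_adj_coe {i j : Fin n} : (G.map Fin.valEmbedding).Adj i j ↔ G.Adj i j :=
  SimpleGraph.map_adj_apply (f := Fin.valEmbedding)

theorem map_dominates {i j : Fin n} :
    Dominates (G.map Fin.valEmbedding) (i : ℕ) j ↔ Dominates G i j := by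
  constructor
  · intro h x hx
    exact map_adj_coe.1 (h (map_adj_coe.2 hx))
  · rintro h x hx
    obtain ⟨k, rfl, hk⟩ := map_adj_iff.1 hx
    exact map_adj_coe.2 (h hk)

theorem map_leastCommon {i j a : Fin n} :
    (a : ℕ) ∈ leastCommon (G.map Fin.valEmbedding) (i : ℕ) j ↔ a ∈ leastCommon G i j := by
  simp only [leastCommon, Set.mem_ofPred_eq, map_adj_coe, Fin.lt_def]

theorem map_unsafe {i j : Fin n} :
    Unsafe (G.map Fin.valEmbedding) (i : ℕ) j ↔ Unsafe G i j := by
  simp only [Unsafe, IsTriple, map_dominates, ← Fin.lt_def]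
  refine and_congr_left fun _ => and_congr_right fun _ => ⟨?_, ?_⟩
  · rintro ⟨x, hx⟩
    obtain ⟨a, rfl⟩ := exists_of_map_adj hx.1.symm
    exact ⟨a, map_leastCommon.1 hx⟩
  · rintro ⟨a, ha⟩
    exact ⟨a, map_leastCommon.2 ha⟩

theorem map_isNext {i j a b : Fin n} :
    IsNext (G.map Fin.valEmbedding) (i : ℕ) j a b ↔ IsNext G i j a b := by
  simp only [IsNext, map_leastCommon, ← Fin.lt_def]
  refine and_congr_right fun _ => and_congr_right fun _ => and_congr_right fun _ =>
    not_congr ⟨?_, ?_⟩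
  · rintro ⟨x, hx, h⟩
    obtain ⟨c, rfl⟩ := exists_of_map_adj hx.1.symm
    exact ⟨c, map_leastCommon.1 hx, h⟩
  · rintro ⟨c, hc, h⟩
    exact ⟨c, map_leastCommon.2 hc, h⟩

theorem map_bad {i j a b : Fin n} :
    Bad (G.map Fin.valEmbedding) (i : ℕ) j a b ↔ Bad G i j a b := by
  simp only [Bad, map_unsafe, map_isNext, map_dominates]

theorem exists_of_isNext {v w a b : ℕ} (h : IsNext (G.map Fin.valEmbedding) v w a b) :
    ∃ i j c d : Fin n, v = i ∧ w = j ∧ a = c ∧ b = d := by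
  obtain ⟨i, hi⟩ := exists_of_map_adj h.1.1
  obtain ⟨j, hj⟩ := exists_of_map_adj h.1.2.1
  obtain ⟨c, hc⟩ := exists_of_map_adj h.1.1.symm
  obtain ⟨d, hd⟩ := exists_of_map_adj h.2.1.1.symm
  exact ⟨i, j, c, d, hi, hj, hc, hd⟩

theorem GoodOn.of_map {T : Set ℕ} (h : GoodOn (G.map Fin.valEmbedding) T) :
    GoodOn G {i | (i : ℕ) ∈ T} :=
  fun i hi j a b hb => h i hi j a b (map_bad.2 hb)

theorem edgeIn_map_iff {a b : Fin n} : EdgeIn (G.map Fin.valEmbedding) (Set.Ici 0) (a : ℕ) b ↔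
    (unsafeDigraph G).Adj a b := by
  constructor
  · rintro ⟨v, -, w, hu, hn⟩
    obtain ⟨i, j, -, -, rfl, rfl, -, -⟩ := exists_of_isNext hn
    exact ⟨i, j, (map_unsafe.1 hu).1, (map_unsafe.1 hu).2, map_isNext.1 hn⟩
  · rintro ⟨v, w, ht, hd, hn⟩
    exact ⟨v, Nat.zero_le _, w, map_unsafe.2 ⟨ht, hd⟩, map_isNext.2 hn⟩

end Transfer

/-! ### Invariance under relabeling -/

section Comap

variable {V : Type*} {G : SimpleGraph V} {σ : Equiv.Perm V}

theorem dominates_comap {v w : V} : Dominates (G.comap σ) v w ↔ Dominates G (σ v) (σ w) := by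
  constructor
  · intro h x hx
    have := @h (σ.symm x) (by simpa using hx)
    simpa using this
  · intro h x hx
    exact h hx

theorem c4Dominated_comap : C4Dominated (G.comap σ) ↔ C4Dominated G := by
  have hC : ∀ {v a w b}, IsC4 (G.comap σ) v a w b ↔ IsC4 G (σ v) (σ a) (σ w) (σ b) :=
    fun {v a w b} => ⟨fun h => ⟨h.1, h.2, h.3, h.4, σ.injective.ne h.5, σ.injective.ne h.6⟩,
      fun h => ⟨h.1, h.2, h.3, h.4, fun he => h.5 (he ▸ rfl), fun he => h.6 (he ▸ rfl)⟩⟩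
  simp only [C4Dominated, DomComparable, dominates_comap, hC]
  constructor
  · intro h v a w b
    simpa using h (σ.symm v) (σ.symm a) (σ.symm w) (σ.symm b)
  · intro h v a w b
    exact h _ _ _ _

theorem cliqueFree_comap : (G.comap σ).CliqueFree 3 ↔ G.CliqueFree 3 :=
  ⟨fun h => h.comap (SimpleGraph.Iso.comap σ G).isContained',
    fun h => h.comap (SimpleGraph.Iso.comap σ G).isContained⟩

end Comap

/-! ### Encoded inputs and the global time bound -/

section Input

variable {n : ℕ} {G : SimpleGraph (Fin n)} {s : Store} {W M : ℕ}

theorem Encodes.inputAdj (h : Encodes G s) :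
    InputAdj n (G.map Fin.valEmbedding) (s.arr 0) (s.arr 1) := by
  refine ⟨h.offset_zero, fun u hu => h.offset_le ⟨u, hu⟩, fun u x hux => ?_, fun u hu x => ?_,
    fun u hu => h.list_injOn ⟨u, hu⟩⟩
  · obtain ⟨i, rfl⟩ := exists_of_map_adj hux
    exact i.2
  · rw [show u = ((⟨u, hu⟩ : Fin n) : ℕ) from rfl, map_adj_iff]
    constructor
    · rintro ⟨j, rfl, hj⟩
      obtain ⟨k, hk, hkj⟩ := (h.mem_list _ _).1 hj
      exact ⟨k, hk.1, hk.2, hkj⟩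
    · rintro ⟨k, h1, h2, hk⟩
      have hmono : ∀ j, j ≤ n → s.arr 0 j ≤ s.arr 0 n := by
        intro j hj
        induction hj using Nat.decreasingInduction with
        | self => exact le_rfl
        | of_succ j hj ih => exact (h.offset_le ⟨j, hj⟩).trans ih
      have hx : x < n := hk ▸ h.list_lt k (h2.trans_le (hmono (u + 1) hu))
      exact ⟨⟨x, hx⟩, rfl, (h.mem_list _ _).2 ⟨k, ⟨h1, h2⟩, hk⟩⟩

theorem ncard_map_adj (u : Fin n) :
    {x | (G.map Fin.valEmbedding).Adj u x}.ncard = (G.neighborSet u).ncard := by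
  rw [← Set.ncard_image_of_injective (G.neighborSet u) Fin.val_injective]
  congr 1
  ext x
  rw [Set.mem_ofPred_eq, map_adj_iff]
  constructor
  · rintro ⟨j, rfl, h⟩
    exact ⟨j, h, rfl⟩
  · rintro ⟨j, h, rfl⟩
    exact ⟨j, rfl, h⟩

theorem Encodes.listLength_eq (h : Encodes G s) (u : Fin n) :
    listLength (s.arr 0) u = (G.neighborSet u).ncard := by
  rw [← h.inputAdj.ncard_adj u.2, ncard_map_adj]

theorem Encodes.offset_last (h : Encodes G s) : s.arr 0 n = 2 * numEdges G := by
  rw [← sum_ncard_neighborSet, ← sum_listLength h.inputAdj.off_zero h.inputAdj.off_le,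
    Finset.sum_range]
  exact Finset.sum_congr rfl fun u _ => h.listLength_eq u

theorem Encodes.bdd (h : Encodes G s) : s.Bdd (n + 2 * numEdges G + 1) := by
  have hmono : ∀ j, j ≤ n → s.arr 0 j ≤ s.arr 0 n := by
    intro j hj
    induction hj using Nat.decreasingInduction with
    | self => exact le_rfl
    | of_succ j hj ih => exact (h.offset_le ⟨j, hj⟩).trans ih
  refine ⟨fun x => ?_, fun A i => ?_⟩
  · by_cases hx : x = 0
    · rw [hx, h.size]
      omega
    · rw [h.reg_eq_zero x hx]
      omega
  · rcases Nat.lt_or_ge A 2 with hA | hA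
    · interval_cases A
      · rcases Nat.lt_or_ge n i with hi | hi
        · rw [h.offset_eq_zero i hi]
          omega
        · have := hmono i hi
          rw [h.offset_last] at this
          omega
      · rcases Nat.lt_or_ge i (s.arr 0 n) with hi | hi
        · have := h.list_lt i hi
          omega
        · rw [h.list_eq_zero i hi]
          omega
    · rw [h.arr_eq_zero A hA]
      omega

/-- All input words are at most `M = n + 2m + 1`, and `60 (n + m + 1)` exceeds `20 M`. -/
theorem runsWithin_of_runs {P : Cmd} {post : Store → Prop} (K : ℕ)
    (h : ∀ s, Encodes G s → ∀ W M, Runs W M P s fun t s' =>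
      t ≤ K * (n + arboricity G * numEdges G + 1) ∧ post s') :
    RunsWithin P (9 * K + 60) G post := by
  intro s hs
  have hW : 20 * (n + 2 * numEdges G + 1) < (9 * K + 60) * (n + numEdges G + 1) := by
    rw [add_mul]
    omega
  obtain ⟨t, s', he, -, ht, hp⟩ := h s hs _ _ (by omega) hW hs.bdd
  refine ⟨t, s', he, hp, ht.trans (Nat.mul_le_mul_right _ (by omega)), fun hn hiso => ht.trans ?_⟩
  have h1 := card_le_of_forall_exists_adj G hiso
  have h2 := numEdges_le G
  rw [Fintype.card_fin] at h1
  -- Without isolated vertices `n ≤ 2m ≤ 4αm`, and `1 ≤ n` bounds the last summand by `4αm` as well,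
  -- which gives `4 + 1 + 4 = 9`.
  calc K * (n + arboricity G * numEdges G + 1)
      ≤ K * (9 * (arboricity G * numEdges G)) := Nat.mul_le_mul_left _ (by omega)
    _ = 9 * K * (arboricity G * numEdges G) := by ring
    _ ≤ _ := Nat.mul_le_mul_right _ (by omega)

theorem SortedAdj.sum_eq {H : SimpleGraph ℕ} {off adj : ℕ → ℕ} (hA : SortedAdj n H off adj)
    {v : ℕ} (hv : v < n) (f : ℕ → ℕ) [DecidableRel H.Adj] :
    ∑ k ∈ Finset.Ico (off v) (off (v + 1)), f (adj k) =
      ∑ w ∈ Finset.range n, if H.Adj v w then f w else 0 := by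
  have hinj := injOn_Ico_of_strict (hA.strict v hv)
  have himg : (Finset.Ico (off v) (off (v + 1))).image adj =
      (Finset.range n).filter fun w => H.Adj v w := by
    ext w
    simp only [Finset.mem_image, Finset.mem_Ico, Finset.mem_filter, Finset.mem_range,
      hA.mem v hv w]
    constructor
    · rintro ⟨k, hk, rfl⟩
      exact ⟨hA.lt _ v ((hA.mem v hv _).2 ⟨k, hk.1, hk.2, rfl⟩).symm, k, hk.1, hk.2, rfl⟩
    · rintro ⟨-, k, h1, h2, h3⟩
      exact ⟨k, ⟨h1, h2⟩, h3⟩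
  rw [← Finset.sum_filter, ← himg, Finset.sum_image]
  rwa [Finset.coe_Ico]

/-- The inner list is scanned only for `a < v`, where the degree ordering makes its length `d(a)`
equal to `min (d v) (d a)`. The double sum is then the one bounded through the arboricity. -/
theorem sum_stepsNN_le {σ : Equiv.Perm (Fin n)} {off adj : ℕ → ℕ}
    (hA : SortedAdj n ((G.comap σ).map Fin.valEmbedding) off adj)
    (hdeg : IsDegreeOrdered (G.comap σ)) :
    ∑ v ∈ Finset.range n, stepsNN off adj v ≤
      n + 2 * numEdges G + 4 * (arboricity G * numEdges G) := by
  classical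
  have hlen : ∀ v : Fin n, off (v + 1) - off v = (G.neighborSet (σ v)).ncard := by
    intro v
    rw [← hA.ncard_adj v.2, ncard_map_adj, ← Set.ncard_image_of_injective _ σ.injective]
    congr 1
    ext x
    constructor
    · rintro ⟨y, hy, rfl⟩
      exact hy
    · intro hx
      exact ⟨σ.symm x, by simpa using hx, by simp⟩
  have hstep : ∀ v : Fin n, stepsNN off adj v ≤ 1 + (G.neighborSet (σ v)).ncard +
      ∑ w : Fin n, if G.Adj (σ v) (σ w) then
        min (G.neighborSet (σ v)).ncard (G.neighborSet (σ w)).ncard else 0 := by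
    intro v
    rw [stepsNN, Finset.sum_add_distrib, Finset.sum_const, Nat.card_Ico, smul_eq_mul, mul_one,
      hlen, ← add_assoc]
    refine Nat.add_le_add_left ?_ _
    rw [hA.sum_eq v.2 fun a => if a < v then off (a + 1) - off a else 0, Finset.sum_range]
    refine Finset.sum_le_sum fun w _ => ?_
    simp only [map_adj_coe, SimpleGraph.comap_adj]
    split_ifs with h1 h2
    · refine le_min ?_ (hlen w).le
      rw [← hlen v, ← hA.ncard_adj w.2, ← hA.ncard_adj v.2, ncard_map_adj, ncard_map_adj]
      exact hdeg w v h2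
    · exact Nat.zero_le _
    · exact le_rfl
  rw [Finset.sum_range]
  refine (Finset.sum_le_sum fun v _ => hstep v).trans ?_
  rw [Finset.sum_add_distrib, Finset.sum_add_distrib]
  refine Nat.add_le_add (Nat.add_le_add (by simp) ?_) ?_
  · rw [Equiv.sum_comp σ fun v => (G.neighborSet v).ncard, sum_ncard_neighborSet]
  · rw [Equiv.sum_comp σ fun v => ∑ w : Fin n, if G.Adj v (σ w) then
      min (G.neighborSet v).ncard (G.neighborSet (σ w)).ncard else 0]
    refine le_trans (le_of_eq (Finset.sum_congr rfl fun v _ => ?_)) (sum_min_degree_le G)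
    exact Equiv.sum_comp σ fun w => if G.Adj v w then
      min (G.neighborSet v).ncard (G.neighborSet w).ncard else 0

/-- For a degree-ordered input the relabeled graph is the graph itself, so the same preparation
serves the algorithm, whose output refers to the given order, and the recognition of arbitrary
graphs. -/
theorem runs_prepCmd_of_encodes (h : Encodes G s) :
    Runs W M prepCmd s fun t s' => t ≤ 300 * (n + 2 * numEdges G + 1) ∧
      ∃ σ : Equiv.Perm (Fin n),
        SortedAdj n ((G.comap σ).map Fin.valEmbedding) (s'.arr 3) (s'.arr 4) ∧
        IsDegreeOrdered (G.comap σ) ∧ (IsDegreeOrdered G → G.comap σ = G) := by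
  refine (runs_prepCmd h.inputAdj rfl rfl h.size (h.arr_eq_zero 3 (by omega) 0)
    (h.arr_eq_zero 8 (by omega))).mono ?_
  rintro t s' - - - ⟨ht, rank, inv, hR, hS, hlen, hdeg, hid⟩
  rw [h.offset_last] at ht
  let σ : Equiv.Perm (Fin n) :=
    { toFun := fun i => ⟨inv i, hR.inv_lt i i.2⟩
      invFun := fun u => ⟨rank u, hR.rank_lt u u.2⟩
      left_inv := fun i => Fin.ext (hR.rank_inv i i.2)
      right_inv := fun u => Fin.ext (hR.inv_rank u u.2) }
  have hmap : relabel n (G.map Fin.valEmbedding) inv = (G.comap σ).map Fin.valEmbedding := by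
    ext x y
    constructor
    · rintro ⟨hx, hy, hxy⟩
      exact (map_adj_coe (i := ⟨x, hx⟩) (j := ⟨y, hy⟩)).2
        ((map_adj_coe (i := σ ⟨x, hx⟩) (j := σ ⟨y, hy⟩)).1 hxy)
    · intro hxy
      obtain ⟨i, rfl⟩ := exists_of_map_adj hxy
      obtain ⟨j, rfl⟩ := exists_of_map_adj hxy.symm
      exact ⟨i.2, j.2, (map_adj_coe (i := σ i) (j := σ j)).2
        ((map_adj_coe (G := G.comap σ) (i := i) (j := j)).1 hxy)⟩
  rw [hmap] at hS
  refine ⟨ht, σ, hS, fun v w hvw => ?_, fun hG => ?_⟩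
  · have h1 := hdeg v w hvw w.2
    rw [← hlen v v.2, ← hlen w w.2] at h1
    rw [← ncard_map_adj v, ← ncard_map_adj w, hS.ncard_adj v.2, hS.ncard_adj w.2]
    exact h1
  · have hinv := hid fun x u hxu hu => by
      rw [h.listLength_eq ⟨x, hxu.trans hu⟩, h.listLength_eq ⟨u, hu⟩]
      exact hG _ _ hxu
    have hσ : ∀ i, σ i = i := fun i => Fin.ext (hinv i i.2)
    ext i j
    rw [SimpleGraph.comap_adj, hσ, hσ]

end Input

/-! ### The two programs and the theorem -/

section Main

variable {n : ℕ} {G : SimpleGraph (Fin n)} {s : Store} {W M : ℕ}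

def outputCmd : Cmd :=
  .seq (.setReg 1 (.cell 14 (.lit 1))) <| .seq (.setReg 2 (.cell 14 (.lit 2))) <|
    .seq (.setReg 3 (.cell 14 (.lit 3))) <| .seq (.setReg 4 (.cell 14 (.lit 4)))
      (.setReg 0 (.cell 14 (.lit 0)))

/-- The implementation of the algorithm. -/
def algorithmCmd : Cmd := .seq prepCmd (.seq coreCmd outputCmd)

/-- The recognition of triangle-free `C₄`-dominated graphs. -/
def recognizeCmd : Cmd :=
  .seq prepCmd <| .seq triangleCmd <| .ifNonzero (.cell 14 (.lit 5)) (.setReg 0 (.lit 0))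
    (.seq coreCmd (.setReg 0 (.minus (.lit 1) (.cell 14 (.lit 0)))))

/-- Some schedule. -/
noncomputable def Schedule.trivial (V : Type*) [Fintype V] : Schedule V where
  lows _ := (Finset.univ : Finset V).toList
  lows_nodup _ := Finset.nodup_toList _
  mem_lows _ _ := by simp
  pairs _ _ := (Finset.univ : Finset (V × V)).toList
  pairs_nodup _ _ := Finset.nodup_toList _
  mem_pairs _ _ _ := by simp

theorem CoreInv.firstBad {next mark dlt fl : ℕ → ℕ}
    (h : CoreInv (G.map Fin.valEmbedding) 0 next mark dlt fl) (hf : fl 0 ≠ 0) :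
    fl 0 = 1 ∧ ∃ v w a b : Fin n, FirstBad G v w a b ∧
      fl 1 = v ∧ fl 2 = a ∧ fl 3 = w ∧ fl 4 = b := by
  obtain ⟨h1, hb, hgood⟩ := h.flag.resolve_left hf
  obtain ⟨v, w, a, b, hv, hw, ha, hb'⟩ := exists_of_isNext hb.2.1
  rw [hv, hw, ha, hb'] at hb
  rw [hv] at hgood
  exact ⟨h1, v, w, a, b, ⟨map_bad.1 hb, hgood.of_map⟩, hv, ha, hw, hb'⟩

theorem CoreInv.goodOn {next mark dlt fl : ℕ → ℕ}
    (h : CoreInv (G.map Fin.valEmbedding) 0 next mark dlt fl) (hf : fl 0 = 0) :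
    GoodOn G Set.univ :=
  fun v _ => (h.good hf).of_map v (Nat.zero_le _)

/-- Without a failure no pair is bad, and the output is `U(G)` under every schedule, so any one will
do. With a failure the recorded quadruple is a first bad one, and the schedule headed by it produces
exactly this output. -/
theorem CoreInv.represents {next mark dlt fl : ℕ → ℕ} (hG : G.CliqueFree 3)
    (h : CoreInv (G.map Fin.valEmbedding) 0 next mark dlt fl) (h2 : s.arr 2 = next)
    (hr : ∀ x ≤ 4, s.reg x = fl x) :
    ∃ sch : Schedule (Fin n), Represents s (algorithm G sch) := by
  by_cases hf : fl 0 = 0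
  · refine ⟨Schedule.trivial _, ?_⟩
    have hgood := h.goodOn hf
    rcases algorithm_spec hG (Schedule.trivial (Fin n)) with ⟨v, w, a, b, -, hb⟩ | ⟨he, -⟩
    · exact absurd hb.1 (hgood v trivial w a b)
    · rw [he]
      refine ⟨(hr 0 (by omega)).trans hf, fun a => ⟨?_, fun b => ?_⟩⟩
      · rw [h2]
        by_cases h0 : next a = 0
        · omega
        · obtain ⟨b, hb⟩ := Nat.exists_eq_add_one_of_ne_zero h0
          obtain ⟨v, -, w, -, hn⟩ := (h.next_iff hf _ _).1 hb
          obtain ⟨-, -, -, d, -, -, -, hd⟩ := exists_of_isNext hn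
          omega
      · rw [← edgeIn_map_iff, ← h.next_iff hf, h2]
  · obtain ⟨h1, v, w, a, b, hb, hv, ha, hw, hb'⟩ := h.firstBad hf
    refine ⟨Schedule.headed w a b, ?_⟩
    rw [algorithm_headed hG hb]
    exact ⟨(hr 0 (by omega)).trans h1, (hr 1 (by omega)).trans hv, (hr 2 (by omega)).trans ha,
      (hr 3 (by omega)).trans hw, (hr 4 (by omega)).trans hb'⟩

theorem runs_outputCmd : Runs W M outputCmd s fun t s' => t ≤ 30 ∧ s'.arr = s.arr ∧
    ∀ x ≤ 4, s'.reg x = s.arr 14 x := by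
  refine Runs.seq (Runs.setReg (by decide) (fun _ h => h.2 14 _) ?_)
  refine Runs.seq (Runs.setReg (by decide) (fun _ h => h.2 14 _) ?_)
  refine Runs.seq (Runs.setReg (by decide) (fun _ h => h.2 14 _) ?_)
  refine Runs.seq (Runs.setReg (by decide) (fun _ h => h.2 14 _) ?_)
  refine Runs.setReg (by decide) (fun _ h => h.2 14 _) ⟨by simp [Exp.cost], rfl, ?_⟩
  intro x hx
  interval_cases x <;> simp [Store.setReg_reg, Store.setReg_arr, Exp.val]

theorem stampInv_of_eq_zero {H : SimpleGraph ℕ} {stamp : ℕ → ℕ} (h : ∀ x, stamp x = 0) :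
    StampInv H stamp := by
  intro x b hb
  rw [h x] at hb
  omega

theorem prepCmd_writesArr {A : ℕ} (hA : 9 ≤ A ∨ A = 2) : prepCmd.writesArr A = false := by
  simp [prepCmd, degreeSort, countDegrees, prefixSums, placeVertices, offsetsCmd,
    transposeCmd, forTo, Cmd.writesArr]
  omega

theorem cliqueFree_map : (G.map Fin.valEmbedding).CliqueFree 3 ↔ G.CliqueFree 3 := by
  have hlt : ∀ u x, (G.map Fin.valEmbedding).Adj u x → u < n := fun u x h => by
    obtain ⟨i, rfl⟩ := exists_of_map_adj h
    exact i.2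
  refine ⟨fun h => h.comap (SimpleGraph.Embedding.map Fin.valEmbedding G).isContained,
    fun h => ?_⟩
  by_contra hcon
  obtain ⟨v, hv, a, w, ⟨h1, -, h2⟩, h3⟩ := (not_cliqueFree_three_iff hlt).1 hcon
  obtain ⟨i, rfl⟩ := exists_of_map_adj h1
  obtain ⟨j, rfl⟩ := exists_of_map_adj h2
  obtain ⟨k, rfl⟩ := exists_of_map_adj h2.symm
  exact CliqueFree.not_adj h (map_adj_coe.1 h1) (map_adj_coe.1 h2) (map_adj_coe.1 h3)

theorem runs_algorithmCmd (hG : G.CliqueFree 3) (hdeg : IsDegreeOrdered G) (hs : Encodes G s) :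
    Runs W M algorithmCmd s fun t s' => t ≤ 20000 * (n + arboricity G * numEdges G + 1) ∧
      ∃ sch : Schedule (Fin n), Represents s' (algorithm G sch) := by
  refine Runs.seq ((runs_prepCmd_of_encodes hs).mono ?_)
  rintro t₁ s₁ - - hF₁ ⟨ht₁, σ, hA, hdeg', hid⟩
  have hsum := sum_stepsNN_le hA hdeg'
  have hm := numEdges_le G
  rw [hid hdeg] at hA
  have hzero : ∀ A, 9 ≤ A ∨ A = 2 → ∀ i, s₁.arr A i = 0 := fun A h => by
    rw [hF₁.2 A (prepCmd_writesArr h)]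
    exact hs.arr_eq_zero A (by omega)
  refine Runs.seq ((runs_coreCmd (cliqueFree_map.2 hG) hA rfl rfl
    (by rw [hF₁.1 0 (by decide), hs.size])
    (hzero 2 (by omega)) (hzero 12 (by omega)) (hzero 14 (by omega) 0)
    (stampInv_of_eq_zero (hzero 13 (by omega)))).mono ?_)
  rintro t₂ s₂ - - hF₂ ⟨ht₂, hC⟩
  refine runs_outputCmd.mono ?_
  rintro t₃ s₃ - - - ⟨ht₃, harr, hr⟩
  exact ⟨by omega, hC.represents hG (by rw [harr]) hr⟩

/-- Both properties are invariant under relabeling, so they are decided on the degree-sorted copy.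
The core runs only after triangles have been excluded, and there the absence of a failure is
equivalent to being `C₄`-dominated. -/
theorem runs_recognizeCmd (hs : Encodes G s) :
    Runs W M recognizeCmd s fun t s' => t ≤ 20000 * (n + arboricity G * numEdges G + 1) ∧
      (G.CliqueFree 3 ∧ C4Dominated G → s'.reg 0 = 1) ∧
      (¬ (G.CliqueFree 3 ∧ C4Dominated G) → s'.reg 0 = 0) := by
  refine Runs.seq ((runs_prepCmd_of_encodes hs).mono ?_)
  rintro t₁ s₁ - - hF₁ ⟨ht₁, σ, hA, hdeg, -⟩
  have hsum := sum_stepsNN_le hA hdeg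
  have hm := numEdges_le G
  have hzero : ∀ A, 9 ≤ A ∨ A = 2 → ∀ i, s₁.arr A i = 0 := fun A h => by
    rw [hF₁.2 A (prepCmd_writesArr h)]
    exact hs.arr_eq_zero A (by omega)
  have hn : s₁.reg 0 = n := by rw [hF₁.1 0 (by decide), hs.size]
  rw [← c4Dominated_comap (σ := σ), ← cliqueFree_comap (σ := σ)]
  refine Runs.seq ((runs_triangleCmd hA rfl rfl hn
    (stampInv_of_eq_zero (hzero 13 (by omega))) (hzero 14 (by omega) 5)).mono ?_)
  rintro t₂ s₂ - - hF₂ ⟨ht₂, hfree, h14, hst⟩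
  rw [cliqueFree_map] at hfree
  refine Runs.ifNonzero (by decide) (fun h5 => ?_) fun h5 => ?_
  · have hnot : ¬ (G.comap σ).CliqueFree 3 := fun h => h5 (hfree.2 h)
    refine Runs.setReg (by decide) (fun _ _ => Nat.zero_le _) ⟨?_, ?_, ?_⟩
    · simp only [Exp.cost]
      omega
    · exact fun h => absurd h.1 hnot
    · exact fun _ => by simp [Store.setReg_reg, Exp.val]
  · have hG := hfree.1 h5
    refine Runs.seq ((runs_coreCmd (cliqueFree_map.2 hG) hA (hF₂.2 3 (by decide))
      (hF₂.2 4 (by decide)) (by rw [hF₂.1 0 (by decide), hn])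
      (by rw [hF₂.2 2 (by decide)]; exact hzero 2 (by omega))
      (by rw [hF₂.2 12 (by decide)]; exact hzero 12 (by omega))
      (h14.trans (hzero 14 (by omega) 0)) hst).mono ?_)
    rintro t₃ s₃ - - - ⟨ht₃, hC⟩
    refine Runs.setReg (by decide) (fun hM _ => (Nat.sub_le _ _).trans hM) ⟨?_, ?_, ?_⟩
    · simp only [Exp.cost]
      omega
    · rintro ⟨-, h⟩
      by_cases hf : s₃.arr 14 0 = 0
      · simp [Store.setReg_reg, Exp.val, hf]
      · obtain ⟨-, v, w, a, b, hb, -⟩ := hC.firstBad hf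
        exact absurd h (hb.1.not_c4Dominated hdeg)
    · intro h
      have hf : s₃.arr 14 0 ≠ 0 := fun hf =>
        h ⟨hG, c4Dominated_of_goodOn (fun _ => Set.toFinite _) (hC.goodOn hf)⟩
      simp only [Store.setReg_reg, Exp.val, if_true]
      omega

end Main

end C4Dom

theorem mainTheorem3 :
    -- correctness of the algorithm, whatever the order in which its loops are run
    (∀ (V : Type*) [Fintype V] [LinearOrder V] (G : SimpleGraph V),
      G.CliqueFree 3 → C4Dom.IsDegreeOrdered G → ∀ sch : C4Dom.Schedule V,
        (∃ v a w b, C4Dom.algorithm G sch = .error (v, a, w, b) ∧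
          C4Dom.NonDominatedC4 G v a w b ∧ ¬ C4Dom.C4Dominated G) ∨
        (C4Dom.algorithm G sch = .ok (C4Dom.unsafeDigraph G) ∧ C4Dom.C4Dominated G)) ∧
    -- implementation of the algorithm
    (∃ (P : C4Dom.Cmd) (C : ℕ), ∀ (n : ℕ) (G : SimpleGraph (Fin n)),
      G.CliqueFree 3 → C4Dom.IsDegreeOrdered G →
        C4Dom.RunsWithin P C G fun s =>
          ∃ sch : C4Dom.Schedule (Fin n), C4Dom.Represents s (C4Dom.algorithm G sch)) ∧
    -- recognition of triangle-free C4-dominated graphs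
    (∃ (P : C4Dom.Cmd) (C : ℕ), ∀ (n : ℕ) (G : SimpleGraph (Fin n)),
        C4Dom.RunsWithin P C G fun s =>
          (G.CliqueFree 3 ∧ C4Dom.C4Dominated G → s.reg 0 = 1) ∧
          (¬ (G.CliqueFree 3 ∧ C4Dom.C4Dominated G) → s.reg 0 = 0)) := by
  exact ⟨fun V _ _ G hG hd sch => C4Dom.algorithm_correct hG hd sch,
    ⟨C4Dom.algorithmCmd, _, fun n G hG hd => C4Dom.runsWithin_of_runs 20000 fun s hs W M =>
      C4Dom.runs_algorithmCmd hG hd hs⟩,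
    ⟨C4Dom.recognizeCmd, _, fun n G => C4Dom.runsWithin_of_runs 20000 fun s hs W M =>
      C4Dom.runs_recognizeCmd hs⟩⟩
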